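/- **Setting.** Let $d\in\{1,2,3\}$, let $\Omega\subset\mathbb R^d$ be a bounded open polyhedral domain and $T>0$. Let $a,c$ (scalar) and $b$ (vector) be smooth on $\overline\Omega\times[0,T]$ with $a\ge\bar a>0$, $c\ge\bar c\ge0$. Consider $u_t-\nabla\cdot(a\nabla u)+b\cdot\nabla u+cu=f$ in $\Omega\times(0,T]$, $a\nabla u\cdot n=g$ on $\partial\Omega\times(0,T]$, $u(\cdot,0)=u_0$, with $f$ smooth, $g(\cdot,t)\in L^1(\partial\Omega)$, $u_0\in L^2(\Omega)$. Write $(\cdot,\cdot)$ for the $L^2(\Omega)$ inner product, $\langle\cdot,\cdot\rangle$ for that of $L^2(\partial\Omega)$, and $\|\cdot\|_0,\ |\cdot|_1,\ \|\cdot\|_1$ for the $L^2(\Omega)$ norm and the $H^1(\Omega)$ semi-norm and norm. *Moving mesh.* Let $0=t_0<t_1<\dots<t_m=T$, $\Delta t_i=t_i-t_{i-1}$. On each $[t_{i-1},t_i]$ there are finitely many vertices $x_k(t)$, quadratic polynomials in $t$, and a fixed list of simplices on these vertices which, for every $t\in[t_{i-1},t_i]$, form a conforming non-degenerate triangulation of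 $\Omega$; the mesh may change discontinuously at the $t_i$. An element $e$ with vertices $x_0(t),\dots,x_d(t)$ is the image of the unit simplex under $\hat x\mapsto \mathcal J_e(t)\hat x+x_0(t)$, $\det\mathcal J_e(t)\ne0$. The curves $t\mapsto x(t)=\mathcal J_e(t)\hat x+x_0(t)$ with $\hat x$ fixed are the characteristics, $x_t$ is the mesh velocity, and $v_\tau(x(t),t)=\frac{d}{dt}v(x(t),t)$ is the characteristic derivative (within one time partition). A function at time $s\in[t_{i-1},t_i]$ is shifted onto the mesh at time $t\in[t_{i-1},t_i]$ by following the characteristics. $\mathcal V_h(t)$ is the space of continuous functions on $\overline\Omega$ that are quadratic on each element at time $t$. $\mathcal V_h$ is the space of functions which on each $[t_{i-1},t_i]$ and each element are, in the variables $(\hat x,t)$, sums of products of a quadratic polynomial in $\hat x$ and one in $t$, which are continuous in space, and whose one-sided limits satisfy $(\phi(t_i^+),\chi)=(\phi(t_i^-),\chi)$ for all $\chi\in\mathcal V_h(t_i^+)$, $1\le i<m$; the value at $0$ is $\phi(0^+)$. *Weak solution.* With $\mathcal A_\tau(t;v,\chi)=\int_\Omega a\nabla v\cdot\nabla\chi+(b-x_t)\cdot\nabla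 v\,\chi+cv\chi\,dx$, the function $u$ satisfies $u(t)\in H^1(\Omega)$ for $0\le t\le T$, $u_\tau(t)\in L^2(\Omega)$ and $(u_\tau(t),\chi)+\mathcal A_\tau(t;u,\chi)=(f(t),\chi)+\langle g(t),\chi\rangle$ for $0<t\le T$ and all $\chi\in H^1(\Omega)\cap C(\overline\Omega)$, and $(u(0),\chi)=(u_0,\chi)$ for all $\chi\in H^1(\Omega)$. On each time partition $u$ is differentiable and $u_\tau$ is absolutely continuous along almost every characteristic, and $u_{\tau\tau}\in L^2(t_{i-1},t_i;H^1(\Omega))$. *Discrete solution.* Let $\varepsilon=\tfrac23$, $\zeta_{i,0}=t_{i-1}$, $\zeta_{i,1}=t_{i-1}+\varepsilon\Delta t_i$, $\zeta_{i,2}=t_i$ and let $t_{i,1}=t_{i-1}+\frac\varepsilon2\Delta t_i$, $t_{i,2}=t_i$ be the collocation nodes. Let $\tilde v$ and $\hat v$ denote $v$ shifted onto the mesh at $t_{i,1}$ and $t_{i,2}$, and $v_{TR}(t_{i,1})=\frac12(\tilde v(\zeta_{i,1})+\tilde v(\zeta_{i,0}))$. The TR-BDF2 solution $u_h\in\mathcal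 V_h$ satisfies $(u_h(0^+),\chi)=(u_0,\chi)$ for all $\chi\in\mathcal V_h(0^+)$ and, for $1\le i\le m$, $$\Big(\tfrac{\tilde u_h(\zeta_{i,1})-\tilde u_h(\zeta_{i,0})}{\varepsilon\Delta t_i},\chi\Big)+\mathcal A_\tau\big(t_{i,1};u_{h,TR}(t_{i,1}),\chi\big)=(f(t_{i,1}),\chi)+\langle g(t_{i,1}),\chi\rangle\quad\forall\chi\in\mathcal V_h(t_{i,1}),$$ $$\Big(\tfrac{\varepsilon(2-\varepsilon)\hat u_h(\zeta_{i,2})-\hat u_h(\zeta_{i,1})+(1-\varepsilon)^2\hat u_h(\zeta_{i,0})}{\varepsilon(1-\varepsilon)\Delta t_i},\chi\Big)+\mathcal A_\tau\big(t_i;\hat u_h(\zeta_{i,2}),\chi\big)=(f(t_i),\chi)+\langle g(t_i),\chi\rangle\quad\forall\chi\in\mathcal V_h(t_i^-).$$ *Energy semi-norm.* With $\|v\|_{(-1,V)}=\sup_{0\ne\chi\in V}|(v,\chi)|/\|\chi\|_1$, let $$|\!|\!|v|\!|\!|^2=\max\Big\{\|v(0)\|_0^2,\max_{1\le i\le m,\,1\le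 j\le2}\|v(t_{i,j})\|_0^2\Big\}+\sum_{i=1}^m\Delta t_i\Big(\|v_\tau(t_{i,1})\|^2_{(-1,\mathcal V_h(t_{i,1}))}+\|v_{TR}(t_{i,1})\|_1^2+\|v(\zeta_{i,1})\|_1^2+\|v_\tau(t_i^-)\|^2_{(-1,\mathcal V_h(t_i^-))}+\|v(t_i^-)\|_1^2\Big).$$ **Theorem.** Let $\mu,\kappa,C_{\mathcal H}>0$. There is a constant $C>0$, depending only on $\mu$, $\kappa$, $C_{\mathcal H}$, $d$, $\Omega$, $T$, $a$, $b$, $c$, such that for every $\alpha>0$ there is $\delta>0$ for which the following holds for every mesh as above with $\max_i\Delta t_i\le\delta$, all data $f,g,u_0$, and all $u,u_h$ as above. Assume that 1. $\|a_\tau\|_\infty\le\alpha$ and $\|b-x_t\|_\infty\le\kappa$ at each collocation node; 2. for every $i$, every element $e$ and every $t\in[t_{i-1},t_i]$ one has $\mathcal J_e(t)=(\mathcal R_e+\Delta t_i\mathcal H_e)\mathcal J_e(t_{i-1}^+)$ with $\mathcal R_e$ orthogonal and $\mathcal H_e$ of spectral norm at most $\mu$; 3. $\|a^{1/2}(t_i)\nabla\phi(t_i^+)\|_0^2\le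 C_{\mathcal A,\mathcal H}\|a^{1/2}(t_i)\nabla\phi(t_i^-)\|_0^2$ for all $\phi\in\mathcal V_h$ and $1\le i<m$, with some $C_{\mathcal A,\mathcal H}\le\frac72$, and the $L^2(\Omega)$-projection $P$ onto $\mathcal V_h(0^+)$ satisfies $|Pv|_1\le C_{\mathcal H}|v|_1$ for $v\in H^1(\Omega)$; 4. $\Delta t_i\le2\Delta t_{i-1}$ for $2\le i\le m$. Then $$|\!|\!|u-u_h|\!|\!|^2\le C\Big\{\inf_{\chi\in\mathcal V_h}|\!|\!|u-\chi|\!|\!|^2+\sum_{i=1}^m\int_{t_{i-1}}^{t_i}\|\Delta t_i^2\,u_{\tau\tau}(t)\|_1^2\,dt\Big\}.$$ -/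

import Mathlib

open MeasureTheory Set
open scoped ContDiff

noncomputable section

namespace MovingFE

/-- Euclidean space `ℝ^d`. -/
abbrev Sp (d : ℕ) := EuclideanSpace ℝ (Fin d)

variable {d : ℕ}

/-! ### The Sobolev space `H¹(Ω)` and its norms -/

/-- `G ∈ L²(Ω)^d` is a weak gradient of `v` on `Ω`. -/
def IsWeakGrad (Ω : Set (Sp d)) (v : Sp d → ℝ) (G : Sp d → Sp d) : Prop :=
  MemLp G 2 (volume.restrict Ω) ∧
    ∀ θ : Sp d → ℝ, ContDiff ℝ ∞ θ → HasCompactSupport θ → tsupport θ ⊆ Ω →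
      ∀ k : Fin d, ∫ x in Ω, v x * fderiv ℝ θ x (EuclideanSpace.single k 1)
        = - ∫ x in Ω, G x k * θ x

/-- Membership in `H¹(Ω)`. -/
def MemH1 (Ω : Set (Sp d)) (v : Sp d → ℝ) : Prop :=
  MemLp v 2 (volume.restrict Ω) ∧ ∃ G, IsWeakGrad Ω v G

open Classical in
/-- The weak gradient of `v` on `Ω` (a representative; it is unique almost everywhere), and `0` if
there is none. -/
def wgrad (Ω : Set (Sp d)) (v : Sp d → ℝ) : Sp d → Sp d :=
  if h : ∃ G, IsWeakGrad Ω v G then h.choose else 0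

/-- The inner product `(v, w)` of `L²(Ω)`. -/
def ip (Ω : Set (Sp d)) (v w : Sp d → ℝ) : ℝ := ∫ x in Ω, v x * w x

/-- The boundary pairing `⟨g, χ⟩`, with respect to surface measure on `∂Ω`. -/
def bip (Ω : Set (Sp d)) (g χ : Sp d → ℝ) : ℝ :=
  ∫ x in frontier Ω, g x * χ x ∂(Measure.euclideanHausdorffMeasure (d - 1))

/-- `‖v‖₀²`. -/
def norm0Sq (Ω : Set (Sp d)) (v : Sp d → ℝ) : ℝ := ∫ x in Ω, v x ^ 2

/-- The squared `H¹` semi-norm `|v|₁²`. -/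
def semi1Sq (Ω : Set (Sp d)) (v : Sp d → ℝ) : ℝ := ∫ x in Ω, ‖wgrad Ω v x‖ ^ 2

/-- The squared `H¹` norm `‖v‖₁²`. -/
def norm1Sq (Ω : Set (Sp d)) (v : Sp d → ℝ) : ℝ := norm0Sq Ω v + semi1Sq Ω v

/-- The diffusion-weighted semi-norm `‖a^{1/2} ∇v‖₀²` for a weight `a` on `Ω`. -/
def weightedSemiSq (Ω : Set (Sp d)) (a : Sp d → ℝ) (v : Sp d → ℝ) : ℝ :=
  ∫ x in Ω, a x * ‖wgrad Ω v x‖ ^ 2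

/-- The mesh-dependent dual semi-norm: the supremum of `|(v, χ)| / ‖χ‖₁` over the nonzero `χ` of
the space `V` of functions on `Ω`. -/
def negNorm (Ω : Set (Sp d)) (V : Set (Sp d → ℝ)) (v : Sp d → ℝ) : ℝ :=
  sSup {r : ℝ | ∃ χ ∈ V, norm1Sq Ω χ ≠ 0 ∧ r = |ip Ω v χ| / √(norm1Sq Ω χ)}

/-- `z ∈ L²(I; H¹(Ω))`. -/
def MemL2H1 (Ω : Set (Sp d)) (I : Set ℝ) (z : ℝ → Sp d → ℝ) : Prop :=
  ∃ G : ℝ → Sp d → Sp d,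
    MemLp (Function.uncurry z) 2 (volume.restrict (I ×ˢ Ω)) ∧
    MemLp (Function.uncurry G) 2 (volume.restrict (I ×ˢ Ω)) ∧
    ∀ᵐ t ∂(volume.restrict I), IsWeakGrad Ω (z t) (G t)

/-! ### Moving triangulations on one time partition -/

/-- The unit simplex of `ℝ^d`, the spatial reference element. -/
def refSimplex (d : ℕ) : Set (Sp d) := {y | (∀ k, 0 ≤ y k) ∧ ∑ k, y k ≤ 1}

/-- The combinatorial data of a moving mesh: finitely many vertices, each with a trajectory that is
quadratic in time (given by its three coefficients), and finitely many elements, each given by the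
list of its `d + 1` vertices. -/
structure MovingMesh (d : ℕ) where
  numV : ℕ
  coeff : Fin numV → Fin 3 → Sp d
  elems : Finset (Fin (d + 1) → Fin numV)

namespace MovingMesh

/-- An element, as the list of its vertices. -/
abbrev Elem (M : MovingMesh d) := Fin (d + 1) → Fin M.numV

variable (M : MovingMesh d)

/-- The position `x_k(t)` of a vertex. -/
def pos (k : Fin M.numV) (t : ℝ) : Sp d := ∑ j : Fin 3, t ^ (j : ℕ) • M.coeff k j

/-- The spatial Jacobian matrix of an element; its columns are `x_k(t) - x_0(t)`. -/
def jac (e : M.Elem) (t : ℝ) : Matrix (Fin d) (Fin d) ℝ :=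
  Matrix.of fun r k => M.pos (e k.succ) t r - M.pos (e 0) t r

/-- The isoparametric map `y ↦ J_e(t) y + x_0(t)` of an element. -/
def map (e : M.Elem) (t : ℝ) (y : Sp d) : Sp d :=
  M.pos (e 0) t + ∑ k, y k • (M.pos (e k.succ) t - M.pos (e 0) t)

/-- The (closed) element at time `t`. -/
def cell (e : M.Elem) (t : ℝ) : Set (Sp d) := convexHull ℝ (range fun k => M.pos (e k) t)

/-- At time `t` the elements form a non-degenerate conforming triangulation of `Ω`: every element
has a nonzero Jacobian determinant, two elements meet in the simplex spanned by their common
vertices, and the elements fill up `Ω`. -/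
def IsTriangulation (Ω : Set (Sp d)) (t : ℝ) : Prop :=
  (∀ e ∈ M.elems, 0 < |(M.jac e t).det|) ∧
  (∀ e ∈ M.elems, ∀ e' ∈ M.elems,
    M.cell e t ∩ M.cell e' t
      = convexHull ℝ ((fun k => M.pos k t) '' (range e ∩ range e'))) ∧
  interior (⋃ e ∈ M.elems, M.cell e t) = Ω

/-- The point `x`, at time `t`, is the image of the reference point `p.2` in the element `p.1`. -/
def IsLabel (t : ℝ) (x : Sp d) (p : M.Elem × Sp d) : Prop :=
  p.1 ∈ M.elems ∧ p.2 ∈ refSimplex d ∧ M.map p.1 t p.2 = x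

open Classical in
/-- Transport along the mesh: `flow t s x` is the position at time `s` of the mesh point that is at
`x` at time `t`. (On a conforming mesh, the choice among several elements that contain `x` does not
matter.) The characteristic through `(x, t)` is `s ↦ flow t s x`. -/
def flow (t s : ℝ) (x : Sp d) : Sp d :=
  if h : ∃ p, M.IsLabel t x p then M.map h.choose.1 s h.choose.2 else x

/-- The mesh velocity `x_t` at `(x, t)`. -/
def vel (t : ℝ) (x : Sp d) : Sp d := deriv (fun s => M.flow t s x) t

/-- The function `w(s)` shifted onto the mesh at time `t`, that is, followed along the mesh. -/
def shift (w : ℝ → Sp d → ℝ) (s t : ℝ) : Sp d → ℝ := fun x => w s (M.flow t s x)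

/-- The space `V_h(t)` of continuous piecewise quadratic functions on the mesh at time `t`.
Continuity is implied: `φ` is one function that is a polynomial on each of the finitely many closed
elements. (Values off the union of the elements play no role.) -/
def sliceSpace (t : ℝ) : Set (Sp d → ℝ) :=
  {φ | ∀ e ∈ M.elems, ∃ P : MvPolynomial (Fin d) ℝ, P.totalDegree ≤ 2 ∧
    ∀ y ∈ refSimplex d, φ (M.map e t y) = MvPolynomial.eval (fun k => y k) P}

/-- Space-time finite element functions on one time partition `I`: continuous in space, and on each
element a tensor product of quadratics in the reference space variable with quadratics in time. -/
def IsFEFunction (I : Set ℝ) (φ : ℝ → Sp d → ℝ) : Prop :=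
  ∀ e ∈ M.elems, ∃ P : Fin 3 → MvPolynomial (Fin d) ℝ, (∀ j, (P j).totalDegree ≤ 2) ∧
    ∀ t ∈ I, ∀ y ∈ refSimplex d,
      φ t (M.map e t y) = ∑ j : Fin 3, t ^ (j : ℕ) * MvPolynomial.eval (fun k => y k) (P j)

/-- Space-time shape regularity at time `t`, relative to the start `t₀` of a time partition of
length `δ`: `J_e(t) = (R + δ H) J_e(t₀)` with `R` orthogonal and `H` of spectral norm at most `μ`. -/
def ShapeRegularAt (t₀ δ μ t : ℝ) : Prop :=
  ∀ e ∈ M.elems, ∃ R ∈ Matrix.orthogonalGroup (Fin d) ℝ, ∃ H : Matrix (Fin d) (Fin d) ℝ,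
    M.jac e t = (R + δ • H) * M.jac e t₀ ∧ ‖Matrix.toEuclideanCLM (n := Fin d) (𝕜 := ℝ) H‖ ≤ μ

end MovingMesh

/-! ### Space-time meshes -/

/-- A space-time mesh for `Ω × (0, T]` with `N + 1` time partitions
`(time i.castSucc, time i.succ]`, `i : Fin (N + 1)`, each with its own moving mesh. -/
structure SpaceTimeMesh (d : ℕ) (Ω : Set (Sp d)) (T : ℝ) where
  N : ℕ
  time : Fin (N + 2) → ℝ
  strictMono : StrictMono time
  time_zero : time 0 = 0
  time_last : time (Fin.last (N + 1)) = T
  mesh : Fin (N + 1) → MovingMesh d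
  triangulation : ∀ i, ∀ t ∈ Icc (time i.castSucc) (time i.succ), (mesh i).IsTriangulation Ω t

namespace SpaceTimeMesh

variable {Ω : Set (Sp d)} {T : ℝ} (S : SpaceTimeMesh d Ω T)

/-- Functions on the space-time domain that may be discontinuous across the time partitions: one
function for each closed time partition, so that `v i (S.left i)` is the limit from the right at the
start of the partition and `v i (S.right i)` is the limit from the left at its end. -/
abbrev SlabFun := Fin (S.N + 1) → ℝ → Sp d → ℝ

/-- The start `t_{i-1}` of a time partition. -/
def left (i : Fin (S.N + 1)) : ℝ := S.time i.castSucc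

/-- The end `t_i` of a time partition; also its second collocation node. -/
def right (i : Fin (S.N + 1)) : ℝ := S.time i.succ

/-- The closed time partition. -/
def slab (i : Fin (S.N + 1)) : Set ℝ := Icc (S.left i) (S.right i)

/-- The length of a time partition. -/
def dt (i : Fin (S.N + 1)) : ℝ := S.right i - S.left i

/-- The mid-step collocation node `t_{i,1} = t_{i-1} + (ε/2) Δt_i`. -/
def tmid (ε : ℝ) (i : Fin (S.N + 1)) : ℝ := S.left i + ε / 2 * S.dt i

/-- The intermediate basis node `ζ_{i,1} = t_{i-1} + ε Δt_i`. -/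
def zeta (ε : ℝ) (i : Fin (S.N + 1)) : ℝ := S.left i + ε * S.dt i

/-- The characteristic derivative `w_τ(x, t) = d/ds w(x(s), s)` at `s = t`, along the mesh of the
`i`-th time partition (one-sided at its ends). -/
def charDeriv (i : Fin (S.N + 1)) (w : ℝ → Sp d → ℝ) : ℝ → Sp d → ℝ :=
  fun t x => derivWithin (fun s => w s ((S.mesh i).flow t s x)) (S.slab i) t

/-- The trapezoid approximation at the mid-step collocation node: the mean of the values at the
first two basis nodes, both shifted onto the mesh at the mid-step collocation node. -/
def trap (ε : ℝ) (i : Fin (S.N + 1)) (w : ℝ → Sp d → ℝ) : Sp d → ℝ := fun x =>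
  ((S.mesh i).shift w (S.zeta ε i) (S.tmid ε i) x
    + (S.mesh i).shift w (S.left i) (S.tmid ε i) x) / 2

/-- The space-time finite element space `V_h`. At the interface between two time partitions, the
limit from the right is the `L²`-projection of the limit from the left. -/
def feSpace : Set S.SlabFun :=
  {φ | (∀ i, (S.mesh i).IsFEFunction (S.slab i) (φ i)) ∧
    ∀ i : Fin S.N, ∀ χ ∈ (S.mesh i.succ).sliceSpace (S.left i.succ),
      ip Ω (φ i.succ (S.left i.succ)) χ = ip Ω (φ i.castSucc (S.right i.castSucc)) χ}

/-- The time-dependent bilinear form `A_τ(t; v, χ)` on the mesh of the `i`-th time partition. -/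
def form (a : Sp d → ℝ → ℝ) (b : Sp d → ℝ → Sp d) (c : Sp d → ℝ → ℝ)
    (i : Fin (S.N + 1)) (t : ℝ) (v χ : Sp d → ℝ) : ℝ :=
  ∫ x in Ω, (a x t * inner ℝ (wgrad Ω v x) (wgrad Ω χ x)
    + inner ℝ (b x t - (S.mesh i).vel t x) (wgrad Ω v x) * χ x + c x t * v x * χ x)

/-- The square of the mesh-dependent energy semi-norm. -/
def energySq (ε : ℝ) (v : S.SlabFun) : ℝ :=
  max (norm0Sq Ω (v 0 0))
    (⨆ i, max (norm0Sq Ω (v i (S.tmid ε i))) (norm0Sq Ω (v i (S.right i))))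
  + ∑ i, S.dt i *
      (negNorm Ω ((S.mesh i).sliceSpace (S.tmid ε i)) (S.charDeriv i (v i) (S.tmid ε i)) ^ 2
        + norm1Sq Ω (S.trap ε i (v i))
        + norm1Sq Ω (v i (S.zeta ε i))
        + negNorm Ω ((S.mesh i).sliceSpace (S.right i)) (S.charDeriv i (v i) (S.right i)) ^ 2
        + norm1Sq Ω (v i (S.right i)))

/-- `u` is a weak solution of
`u_t - ∇·(a ∇u) + b·∇u + c u = f`, `a ∇u·n = g` on `∂Ω`, `u(0) = u₀`,
written in terms of the characteristic derivative. The test functions are the `H¹` functions that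
are continuous up to the boundary, so that their boundary values are the ordinary ones. -/
def IsWeakSolution (a : Sp d → ℝ → ℝ) (b : Sp d → ℝ → Sp d) (c : Sp d → ℝ → ℝ)
    (f g : Sp d → ℝ → ℝ) (u₀ : Sp d → ℝ) (u : ℝ → Sp d → ℝ) : Prop :=
  (∀ t ∈ Icc 0 T, MemH1 Ω (u t)) ∧
  (∀ i, ∀ t ∈ Ioc (S.left i) (S.right i),
    MemLp (S.charDeriv i u t) 2 (volume.restrict Ω) ∧
    ∀ χ, MemH1 Ω χ → ContinuousOn χ (closure Ω) →
      ip Ω (S.charDeriv i u t) χ + S.form a b c i t (u t) χ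
        = ip Ω (fun x => f x t) χ + bip Ω (fun x => g x t) χ) ∧
  ∀ χ, MemH1 Ω χ → ip Ω (u 0) χ = ip Ω u₀ χ

/-- On each time partition, `u` is differentiable along almost every characteristic, the
characteristic derivative `u_τ` is absolutely continuous along it with derivative `u_ττ`, and
`u_ττ ∈ L²(I; H¹(Ω))`. -/
def HasSecondCharDeriv (u : ℝ → Sp d → ℝ) : Prop :=
  ∀ i,
    (∀ᵐ x ∂(volume.restrict Ω),
      let γ : ℝ → Sp d := fun s => (S.mesh i).flow (S.left i) s x
      DifferentiableOn ℝ (fun s => u s (γ s)) (S.slab i) ∧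
      IntervalIntegrable (fun s => S.charDeriv i (S.charDeriv i u) s (γ s)) volume
        (S.left i) (S.right i) ∧
      ∀ t ∈ S.slab i, S.charDeriv i u t (γ t) = S.charDeriv i u (S.left i) (γ (S.left i))
        + ∫ s in (S.left i)..t, S.charDeriv i (S.charDeriv i u) s (γ s)) ∧
    MemL2H1 Ω (S.slab i) (S.charDeriv i (S.charDeriv i u))

/-- `uh` solves the discrete problem: it lies in `V_h`, starts from the `L²`-projection of `u₀`, and
satisfies the trapezoid equation at each mid-step collocation node and the second-order backward
difference equation at the end of each time step. -/
def IsDiscreteSolution (ε : ℝ) (a : Sp d → ℝ → ℝ) (b : Sp d → ℝ → Sp d) (c : Sp d → ℝ → ℝ)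
    (f g : Sp d → ℝ → ℝ) (u₀ : Sp d → ℝ) (uh : S.SlabFun) : Prop :=
  uh ∈ S.feSpace ∧
  (∀ χ ∈ (S.mesh 0).sliceSpace 0, ip Ω (uh 0 0) χ = ip Ω u₀ χ) ∧
  (∀ i, ∀ χ ∈ (S.mesh i).sliceSpace (S.tmid ε i),
    ip Ω (fun x => ((S.mesh i).shift (uh i) (S.zeta ε i) (S.tmid ε i) x
        - (S.mesh i).shift (uh i) (S.left i) (S.tmid ε i) x) / (ε * S.dt i)) χ
      + S.form a b c i (S.tmid ε i) (S.trap ε i (uh i)) χ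
      = ip Ω (fun x => f x (S.tmid ε i)) χ + bip Ω (fun x => g x (S.tmid ε i)) χ) ∧
  ∀ i, ∀ χ ∈ (S.mesh i).sliceSpace (S.right i),
    ip Ω (fun x => (ε * (2 - ε) * uh i (S.right i) x
        - (S.mesh i).shift (uh i) (S.zeta ε i) (S.right i) x
        + (1 - ε) ^ 2 * (S.mesh i).shift (uh i) (S.left i) (S.right i) x)
          / (ε * (1 - ε) * S.dt i)) χ
      + S.form a b c i (S.right i) (uh i (S.right i)) χ
      = ip Ω (fun x => f x (S.right i)) χ + bip Ω (fun x => g x (S.right i)) χ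

/-- `K` bounds the growth of the diffusion-weighted semi-norm across the mesh discontinuities. -/
def IsStabilityConstant (a : Sp d → ℝ → ℝ) (K : ℝ) : Prop :=
  ∀ φ ∈ S.feSpace, ∀ i : Fin S.N,
    weightedSemiSq Ω (fun x => a x (S.left i.succ)) (φ i.succ (S.left i.succ))
      ≤ K * weightedSemiSq Ω (fun x => a x (S.right i.castSucc))
          (φ i.castSucc (S.right i.castSucc))

/-- The `L²`-projection onto the finite element space on the initial mesh is stable in the `H¹`
semi-norm with constant `K`. -/
def InitialProjectionStable (K : ℝ) : Prop :=
  ∀ v, MemH1 Ω v → ∀ w ∈ (S.mesh 0).sliceSpace 0,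
    (∀ χ ∈ (S.mesh 0).sliceSpace 0, ip Ω w χ = ip Ω v χ) →
      √(semi1Sq Ω w) ≤ K * √(semi1Sq Ω v)

end SpaceTimeMesh

end MovingFE

end

noncomputable section

namespace MovingFE

variable {d : ℕ}

open Filter Topology Metric
open scoped NNReal

variable {Ω : Set (Sp d)}

/-! Take any `χ` in the finite element space and write `u - u_h = E - z` with `E = u - χ` and `z =
u_h - χ`. Along characteristics `z` is quadratic in time, and for quadratics both difference
quotients of the scheme equal the characteristic derivative at their node, so the scheme is a
collocation method. Subtracting it from the weak formulation at the two nodes cancels the data,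
boundary term included. Thus `z` solves the scheme with right-hand sides controlled in the dual norm
by `E` and, at the first node only, by the consistency error `u - u_TR` (`error_eq_tmid`,
`error_eq_right`). It remains to prove stability of the scheme and to bound the consistency error;
the triangle inequality and the infimum over `χ` conclude.

Stability. Let `Z0`, `Z1`, `Z2` be the values of `z` at the three basis nodes, carried to the mesh
at `t_i`, and put `M = (Z0 + Z1)/2`, `W = Z1 - Z0`, `P = Z2 - M`. The stages are tested with `5/4 M
+ Z2` and `Z2` and weighted by `2Δt/3` and `Δt/2`. The time differences then add up to `‖Z2‖² -
‖Z0‖² + ‖P‖² + ‖W‖²/4 - (W, P)/4`, which telescopes up to positive damping (`ip_stage_identity`),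
and the diffusion terms remain coercive in `M` and `Z2`. All other terms are absorbed, which gives
`one_step_energy_le`. Across an interface `z` jumps by an `L²`-projection, so its `L²` norm does not
grow, and `discrete_gronwall` bounds the `L²` norms together with the time-weighted sum of
gradients. The dual norms of `z_τ` are then read off from the equations. The `H¹` norm at the middle
basis node comes from `Z1 = 2M - Z0`; it involves the gradient at the start of the step, and this is
where stability across the interfaces, the grading of the time steps and the `H¹`-stable initial
projection enter.

Geometry. The two stages live on different meshes. Shape regularity makes the flow between two times
of one step a piecewise affine bi-Lipschitz bijection of `Ω` with constant `Λ = 1 + 4μΔt` in both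
directions (`isMeshIso_flow`, `norm_trans_le`). Transport therefore changes `L²` products by a
relative `O(Δt)`, which Gronwall tolerates, and diffusion energies by a fraction which coercivity
absorbs. The required chain rule for weak gradients under such maps is `isWeakGrad_comp`.

Consistency. On the first part of a step `u - u_TR` is a second difference along characteristics,
hence a time average of the transported `u_ττ` with a hat-shaped kernel; weak gradients commute with
transport and with time averages (`norm1Sq_sub_trap_le`). -/

/-! ### Lipschitz functions along segments -/

/-- A continuous function on `[0, 1]` that, to the right of every point, grows at rate at most `L`
along some sequence, grows at rate at most `L`. -/
theorem norm_sub_le_of_right_slope {E : Type*} [NormedAddCommGroup E] {g : ℝ → E} {L : ℝ}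
    (hc : ContinuousOn g (Icc 0 1))
    (h : ∀ t ∈ Ico (0 : ℝ) 1, ∀ y > t, ∃ t' ∈ Ioc t y, ‖g t' - g t‖ ≤ L * (t' - t)) :
    ‖g 1 - g 0‖ ≤ L := by
  -- Continuous induction: the set of times where the bound holds is closed by continuity of `g`,
  -- and the hypothesis extends it to the right of each of its points.
  have key : Icc (0 : ℝ) 1 ⊆ {t | ‖g t - g 0‖ ≤ L * t} := by
    apply IsClosed.Icc_subset_of_forall_exists_gt
    · have : {t | ‖g t - g 0‖ ≤ L * t} ∩ Icc (0 : ℝ) 1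
          = {t ∈ Icc (0 : ℝ) 1 | ‖g t - g 0‖ ≤ L * t} := by
        ext; simp [and_comm]
      rw [this]
      exact isClosed_Icc.isClosed_le ((hc.sub continuousOn_const).norm) (by fun_prop)
    · simp
    · rintro t ⟨ht, ht'⟩ y hy
      obtain ⟨s, hs, hs'⟩ := h t ht' y hy
      refine ⟨s, ?_, hs⟩
      have : g s - g 0 = (g s - g t) + (g t - g 0) := by abel
      simp only [mem_ofPred_eq] at ht ⊢
      rw [this]
      refine (norm_add_le _ _).trans ?_
      linarith
  have := key (right_mem_Icc.2 zero_le_one)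
  simpa using this

/-- A function on a normed space that is Lipschitz near every point, with a uniform constant, is
Lipschitz. -/
theorem lipschitzWith_of_locally {E F : Type*} [NormedAddCommGroup E] [NormedSpace ℝ E]
    [NormedAddCommGroup F] {f : E → F} {C : ℝ≥0}
    (h : ∀ x, ∃ s ∈ 𝓝 x, LipschitzOnWith C f s) : LipschitzWith C f := by
  have hcont : Continuous f := continuous_iff_continuousAt.2 fun x => by
    obtain ⟨s, hs, hf⟩ := h x
    exact hf.continuousOn.continuousAt hs
  apply LipschitzWith.of_dist_le_mul
  intro y x
  rw [dist_eq_norm, dist_eq_norm]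
  let l : ℝ → E := fun t => x + t • (y - x)
  have hl : Continuous l := by fun_prop
  have := norm_sub_le_of_right_slope (g := f ∘ l) (L := C * ‖y - x‖)
    (hcont.comp hl).continuousOn (by
      intro t ht z hz
      obtain ⟨s, hs, hf⟩ := h (l t)
      have h1 : ∀ᶠ t' in 𝓝[>] t, l t' ∈ s :=
        (hl.continuousAt.tendsto.mono_left nhdsWithin_le_nhds) hs
      have h2 : ∀ᶠ t' in 𝓝[>] t, t' ∈ Ioc t z := Ioc_mem_nhdsGT hz
      obtain ⟨t', h3, h4⟩ := (h1.and h2).exists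
      refine ⟨t', h4, ?_⟩
      have := hf.dist_le_mul _ h3 _ (mem_of_mem_nhds hs)
      rw [dist_eq_norm, dist_eq_norm] at this
      refine this.trans (le_of_eq ?_)
      have : l t' - l t = (t' - t) • (y - x) := by simp only [l]; module
      rw [this, norm_smul, Real.norm_of_nonneg (by linarith [h4.1])]
      ring)
  simpa [l] using this

/-- A function that is Lipschitz on each of finitely many closed sets is Lipschitz along
every segment covered by them. -/
theorem norm_sub_le_of_segment_subset_iUnion {E F ι : Type*} [NormedAddCommGroup E]
    [NormedSpace ℝ E] [NormedAddCommGroup F] {f : E → F} {C : ℝ≥0} (I : Finset ι) {K : ι → Set E}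
    (hK : ∀ i ∈ I, IsClosed (K i))
    (hf : ∀ i ∈ I, LipschitzOnWith C f (K i)) {x y : E} (hxy : segment ℝ x y ⊆ ⋃ i ∈ I, K i) :
    ‖f y - f x‖ ≤ C * ‖y - x‖ := by
  let l : ℝ → E := fun t => x + t • (y - x)
  have hl : Continuous l := by fun_prop
  have hseg : ∀ t ∈ Icc (0 : ℝ) 1, ∃ i ∈ I, l t ∈ K i := by
    intro t ht
    have : l t ∈ segment ℝ x y := by
      rw [segment_eq_image']; exact ⟨t, ht, rfl⟩
    simpa using hxy this
  have hcont : ContinuousOn (f ∘ l) (Icc 0 1) := by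
    have : Icc (0 : ℝ) 1 ⊆ ⋃ i : I, l ⁻¹' (K i) := by
      intro t ht
      obtain ⟨i, hi, hi'⟩ := hseg t ht
      exact mem_iUnion.2 ⟨⟨i, hi⟩, hi'⟩
    refine ContinuousOn.mono ?_ this
    refine (locallyFinite_of_finite _).continuousOn_iUnion
      (fun i => (hK i i.2).preimage hl) fun i => ?_
    exact (hf i i.2).continuousOn.comp hl.continuousOn fun t ht => ht
  have := norm_sub_le_of_right_slope (g := f ∘ l) (L := C * ‖y - x‖) hcont (by
      intro t ht z hz
      have h2 : ∀ᶠ t' in 𝓝[>] t, t' ∈ Ioc t (min z 1) := Ioc_mem_nhdsGT (lt_min hz ht.2)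
      have h1 : ∃ᶠ t' in 𝓝[>] t, ∃ i ∈ I, l t' ∈ K i :=
        (h2.mono fun t' h => hseg t' ⟨by linarith [h.1, ht.1], h.2.trans (min_le_right _ _)⟩).frequently
      -- Pigeonhole: a single one of the finitely many sets is visited at times arbitrarily close to
      -- `t` from the right. Being closed, it contains `l t` as well, so its Lipschitz bound
      -- compares the two points.
      have h3 : ∃ i ∈ I, ∃ᶠ t' in 𝓝[>] t, l t' ∈ K i := by
        by_contra hcon
        push Not at hcon
        refine h1 ?_
        have : ∀ᶠ t' in 𝓝[>] t, ∀ i ∈ I, l t' ∉ K i :=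
          (Filter.eventually_all_finset I).2 fun i hi => by simpa using hcon i hi
        filter_upwards [this] with t' h ⟨i, hi, hi'⟩
        exact h i hi hi'
      obtain ⟨i, hi, h3⟩ := h3
      have hti : l t ∈ K i := by
        have : ∃ᶠ t' in 𝓝 t, l t' ∈ K i := h3.filter_mono nhdsWithin_le_nhds
        exact ((hK i hi).preimage hl).mem_of_frequently_of_tendsto this tendsto_id
      obtain ⟨t', h4, h5⟩ := (h3.and_eventually h2).exists
      refine ⟨t', ⟨h5.1, h5.2.trans (min_le_left _ _)⟩, ?_⟩
      have := (hf i hi).dist_le_mul _ h4 _ hti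
      rw [dist_eq_norm, dist_eq_norm] at this
      refine this.trans (le_of_eq ?_)
      have : l t' - l t = (t' - t) • (y - x) := by simp only [l]; module
      rw [this, norm_smul, Real.norm_of_nonneg (by linarith [h5.1])]
      ring)
  simpa [l] using this

/-! ### Integration by parts for locally Lipschitz functions -/

/-- `f` is Lipschitz near every point of `Ω`, with a uniform constant. -/
def LocLip {F : Type*} [NormedAddCommGroup F] (Ω : Set (Sp d)) (C : ℝ≥0) (f : Sp d → F) : Prop :=
  ∀ x ∈ Ω, ∃ s ∈ 𝓝 x, LipschitzOnWith C f s

theorem LocLip.continuousOn {F : Type*} [NormedAddCommGroup F] {Ω : Set (Sp d)} {C : ℝ≥0}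
    {f : Sp d → F} (h : LocLip Ω C f) : ContinuousOn f Ω := fun x hx => by
  obtain ⟨s, hs, hf⟩ := h x hx
  exact (hf.continuousOn.continuousAt hs).continuousWithinAt

/-- Multiplying `f` by a Lipschitz cutoff of `K` gives a globally Lipschitz function, to which
integration by parts on the whole space applies. The product rule gives the constant: `C` from `f`,
plus the bound of `f` near `K` times the slope `1/δ` of the cutoff. -/
theorem exists_lipschitz_cutoff {Ω : Set (Sp d)} (hΩ : IsOpen Ω) {C : ℝ≥0} {f : Sp d → ℝ}
    (hf : LocLip Ω C f) {K : Set (Sp d)} (hK : IsCompact K) (hKΩ : K ⊆ Ω) :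
    ∃ (D : ℝ≥0) (g : Sp d → ℝ), LipschitzWith D g ∧ ∀ x ∈ K, g x = f x := by
  obtain ⟨δ, hδ, hδΩ⟩ := hK.exists_cthickening_subset_open hΩ hKΩ
  have hKc : IsCompact (cthickening δ K) := hK.cthickening
  obtain ⟨M, hM⟩ := hKc.exists_bound_of_continuousOn (hf.continuousOn.mono hδΩ)
  let ψ : Sp d → ℝ := fun x => (thickenedIndicator hδ K x : ℝ)
  have hψL : LipschitzWith δ.toNNReal⁻¹ ψ := by
    have := lipschitzWith_thickenedIndicator hδ K
    intro x y
    have h2 := this x y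
    simpa [ψ, edist_dist, NNReal.dist_eq, Real.dist_eq] using h2
  have hψ1 : ∀ x, |ψ x| ≤ 1 := fun x => by
    rw [abs_of_nonneg (NNReal.coe_nonneg _)]
    exact_mod_cast thickenedIndicator_le_one hδ K x
  have hψ0 : ∀ x ∉ cthickening δ K, ψ x = 0 := fun x hx => by
    have : x ∉ thickening δ K := fun h => hx (thickening_subset_cthickening _ _ h)
    simp only [ψ]; rw [thickenedIndicator_zero hδ K this]; rfl
  let M' : ℝ≥0 := (max M 0).toNNReal + 1
  have hM' : (M' : ℝ) = max M 0 + 1 := by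
    simp [M']
  refine ⟨C + M' * δ.toNNReal⁻¹, fun x => ψ x * f x, ?_, ?_⟩
  · apply lipschitzWith_of_locally
    intro x
    by_cases hx : x ∈ cthickening δ K
    · obtain ⟨s, hs, hfs⟩ := hf x (hδΩ hx)
      have hcx : ContinuousAt f x := hfs.continuousOn.continuousAt hs
      have hb : ∀ᶠ y in 𝓝 x, |f y| < M' := by
        apply hcx.abs.eventually_lt_const
        have := hM x hx
        rw [Real.norm_eq_abs] at this
        rw [hM']
        linarith [le_max_left M 0]
      refine ⟨s ∩ {y | |f y| < M'}, Filter.inter_mem hs hb, ?_⟩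
      apply LipschitzOnWith.of_dist_le_mul
      intro y hy z hz
      have h1 := hfs.dist_le_mul y hy.1 z hz.1
      have h2 := hψL.dist_le_mul y z
      have h3 : |f z| < M' := hz.2
      rw [Real.dist_eq] at h1 h2 ⊢
      have : ψ y * f y - ψ z * f z = ψ y * (f y - f z) + (ψ y - ψ z) * f z := by ring
      rw [this]
      calc _ ≤ |ψ y| * |f y - f z| + |ψ y - ψ z| * |f z| := by
            refine (abs_add_le _ _).trans ?_; rw [abs_mul, abs_mul]
        _ ≤ 1 * (C * dist y z) + (δ.toNNReal⁻¹ : ℝ≥0) * dist y z * M' := by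
            gcongr
            exact hψ1 y
        _ = _ := by push_cast; ring
    · refine ⟨(cthickening δ K)ᶜ, isClosed_cthickening.isOpen_compl.mem_nhds hx, ?_⟩
      apply LipschitzOnWith.of_dist_le_mul
      intro y hy z hz
      simp only [hψ0 y hy, hψ0 z hz, zero_mul, dist_self]
      positivity
  · intro x hx
    have : ψ x = 1 := by
      simp only [ψ]; rw [thickenedIndicator_one hδ K hx]; rfl
    simp [this]

/-- Only the values of `f` near the support of `θ` matter, so `f` may be replaced by a globally
Lipschitz function, for which the identity is Rademacher-type integration by parts. -/
theorem integral_mul_fderiv_eq_neg_lineDeriv {Ω : Set (Sp d)} (hΩ : IsOpen Ω) {C : ℝ≥0}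
    {f : Sp d → ℝ} (hf : LocLip Ω C f) {θ : Sp d → ℝ} (hθ : ContDiff ℝ ∞ θ)
    (hθc : HasCompactSupport θ) (hθΩ : tsupport θ ⊆ Ω) (v : Sp d) :
    ∫ x in Ω, f x * fderiv ℝ θ x v = - ∫ x in Ω, lineDeriv ℝ f x v * θ x := by
  obtain ⟨D, g, hg, hgf⟩ := exists_lipschitz_cutoff hΩ hf hθc hθΩ
  obtain ⟨L, hL⟩ := (hθ.of_le (by simp)).lipschitzWith_of_hasCompactSupport hθc one_ne_zero
  have h0 : ∀ x, x ∉ Ω → θ x = 0 := fun x hx => by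
    by_contra h
    exact hx (hθΩ (subset_tsupport _ h))
  have h0' : ∀ x, x ∉ tsupport θ → fderiv ℝ θ x v = 0 := fun x hx => by
    have : fderiv ℝ θ x = 0 := by
      by_contra h
      exact hx (support_fderiv_subset ℝ h)
    simp [this]
  have key := hg.integral_lineDeriv_mul_eq (μ := volume) hL hθc v
  have e1 : ∫ x in Ω, f x * fderiv ℝ θ x v = ∫ x, g x * fderiv ℝ θ x v := by
    rw [← integral_indicator hΩ.measurableSet]
    congr 1; ext x
    by_cases hx : x ∈ tsupport θ
    · rw [indicator_of_mem (hθΩ hx), hgf x hx]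
    · rw [h0' x hx]; by_cases hx' : x ∈ Ω <;> simp [h0' x hx]
  have e2 : ∫ x in Ω, lineDeriv ℝ f x v * θ x = ∫ x, lineDeriv ℝ g x v * θ x := by
    rw [← integral_indicator hΩ.measurableSet]
    congr 1; ext x
    by_cases hx : x ∈ Function.support θ
    · rw [indicator_of_mem (hθΩ (subset_tsupport _ hx))]
      have : f =ᶠ[𝓝 x] g := by
        filter_upwards [hθ.continuous.isOpen_support.mem_nhds hx] with y hy
        exact (hgf y (subset_tsupport _ hy)).symm
      rw [Filter.EventuallyEq.lineDeriv_eq this]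
    · have : θ x = 0 := by simpa using hx
      by_cases hx' : x ∈ Ω <;> simp [this]
  rw [e1, e2, key, ← integral_neg]
  congr 1; ext x
  have hd : DifferentiableAt ℝ θ x := hθ.differentiable (by simp) x
  rw [hd.lineDeriv_eq_fderiv]
  simp [mul_comm]

/-! ### Basic properties of weak gradients -/

theorem integrable_mul_of_memLp {X : Type*} [MeasurableSpace X] {μ : Measure X} {f g : X → ℝ}
    (hf : MemLp f 2 μ) (hg : MemLp g 2 μ) : Integrable (fun x => f x * g x) μ :=
  hf.integrable_mul hg

theorem memLp_coord {μ : Measure (Sp d)} {p : ENNReal} {G : Sp d → Sp d} (hG : MemLp G p μ)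
    (k : Fin d) : MemLp (fun x => G x k) p μ :=
  (EuclideanSpace.proj k : Sp d →L[ℝ] ℝ).comp_memLp' hG

theorem eq_zero_of_notMem {θ : Sp d → ℝ} (hθ : tsupport θ ⊆ Ω) {x : Sp d} (hx : x ∉ Ω) :
    θ x = 0 := by
  by_contra h
  exact hx (hθ (subset_tsupport _ h))

theorem memLp_of_test {μ : Measure (Sp d)} [IsFiniteMeasureOnCompacts μ] {θ : Sp d → ℝ}
    (h1 : Continuous θ) (h2 : HasCompactSupport θ) : MemLp θ 2 μ :=
  h1.memLp_of_hasCompactSupport h2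

theorem memLp_fderiv_of_test {μ : Measure (Sp d)} [IsFiniteMeasureOnCompacts μ] {θ : Sp d → ℝ}
    (h1 : ContDiff ℝ ∞ θ) (h2 : HasCompactSupport θ) (v : Sp d) :
    MemLp (fun x => fderiv ℝ θ x v) 2 μ :=
  ((h1.continuous_fderiv (by simp)).clm_apply continuous_const).memLp_of_hasCompactSupport
    (h2.fderiv_apply ℝ v)

theorem IsWeakGrad.unique (hΩ : IsOpen Ω) [IsFiniteMeasure (volume.restrict Ω)]
    {v : Sp d → ℝ} {G G' : Sp d → Sp d} (h : IsWeakGrad Ω v G) (h' : IsWeakGrad Ω v G') :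
    G =ᵐ[volume.restrict Ω] G' := by
  have key : ∀ k : Fin d, ∀ᵐ x ∂volume, x ∈ Ω → G x k - G' x k = 0 := by
    intro k
    have i1 : MemLp (fun x => G x k) 2 (volume.restrict Ω) := memLp_coord h.1 k
    have i2 : MemLp (fun x => G' x k) 2 (volume.restrict Ω) := memLp_coord h'.1 k
    apply hΩ.ae_eq_zero_of_integral_contDiff_smul_eq_zero
    · have : IntegrableOn (fun x => G x k - G' x k) Ω := (i1.sub i2).integrable one_le_two
      exact this.locallyIntegrableOn
    · intro θ h1 h2 h3
      have e := h.2 θ h1 h2 h3 k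
      rw [h'.2 θ h1 h2 h3 k, neg_inj] at e
      have hm : MemLp θ 2 (volume.restrict Ω) := memLp_of_test h1.continuous h2
      have : ∫ x in Ω, θ x • (G x k - G' x k) = 0 := by
        have : ∀ x, θ x • (G x k - G' x k) = G x k * θ x - G' x k * θ x := fun x => by
          simp; ring
        simp_rw [this]
        rw [integral_sub (integrable_mul_of_memLp i1 hm) (integrable_mul_of_memLp i2 hm), e, sub_self]
      rw [← this, setIntegral_eq_integral_of_forall_compl_eq_zero]
      intro x hx
      simp [eq_zero_of_notMem h3 hx]
  have := ae_all_iff.2 key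
  refine (ae_restrict_iff' hΩ.measurableSet).2 ?_
  filter_upwards [this] with x hx hxΩ
  ext k
  linarith [hx k hxΩ]

theorem IsWeakGrad.congr {v v' : Sp d → ℝ} {G : Sp d → Sp d} (h : IsWeakGrad Ω v G)
    (hv : v =ᵐ[volume.restrict Ω] v') : IsWeakGrad Ω v' G := by
  refine ⟨h.1, fun θ h1 h2 h3 k => ?_⟩
  rw [← h.2 θ h1 h2 h3 k]
  apply integral_congr_ae
  filter_upwards [hv] with x hx
  rw [hx]

theorem IsWeakGrad.add {v w : Sp d → ℝ} {G H : Sp d → Sp d} (hv : IsWeakGrad Ω v G)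
    (hw : IsWeakGrad Ω w H) (hv2 : MemLp v 2 (volume.restrict Ω))
    (hw2 : MemLp w 2 (volume.restrict Ω)) :
    IsWeakGrad Ω (fun x => v x + w x) (fun x => G x + H x) := by
  refine ⟨hv.1.add hw.1, fun θ h1 h2 h3 k => ?_⟩
  have hm : MemLp θ 2 (volume.restrict Ω) := memLp_of_test h1.continuous h2
  have hm' := memLp_fderiv_of_test (μ := volume.restrict Ω) h1 h2 (EuclideanSpace.single k 1)
  simp only [PiLp.add_apply, add_mul]
  rw [integral_add (integrable_mul_of_memLp hv2 hm') (integrable_mul_of_memLp hw2 hm'),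
    integral_add (integrable_mul_of_memLp (memLp_coord hv.1 k) hm)
      (integrable_mul_of_memLp (memLp_coord hw.1 k) hm), hv.2 θ h1 h2 h3 k, hw.2 θ h1 h2 h3 k]
  ring

theorem IsWeakGrad.const_mul {v : Sp d → ℝ} {G : Sp d → Sp d} (hv : IsWeakGrad Ω v G) (c : ℝ) :
    IsWeakGrad Ω (fun x => c * v x) (fun x => c • G x) := by
  refine ⟨hv.1.const_smul c, fun θ h1 h2 h3 k => ?_⟩
  simp only [PiLp.smul_apply, smul_eq_mul, mul_assoc]
  rw [integral_const_mul, integral_const_mul, hv.2 θ h1 h2 h3 k]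
  ring

theorem IsWeakGrad.sub {v w : Sp d → ℝ} {G H : Sp d → Sp d} (hv : IsWeakGrad Ω v G)
    (hw : IsWeakGrad Ω w H) (hv2 : MemLp v 2 (volume.restrict Ω))
    (hw2 : MemLp w 2 (volume.restrict Ω)) :
    IsWeakGrad Ω (fun x => v x - w x) (fun x => G x - H x) := by
  have := hv.add (hw.const_mul (-1)) hv2 (hw2.const_mul (-1))
  simpa [sub_eq_add_neg] using this

theorem MemH1.isWeakGrad {v : Sp d → ℝ} (h : MemH1 Ω v) : IsWeakGrad Ω v (wgrad Ω v) := by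
  unfold wgrad
  rw [dif_pos h.2]
  exact h.2.choose_spec

theorem IsWeakGrad.wgrad_eq (hΩ : IsOpen Ω) [IsFiniteMeasure (volume.restrict Ω)]
    {v : Sp d → ℝ} {G : Sp d → Sp d} (h : IsWeakGrad Ω v G) :
    wgrad Ω v =ᵐ[volume.restrict Ω] G := by
  refine IsWeakGrad.unique hΩ ?_ h
  unfold wgrad
  rw [dif_pos ⟨G, h⟩]
  exact (⟨G, h⟩ : ∃ G, IsWeakGrad Ω v G).choose_spec

theorem MemH1.congr {v v' : Sp d → ℝ} (h : MemH1 Ω v) (hv : v =ᵐ[volume.restrict Ω] v') :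
    MemH1 Ω v' :=
  ⟨h.1.ae_eq hv, wgrad Ω v, h.isWeakGrad.congr hv⟩

theorem MemH1.add {v w : Sp d → ℝ} (hv : MemH1 Ω v) (hw : MemH1 Ω w) :
    MemH1 Ω (fun x => v x + w x) :=
  ⟨hv.1.add hw.1, _, hv.isWeakGrad.add hw.isWeakGrad hv.1 hw.1⟩

theorem MemH1.sub {v w : Sp d → ℝ} (hv : MemH1 Ω v) (hw : MemH1 Ω w) :
    MemH1 Ω (fun x => v x - w x) :=
  ⟨hv.1.sub hw.1, _, hv.isWeakGrad.sub hw.isWeakGrad hv.1 hw.1⟩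

theorem MemH1.const_mul {v : Sp d → ℝ} (hv : MemH1 Ω v) (c : ℝ) :
    MemH1 Ω (fun x => c * v x) :=
  ⟨hv.1.const_mul c, _, hv.isWeakGrad.const_mul c⟩

theorem wgrad_congr {v v' : Sp d → ℝ} (hv : v =ᵐ[volume.restrict Ω] v') :
    wgrad Ω v = wgrad Ω v' := by
  -- The two functions have the same set of weak gradients, so the choice in `wgrad` picks the same
  -- representative and the gradients agree everywhere, not just almost everywhere.
  have : IsWeakGrad Ω v = IsWeakGrad Ω v' := by
    ext G
    exact ⟨fun h => h.congr hv, fun h => h.congr hv.symm⟩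
  unfold wgrad
  rw [this]

theorem wgrad_add (hΩ : IsOpen Ω) [IsFiniteMeasure (volume.restrict Ω)]
    {v w : Sp d → ℝ} (hv : MemH1 Ω v) (hw : MemH1 Ω w) :
    wgrad Ω (fun x => v x + w x) =ᵐ[volume.restrict Ω] fun x => wgrad Ω v x + wgrad Ω w x :=
  (hv.isWeakGrad.add hw.isWeakGrad hv.1 hw.1).wgrad_eq hΩ

theorem wgrad_sub (hΩ : IsOpen Ω) [IsFiniteMeasure (volume.restrict Ω)]
    {v w : Sp d → ℝ} (hv : MemH1 Ω v) (hw : MemH1 Ω w) :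
    wgrad Ω (fun x => v x - w x) =ᵐ[volume.restrict Ω] fun x => wgrad Ω v x - wgrad Ω w x :=
  (hv.isWeakGrad.sub hw.isWeakGrad hv.1 hw.1).wgrad_eq hΩ

theorem wgrad_const_mul (hΩ : IsOpen Ω) [IsFiniteMeasure (volume.restrict Ω)]
    {v : Sp d → ℝ} (hv : MemH1 Ω v) (c : ℝ) :
    wgrad Ω (fun x => c * v x) =ᵐ[volume.restrict Ω] fun x => c • wgrad Ω v x :=
  (hv.isWeakGrad.const_mul c).wgrad_eq hΩ

theorem IsWeakGrad.semi1Sq_eq (hΩ : IsOpen Ω) [IsFiniteMeasure (volume.restrict Ω)]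
    {v : Sp d → ℝ} {G : Sp d → Sp d} (h : IsWeakGrad Ω v G) :
    semi1Sq Ω v = ∫ x in Ω, ‖G x‖ ^ 2 := by
  apply integral_congr_ae
  filter_upwards [h.wgrad_eq hΩ] with x hx
  rw [hx]

/-! ### Mollification of the test fields -/

/-- A smooth bump function at the origin of radius `δ / (n + 1)`. -/
def bump (d : ℕ) {δ : ℝ} (hδ : 0 < δ) (n : ℕ) : ContDiffBump (0 : Sp d) where
  rIn := δ / (n + 1) / 2
  rOut := δ / (n + 1)
  rIn_pos := by positivity
  rIn_lt_rOut := half_lt_self (by positivity)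

theorem tendsto_bump_rOut {δ : ℝ} (hδ : 0 < δ) :
    Tendsto (fun n => (bump d hδ n).rOut) atTop (𝓝 0) := by
  have := (tendsto_one_div_add_atTop_nhds_zero_nat (𝕜 := ℝ)).const_mul δ
  simpa [bump, div_eq_mul_inv] using this

/-- The mollification of a function with a smooth bump. -/
def moll {δ : ℝ} (hδ : 0 < δ) (n : ℕ) (g : Sp d → ℝ) : Sp d → ℝ :=
  convolution ((bump d hδ n).normed volume) g (ContinuousLinearMap.lsmul ℝ ℝ) volume

theorem moll_apply {δ : ℝ} (hδ : 0 < δ) (n : ℕ) (g : Sp d → ℝ) (x : Sp d) :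
    moll hδ n g x = ∫ t, (bump d hδ n).normed volume (x - t) * g t := by
  rw [moll, convolution_eq_swap]
  rfl

theorem contDiff_moll {δ : ℝ} (hδ : 0 < δ) (n : ℕ) {g : Sp d → ℝ} (hg : LocallyIntegrable g) :
    ContDiff ℝ ∞ (moll hδ n g) :=
  (bump d hδ n).hasCompactSupport_normed.contDiff_convolution_left _
    (bump d hδ n).contDiff_normed hg

/-- The derivative falls on the smooth kernel, so `g` need only be locally integrable. -/
theorem fderiv_moll_apply {δ : ℝ} (hδ : 0 < δ) (n : ℕ) {g : Sp d → ℝ} (hg : LocallyIntegrable g)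
    (x v : Sp d) :
    fderiv ℝ (moll hδ n g) x v
      = ∫ t, fderiv ℝ ((bump d hδ n).normed volume) (x - t) v * g t := by
  have hc := (bump d hδ n).hasCompactSupport_normed (μ := (volume : Measure (Sp d)))
  have hs : ContDiff ℝ 1 ((bump d hδ n).normed (volume : Measure (Sp d))) :=
    (bump d hδ n).contDiff_normed
  have := hc.hasFDerivAt_convolution_left (ContinuousLinearMap.lsmul ℝ ℝ) hs hg x
  rw [moll, this.fderiv, convolution_eq_swap]
  have hintegr : ConvolutionExistsAt (fderiv ℝ ((bump d hδ n).normed (volume : Measure (Sp d)))) g x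
      (ContinuousLinearMap.precompL (Sp d) (ContinuousLinearMap.lsmul ℝ ℝ)) volume :=
    (hc.fderiv ℝ).convolutionExists_left _ (hs.continuous_fderiv one_ne_zero) hg x
  have hintegr' := hintegr.integrable_swap
  rw [ContinuousLinearMap.integral_apply hintegr']
  rfl

theorem abs_moll_le {δ : ℝ} (hδ : 0 < δ) (n : ℕ) {g : Sp d → ℝ} {B : ℝ} (hB : ∀ x, |g x| ≤ B)
    (x : Sp d) : |moll hδ n g x| ≤ B := by
  have hi : Integrable ((bump d hδ n).normed (volume : Measure (Sp d))) :=
    (bump d hδ n).integrable_normed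
  rw [moll, convolution_def, ← Real.norm_eq_abs]
  calc _ ≤ ∫ t, (bump d hδ n).normed volume t * B := by
        apply norm_integral_le_of_norm_le (hi.mul_const B)
        refine Eventually.of_forall fun t => ?_
        have h0 := (bump d hδ n).nonneg_normed (μ := (volume : Measure (Sp d))) t
        simp only [ContinuousLinearMap.lsmul_apply, smul_eq_mul, norm_mul, Real.norm_eq_abs,
          abs_of_nonneg h0]
        gcongr
        exact hB _
    _ = B := by rw [integral_mul_const, (bump d hδ n).integral_normed, one_mul]

theorem tsupport_moll_subset {δ : ℝ} (hδ : 0 < δ) (n : ℕ) {g : Sp d → ℝ} {K : Set (Sp d)}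
    (hg : ∀ x ∉ K, g x = 0) : tsupport (moll hδ n g) ⊆ cthickening δ K := by
  refine closure_minimal ?_ isClosed_cthickening
  refine (support_convolution_subset _).trans ?_
  rw [(bump d hδ n).support_normed_eq]
  rintro _ ⟨a, ha, b, hb, rfl⟩
  have hbK : b ∈ K := by
    by_contra h
    exact hb (hg b h)
  refine mem_cthickening_of_dist_le _ b _ _ hbK ?_
  have h1 : dist a 0 < (bump d hδ n).rOut := ha
  have h2 : (bump d hδ n).rOut ≤ δ := by
    simp only [bump]
    exact div_le_self hδ.le (by linarith [Nat.cast_nonneg (α := ℝ) n])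
  simp only [dist_zero_right] at h1
  simp only [dist_eq_norm, add_sub_cancel_right]
  linarith

/-- Dominated convergence: mollification preserves the bound `B` and converges at Lebesgue points.
No regularity of `g` is needed, which allows test fields that jump across element faces. -/
theorem tendsto_integral_mul_moll [IsFiniteMeasure (volume.restrict Ω)] {δ : ℝ} (hδ : 0 < δ)
    {w g : Sp d → ℝ} (hw : MemLp w 2 (volume.restrict Ω)) {B : ℝ} (hB : ∀ x, |g x| ≤ B)
    (hg : LocallyIntegrable g) :
    Tendsto (fun n => ∫ x in Ω, w x * moll hδ n g x) atTop (𝓝 (∫ x in Ω, w x * g x)) := by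
  apply tendsto_integral_of_dominated_convergence (fun x => ‖w x‖ * B)
  · intro n
    exact hw.1.mul (contDiff_moll hδ n hg).continuous.aestronglyMeasurable
  · exact (hw.integrable one_le_two).norm.mul_const B
  · intro n
    refine Eventually.of_forall fun x => ?_
    rw [norm_mul]
    gcongr
    exact abs_moll_le hδ n hB x
  · have := ContDiffBump.ae_convolution_tendsto_right_of_locallyIntegrable (μ := volume) (K := 2)
      (tendsto_bump_rOut (d := d) hδ) (Eventually.of_forall fun n => by simp only [bump]; linarith) hg
    filter_upwards [ae_restrict_of_ae this] with x hx
    exact hx.const_mul _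

/-- The weak gradient may be tested with bounded fields, compactly supported in `Ω`, whose weak
divergence is bounded. -/
theorem IsWeakGrad.integral_mul_div_eq (hΩ : IsOpen Ω) [IsFiniteMeasure (volume.restrict Ω)]
    {w : Sp d → ℝ} {G : Sp d → Sp d} (hw : MemLp w 2 (volume.restrict Ω)) (hG : IsWeakGrad Ω w G)
    {ψ : Sp d → Sp d} {D : Sp d → ℝ} {K : Set (Sp d)} (hK : IsCompact K) (hKΩ : K ⊆ Ω)
    (hψm : AEStronglyMeasurable ψ volume) (hDm : AEStronglyMeasurable D volume) {B : ℝ}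
    (hψB : ∀ x, ‖ψ x‖ ≤ B) (hDB : ∀ x, |D x| ≤ B) (hψK : ∀ x ∉ K, ψ x = 0)
    (hdiv : ∀ η : Sp d → ℝ, ContDiff ℝ ∞ η → HasCompactSupport η →
      ∫ x, fderiv ℝ η x (ψ x) = - ∫ x, D x * η x) :
    ∫ x in Ω, w x * D x = - ∫ x in Ω, inner ℝ (G x) (ψ x) := by
  obtain ⟨δ, hδ, hδΩ⟩ := hK.exists_cthickening_subset_open hΩ hKΩ
  have hψk : ∀ k x, |ψ x k| ≤ B := fun k x =>
    (by simpa using PiLp.norm_apply_le (ψ x) k : |ψ x k| ≤ ‖ψ x‖).trans (hψB x)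
  have hψmk : ∀ k, AEStronglyMeasurable (fun x => ψ x k) volume := fun k =>
    (EuclideanSpace.proj k : Sp d →L[ℝ] ℝ).continuous.comp_aestronglyMeasurable hψm
  have hDl : LocallyIntegrable D := (memLp_top_of_bound hDm B
    (Eventually.of_forall fun x => by simpa using hDB x)).locallyIntegrable le_top
  have hψl : ∀ k, LocallyIntegrable (fun x => ψ x k) := fun k =>
    (memLp_top_of_bound (hψmk k) B
      (Eventually.of_forall fun x => by simpa using hψk k x)).locallyIntegrable le_top
  -- Mollification commutes with the weak divergence: testing `hdiv` with the translated and
  -- reflected kernel `t ↦ ρ (x - t)` shows that the divergence of the mollified field is the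
  -- mollification of `D`.
  have hsum : ∀ n x, ∑ k, fderiv ℝ (moll hδ n fun x => ψ x k) x (EuclideanSpace.single k 1)
      = moll hδ n D x := by
    intro n x
    set ρ := (bump d hδ n).normed (volume : Measure (Sp d)) with hρ
    have hρs : ContDiff ℝ ∞ ρ := (bump d hδ n).contDiff_normed
    have hρc : HasCompactSupport ρ := (bump d hδ n).hasCompactSupport_normed
    have hη := hdiv (fun t => ρ (x - t)) (hρs.comp (by fun_prop))
      (hρc.comp_homeomorph (Homeomorph.subLeft x))
    have hfd : ∀ t v, fderiv ℝ (fun t => ρ (x - t)) t v = - fderiv ℝ ρ (x - t) v := by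
      intro t v
      have h1 : HasFDerivAt (fun t => x - t) (-ContinuousLinearMap.id ℝ (Sp d)) t := by
        simpa using (hasFDerivAt_id t).const_sub x
      have := ((hρs.differentiable (by simp) (x - t)).hasFDerivAt.comp t h1).fderiv
      rw [show (fun t => ρ (x - t)) = ρ ∘ (fun t => x - t) from rfl, this]
      simp
    simp_rw [fderiv_moll_apply hδ n (hψl _), ← hρ]
    rw [← integral_finsetSum]
    · have : ∀ t, ∑ k, fderiv ℝ ρ (x - t) (EuclideanSpace.single k 1) * ψ t k
          = fderiv ℝ ρ (x - t) (ψ t) := by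
        intro t
        conv_rhs => rw [← (EuclideanSpace.basisFun (Fin d) ℝ).sum_repr (ψ t)]
        simp [map_sum, mul_comm]
      simp_rw [this]
      rw [moll_apply, ← hρ]
      simp_rw [hfd, integral_neg, neg_inj] at hη
      rw [hη]
      simp_rw [mul_comm]
    · intro k _
      have hc : Continuous fun t => fderiv ℝ ρ (x - t) (EuclideanSpace.single k 1) :=
        ((hρs.continuous_fderiv (by simp)).comp (by fun_prop)).clm_apply continuous_const
      have hcs : HasCompactSupport fun t => fderiv ℝ ρ (x - t) (EuclideanSpace.single k 1) :=
        (hρc.fderiv_apply ℝ (EuclideanSpace.single k 1)).comp_homeomorph (Homeomorph.subLeft x)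
      exact (hψl k).integrable_smul_left_of_hasCompactSupport hc hcs
  -- The mollified components are smooth and supported within `δ` of `K`, hence inside `Ω`, so each
  -- is admissible in the definition of the weak gradient.
  have hid : ∀ n, ∫ x in Ω, w x * moll hδ n D x
      = - ∑ k, ∫ x in Ω, G x k * moll hδ n (fun x => ψ x k) x := by
    intro n
    have hcomp : ∀ k, HasCompactSupport (moll hδ n fun x => ψ x k) := fun k =>
      HasCompactSupport.of_support_subset_isCompact hK.cthickening
        ((subset_tsupport _).trans
          (tsupport_moll_subset hδ n (K := K) fun x hx => by simp [hψK x hx]))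
    have hts : ∀ k, tsupport (moll hδ n fun x => ψ x k) ⊆ Ω := fun k =>
      (tsupport_moll_subset hδ n (K := K) fun x hx => by simp [hψK x hx]).trans hδΩ
    simp_rw [← hsum, Finset.mul_sum]
    rw [integral_finsetSum, ← Finset.sum_neg_distrib]
    · exact Finset.sum_congr rfl fun k _ =>
        hG.2 _ (contDiff_moll hδ n (hψl k)) (hcomp k) (hts k) k
    · intro k _
      exact hw.integrable_mul (memLp_fderiv_of_test (contDiff_moll hδ n (hψl k)) (hcomp k) _)
  have lim1 := tendsto_integral_mul_moll (Ω := Ω) hδ hw hDB hDl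
  have lim2 : Tendsto (fun n => - ∑ k, ∫ x in Ω, G x k * moll hδ n (fun x => ψ x k) x) atTop
      (𝓝 (- ∑ k, ∫ x in Ω, G x k * ψ x k)) :=
    (tendsto_finsetSum _ fun k _ =>
      tendsto_integral_mul_moll hδ (memLp_coord hG.1 k) (hψk k) (hψl k)).neg
  simp_rw [hid] at lim1
  rw [tendsto_nhds_unique lim1 lim2, ← integral_finsetSum]
  · congr 2; ext x
    simp [PiLp.inner_apply, mul_comm]
  · intro k _
    refine ((memLp_coord hG.1 k).integrable one_le_two).mul_bdd (c := B)
      (hψmk k).restrict (Eventually.of_forall fun x => by simpa using hψk k x)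

/-! ### Piecewise smooth bi-Lipschitz maps of `Ω` -/

/-- The properties of one direction of a piecewise smooth bi-Lipschitz bijection of `Ω`. -/
structure IsMeshMap (Ω : Set (Sp d)) (Λ : ℝ≥0) (F F' : Sp d → Sp d) (U U' : Set (Sp d)) :
    Prop where
  isOpen : IsOpen U
  subset : U ⊆ Ω
  null : volume (Ω \ U) = 0
  mapsTo : MapsTo F Ω Ω
  mapsToU : MapsTo F U U'
  left_inv : ∀ x ∈ Ω, F' (F x) = x
  diff : ∀ x ∈ U, DifferentiableAt ℝ F x
  locLip : LocLip Ω Λ F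

/-- A piecewise smooth bi-Lipschitz bijection of `Ω` with its inverse. -/
structure IsMeshIso (Ω : Set (Sp d)) (Λ : ℝ≥0) (F F' : Sp d → Sp d) (U U' : Set (Sp d)) :
    Prop where
  fwd : IsMeshMap Ω Λ F F' U U'
  bwd : IsMeshMap Ω Λ F' F U' U

/-- The determinant is the volume ratio of the image of the unit ball, and this image lies in the
ball of radius `Λ`. -/
theorem abs_det_le (L : Sp d →L[ℝ] Sp d) {Λ : ℝ} (h : ‖L‖ ≤ Λ) : |L.det| ≤ Λ ^ d := by
  have h0 : 0 ≤ Λ := (norm_nonneg _).trans h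
  have h1 := Measure.addHaar_image_continuousLinearMap volume L (closedBall 0 1)
  have h2 : L '' closedBall 0 1 ⊆ closedBall 0 Λ := by
    rintro _ ⟨x, hx, rfl⟩
    simp only [mem_closedBall, dist_zero_right] at hx ⊢
    calc ‖L x‖ ≤ ‖L‖ * ‖x‖ := L.le_opNorm x
      _ ≤ Λ * 1 := by gcongr
      _ = Λ := mul_one _
  have h3 := measure_mono (μ := (volume : Measure (Sp d))) h2
  rw [h1, Measure.addHaar_closedBall _ _ h0, Measure.addHaar_closedBall _ _ zero_le_one] at h3
  simp only [one_pow, ENNReal.ofReal_one, one_mul, finrank_euclideanSpace, Fintype.card_fin] at h3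
  have hpos : volume (ball (0 : Sp d) 1) ≠ 0 := (measure_ball_pos _ _ one_pos).ne'
  have hfin : volume (ball (0 : Sp d) 1) ≠ ⊤ := measure_ball_lt_top.ne
  rw [ENNReal.mul_le_mul_iff_left hpos hfin] at h3
  exact (ENNReal.ofReal_le_ofReal_iff (by positivity)).1 h3

theorem LocLip.norm_fderiv_le {F : Type*} [NormedAddCommGroup F] [NormedSpace ℝ F] {Λ : ℝ≥0}
    {f : Sp d → F} (h : LocLip Ω Λ f) {x : Sp d} (hx : x ∈ Ω) : ‖fderiv ℝ f x‖ ≤ Λ := by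
  obtain ⟨s, hs, hf⟩ := h x hx
  exact norm_fderiv_le_of_lipschitzOn ℝ hs hf

theorem LocLip.comp_lipschitz {Λ C : ℝ≥0} {F : Sp d → Sp d} {η : Sp d → ℝ} (h : LocLip Ω Λ F)
    (hη : LipschitzWith C η) : LocLip Ω (C * Λ) (fun x => η (F x)) := fun x hx => by
  obtain ⟨s, hs, hf⟩ := h x hx
  exact ⟨s, hs, hη.comp_lipschitzOnWith hf⟩

namespace IsMeshMap

variable {Λ : ℝ≥0} {F F' : Sp d → Sp d} {U U' : Set (Sp d)}

theorem restrict_eq (h : IsMeshMap Ω Λ F F' U U') :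
    (volume : Measure (Sp d)).restrict Ω = volume.restrict U := by
  apply Measure.restrict_congr_set
  exact (ae_eq_set.2 ⟨h.null, by simp [sdiff_eq_empty.2 h.subset]⟩)

theorem injOn (h : IsMeshMap Ω Λ F F' U U') : InjOn F U := fun x hx y hy hxy => by
  rw [← h.left_inv x (h.subset hx), ← h.left_inv y (h.subset hy), hxy]

theorem continuousOn (h : IsMeshMap Ω Λ F F' U U') : ContinuousOn F U :=
  h.locLip.continuousOn.mono h.subset

theorem aemeasurable (h : IsMeshMap Ω Λ F F' U U') : AEMeasurable F (volume.restrict Ω) := by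
  rw [h.restrict_eq]
  exact h.continuousOn.aemeasurable h.isOpen.measurableSet

theorem ae_mem (h : IsMeshMap Ω Λ F F' U U') : ∀ᵐ x ∂(volume.restrict Ω), x ∈ U := by
  rw [h.restrict_eq]
  exact ae_restrict_mem h.isOpen.measurableSet

end IsMeshMap

namespace IsMeshIso

variable {Λ : ℝ≥0} {F F' : Sp d → Sp d} {U U' : Set (Sp d)}

theorem symm (h : IsMeshIso Ω Λ F F' U U') : IsMeshIso Ω Λ F' F U' U := ⟨h.bwd, h.fwd⟩

theorem image_eq (h : IsMeshIso Ω Λ F F' U U') : F '' U = U' := by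
  refine subset_antisymm h.fwd.mapsToU.image_subset fun y hy => ?_
  exact ⟨F' y, h.bwd.mapsToU hy, h.bwd.left_inv y (h.bwd.subset hy)⟩

theorem fderiv_comp (h : IsMeshIso Ω Λ F F' U U') {x : Sp d} (hx : x ∈ U) :
    (fderiv ℝ F' (F x)).comp (fderiv ℝ F x) = ContinuousLinearMap.id ℝ (Sp d) := by
  have h1 := (h.bwd.diff _ (h.fwd.mapsToU hx)).hasFDerivAt.comp x (h.fwd.diff x hx).hasFDerivAt
  have h2 : F' ∘ F =ᶠ[𝓝 x] id := by
    filter_upwards [h.fwd.isOpen.mem_nhds hx] with y hy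
    exact h.fwd.left_inv y (h.fwd.subset hy)
  exact (h1.congr_of_eventuallyEq h2.symm).unique (hasFDerivAt_id x)

/-- Change of variables. -/
theorem integral_det_smul_comp {E : Type*} [NormedAddCommGroup E] [NormedSpace ℝ E]
    (h : IsMeshIso Ω Λ F F' U U') (g : Sp d → E) :
    ∫ x in Ω, |(fderiv ℝ F x).det| • g (F x) = ∫ y in Ω, g y := by
  have h1 : ∫ y in Ω, g y = ∫ y in F '' U, g y := by
    rw [h.image_eq, ← h.bwd.restrict_eq]
  rw [h1, h.fwd.restrict_eq]
  exact (integral_image_eq_integral_abs_det_fderiv_smul volume h.fwd.isOpen.measurableSet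
    (fun x hx => (h.fwd.diff x hx).hasFDerivAt.hasFDerivWithinAt) h.fwd.injOn g).symm

theorem integral_comp {E : Type*} [NormedAddCommGroup E] [NormedSpace ℝ E]
    (h : IsMeshIso Ω Λ F F' U U') (g : Sp d → E) :
    ∫ x in Ω, g (F x) = ∫ y in Ω, |(fderiv ℝ F' y).det| • g y := by
  rw [← h.symm.integral_det_smul_comp fun x => g (F x)]
  apply integral_congr_ae
  filter_upwards [h.bwd.ae_mem] with y hy
  rw [h.bwd.left_inv y (h.bwd.subset hy)]

theorem abs_det_fderiv_le (h : IsMeshIso Ω Λ F F' U U') {x : Sp d} (hx : x ∈ Ω) :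
    |(fderiv ℝ F x).det| ≤ (Λ : ℝ) ^ d :=
  abs_det_le _ (h.fwd.locLip.norm_fderiv_le hx)

theorem aestronglyMeasurable_fderiv (μ : Measure (Sp d)) (F : Sp d → Sp d) :
    AEStronglyMeasurable (fderiv ℝ F) μ :=
  (measurable_fderiv ℝ F).aestronglyMeasurable

theorem aestronglyMeasurable_abs_det (μ : Measure (Sp d)) (F : Sp d → Sp d) :
    AEStronglyMeasurable (fun x => |(fderiv ℝ F x).det|) μ :=
  (ContinuousLinearMap.continuous_det.abs).comp_aestronglyMeasurable
    (aestronglyMeasurable_fderiv μ F)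

/-- The preimage of a null set under `F` is, on `U`, its image under the differentiable inverse
`F'`, and differentiable maps send null sets to null sets. This makes composition with `F`
meaningful on almost-everywhere classes. -/
theorem map_absolutelyContinuous (h : IsMeshIso Ω Λ F F' U U') :
    (volume.restrict Ω).map F ≪ volume.restrict Ω := by
  refine Measure.AbsolutelyContinuous.mk fun s hs hs0 => ?_
  rw [Measure.map_apply_of_aemeasurable h.fwd.aemeasurable hs]
  rw [h.bwd.restrict_eq, Measure.restrict_apply hs] at hs0
  have h1 := addHaar_image_eq_zero_of_differentiableOn_of_addHaar_eq_zero volume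
    (f := F') (s := s ∩ U')
    (fun y hy => (h.bwd.diff y hy.2).differentiableWithinAt) hs0
  rw [h.fwd.restrict_eq, Measure.restrict_apply₀']
  · refine measure_mono_null ?_ h1
    rintro x ⟨hx, hxU⟩
    exact ⟨F x, ⟨hx, h.fwd.mapsToU hxU⟩, h.fwd.left_inv x (h.fwd.subset hxU)⟩
  · exact h.fwd.isOpen.measurableSet.nullMeasurableSet

theorem ae_comp (h : IsMeshIso Ω Λ F F' U U') {p : Sp d → Prop}
    (hp : ∀ᵐ y ∂(volume.restrict Ω), p y) : ∀ᵐ x ∂(volume.restrict Ω), p (F x) :=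
  ae_of_ae_map h.fwd.aemeasurable (h.map_absolutelyContinuous.ae_le hp)

theorem aestronglyMeasurable_comp {E : Type*} [TopologicalSpace E] (h : IsMeshIso Ω Λ F F' U U')
    {g : Sp d → E} (hg : AEStronglyMeasurable g (volume.restrict Ω)) :
    AEStronglyMeasurable (fun x => g (F x)) (volume.restrict Ω) :=
  (hg.mono_ac h.map_absolutelyContinuous).comp_aemeasurable h.fwd.aemeasurable

theorem integrable_comp {E : Type*} [NormedAddCommGroup E] [NormedSpace ℝ E]
    (h : IsMeshIso Ω Λ F F' U U') {g : Sp d → E} (hg : Integrable g (volume.restrict Ω)) :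
    Integrable (fun x => g (F x)) (volume.restrict Ω) := by
  have h1 : Integrable (fun y => |(fderiv ℝ F' y).det| • g y) (volume.restrict Ω) := by
    refine hg.bdd_smul ((Λ : ℝ) ^ d) (aestronglyMeasurable_abs_det _ F') ?_
    filter_upwards [h.bwd.ae_mem] with y hy
    simpa using h.symm.abs_det_fderiv_le (h.bwd.subset hy)
  have h2 := integrableOn_image_iff_integrableOn_abs_det_fderiv_smul volume
    h.bwd.isOpen.measurableSet
    (fun x hx => (h.bwd.diff x hx).hasFDerivAt.hasFDerivWithinAt) h.bwd.injOn (fun x => g (F x))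
  rw [h.symm.image_eq, IntegrableOn, IntegrableOn, ← h.fwd.restrict_eq, ← h.bwd.restrict_eq] at h2
  rw [h2]
  refine h1.congr ?_
  filter_upwards [h.bwd.ae_mem] with y hy
  rw [h.bwd.left_inv y (h.bwd.subset hy)]

theorem memLp_comp {E : Type*} [NormedAddCommGroup E] [NormedSpace ℝ E]
    (h : IsMeshIso Ω Λ F F' U U') {g : Sp d → E} (hg : MemLp g 2 (volume.restrict Ω)) :
    MemLp (fun x => g (F x)) 2 (volume.restrict Ω) := by
  rw [memLp_two_iff_integrable_sq_norm (h.aestronglyMeasurable_comp hg.1)]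
  exact h.integrable_comp ((memLp_two_iff_integrable_sq_norm hg.1).1 hg)

/-- The pulled back gradient. -/
def pullGrad (F : Sp d → Sp d) (G : Sp d → Sp d) : Sp d → Sp d :=
  fun x => ContinuousLinearMap.adjoint (fderiv ℝ F x) (G (F x))

theorem memLp_pullGrad (h : IsMeshIso Ω Λ F F' U U') {G : Sp d → Sp d}
    (hG : MemLp G 2 (volume.restrict Ω)) : MemLp (pullGrad F G) 2 (volume.restrict Ω) := by
  have h1 := h.memLp_comp hG
  refine MemLp.of_le_mul (c := (Λ : ℝ)) h1 ?_ ?_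
  · have h2 : AEStronglyMeasurable (fun x => ContinuousLinearMap.adjoint (fderiv ℝ F x))
        (volume.restrict Ω) :=
      (ContinuousLinearMap.adjoint (𝕜 := ℝ) (E := Sp d) (F := Sp d)).continuous.comp_aestronglyMeasurable
        (aestronglyMeasurable_fderiv _ F)
    exact (isBoundedBilinearMap_apply (𝕜 := ℝ) (E := Sp d) (F := Sp d)).continuous.comp_aestronglyMeasurable (h2.prodMk h1.1)
  · filter_upwards [h.fwd.ae_mem] with x hx
    refine (ContinuousLinearMap.le_opNorm _ _).trans ?_
    gcongr
    rw [LinearIsometryEquiv.norm_map]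
    exact h.fwd.locLip.norm_fderiv_le (h.fwd.subset hx)

/-- The chain rule for weak gradients. -/
theorem isWeakGrad_comp (hΩ : IsOpen Ω) [IsFiniteMeasure (volume.restrict Ω)]
    (h : IsMeshIso Ω Λ F F' U U') {w : Sp d → ℝ} {G : Sp d → Sp d}
    (hw : MemLp w 2 (volume.restrict Ω)) (hG : IsWeakGrad Ω w G) :
    IsWeakGrad Ω (fun x => w (F x)) (pullGrad F G) := by
  refine ⟨h.memLp_pullGrad hG.1, fun θ hθ hθc hθΩ k => ?_⟩
  set e : Sp d := EuclideanSpace.single k 1 with he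
  set K : Set (Sp d) := F '' tsupport θ with hKdef
  have hK : IsCompact K := hθc.isCompact.image_of_continuousOn (h.fwd.locLip.continuousOn.mono hθΩ)
  have hKΩ : K ⊆ Ω := by
    rintro _ ⟨x, hx, rfl⟩
    exact h.fwd.mapsTo (hθΩ hx)
  have hmemK : ∀ y ∈ U', F' y ∈ tsupport θ → y ∈ K := fun y hy hy' =>
    ⟨F' y, hy', h.bwd.left_inv y (h.bwd.subset hy)⟩
  -- The Piola transform of the field `θ e`. Since `F'` is only piecewise smooth, `θ ∘ F'` is not an
  -- admissible test function; but `ψ`, although discontinuous across faces, has the bounded weak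
  -- divergence `D`.
  set ψ : Sp d → Sp d := U'.indicator fun y =>
    |(fderiv ℝ F' y).det| • (θ (F' y) • fderiv ℝ F (F' y) e) with hψ
  set D : Sp d → ℝ := U'.indicator fun y => |(fderiv ℝ F' y).det| • fderiv ℝ θ (F' y) e with hD
  have hU'm := h.bwd.isOpen.measurableSet
  have hF'm : AEMeasurable F' (volume.restrict U') := by
    rw [← h.bwd.restrict_eq]; exact h.bwd.aemeasurable
  have hdθ : Continuous fun x => fderiv ℝ θ x e :=
    (hθ.continuous_fderiv (by simp)).clm_apply continuous_const
  have hψm : AEStronglyMeasurable ψ volume := by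
    rw [hψ, aestronglyMeasurable_indicator_iff hU'm]
    refine (aestronglyMeasurable_abs_det _ F').fun_smul (AEStronglyMeasurable.fun_smul ?_ ?_)
    · exact (hθ.continuous.measurable.comp_aemeasurable hF'm).aestronglyMeasurable
    · exact ((measurable_fderiv_apply_const ℝ F e).comp_aemeasurable hF'm).aestronglyMeasurable
  have hDm : AEStronglyMeasurable D volume := by
    rw [hD, aestronglyMeasurable_indicator_iff hU'm]
    refine (aestronglyMeasurable_abs_det _ F').smul ?_
    exact (hdθ.measurable.comp_aemeasurable hF'm).aestronglyMeasurable
  obtain ⟨M₁, hM₁⟩ := hθ.continuous.bounded_above_of_compact_support hθc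
  obtain ⟨M₂, hM₂⟩ := hdθ.bounded_above_of_compact_support (hθc.fderiv_apply ℝ e)
  have hM₁0 : 0 ≤ M₁ := (norm_nonneg _).trans (hM₁ 0)
  have hM₂0 : 0 ≤ M₂ := (norm_nonneg _).trans (hM₂ 0)
  have hψB : ∀ y, ‖ψ y‖ ≤ (Λ : ℝ) ^ d * (M₁ * (Λ * ‖e‖)) := by
    intro y
    by_cases hy : y ∈ U'
    · rw [hψ, indicator_of_mem hy, norm_smul, norm_smul, Real.norm_eq_abs, abs_abs]
      gcongr
      · exact h.symm.abs_det_fderiv_le (h.bwd.subset hy)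
      · exact hM₁ _
      · refine (ContinuousLinearMap.le_opNorm _ _).trans ?_
        gcongr
        exact h.fwd.locLip.norm_fderiv_le (h.bwd.mapsTo (h.bwd.subset hy))
    · rw [hψ, indicator_of_notMem hy, norm_zero]; positivity
  have hDB : ∀ y, |D y| ≤ (Λ : ℝ) ^ d * M₂ := by
    intro y
    by_cases hy : y ∈ U'
    · rw [hD, indicator_of_mem hy, smul_eq_mul, abs_mul, abs_abs]
      gcongr
      · exact h.symm.abs_det_fderiv_le (h.bwd.subset hy)
      · exact hM₂ _
    · rw [hD, indicator_of_notMem hy, abs_zero]; positivity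
  have hψK : ∀ y ∉ K, ψ y = 0 := by
    intro y hy
    by_cases hyU : y ∈ U'
    · have : θ (F' y) = 0 := by
        by_contra h0
        exact hy (hmemK y hyU (subset_tsupport _ h0))
      simp [hψ, this]
    · rw [hψ, indicator_of_notMem hyU]
  -- After the change of variables both sides live on the source side, where the claim is
  -- integration by parts of the Lipschitz function `η ∘ F` against `θ`. Hence no contributions
  -- arise on the faces.
  have hdiv : ∀ η : Sp d → ℝ, ContDiff ℝ ∞ η → HasCompactSupport η →
      ∫ x, fderiv ℝ η x (ψ x) = - ∫ x, D x * η x := by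
    intro η hη hηc
    obtain ⟨C, hC⟩ := (hη.of_le (by simp)).lipschitzWith_of_hasCompactSupport hηc one_ne_zero
    have hibp := integral_mul_fderiv_eq_neg_lineDeriv hΩ (h.fwd.locLip.comp_lipschitz hC)
      hθ hθc hθΩ e
    have e1 : ∫ x, fderiv ℝ η x (ψ x) = ∫ x in Ω, lineDeriv ℝ (fun x => η (F x)) x e * θ x := by
      rw [← h.symm.integral_det_smul_comp (fun x => lineDeriv ℝ (fun x => η (F x)) x e * θ x),
        h.bwd.restrict_eq, ← integral_indicator hU'm]
      congr 1; ext y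
      by_cases hy : y ∈ U'
      · have hx := h.bwd.mapsToU hy
        have hd : HasFDerivAt (fun x => η (F x)) ((fderiv ℝ η (F (F' y))).comp
            (fderiv ℝ F (F' y))) (F' y) :=
          (hη.differentiable (by simp) _).hasFDerivAt.comp _ (h.fwd.diff _ hx).hasFDerivAt
        rw [indicator_of_mem hy, hψ, indicator_of_mem hy, hd.hasLineDerivAt e |>.lineDeriv,
          h.bwd.left_inv y (h.bwd.subset hy)]
        simp only [map_smul, smul_eq_mul, ContinuousLinearMap.comp_apply]
        ring
      · rw [indicator_of_notMem hy, hψ, indicator_of_notMem hy, map_zero]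
    have e2 : ∫ x, D x * η x = ∫ x in Ω, η (F x) * fderiv ℝ θ x e := by
      rw [← h.symm.integral_det_smul_comp (fun x => η (F x) * fderiv ℝ θ x e),
        h.bwd.restrict_eq, ← integral_indicator hU'm]
      congr 1; ext y
      by_cases hy : y ∈ U'
      · rw [indicator_of_mem hy, hD, indicator_of_mem hy, h.bwd.left_inv y (h.bwd.subset hy)]
        simp; ring
      · rw [indicator_of_notMem hy, hD, indicator_of_notMem hy, zero_mul]
    rw [e1, e2, hibp, neg_neg]
  have key := hG.integral_mul_div_eq hΩ hw hK hKΩ hψm hDm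
    (fun y => (hψB y).trans (le_max_left _ ((Λ : ℝ) ^ d * M₂)))
    (fun y => (hDB y).trans (le_max_right _ _)) hψK hdiv
  have e1 : ∫ x in Ω, w (F x) * fderiv ℝ θ x e = ∫ y in Ω, w y * D y := by
    rw [← h.symm.integral_det_smul_comp (fun x => w (F x) * fderiv ℝ θ x e)]
    apply integral_congr_ae
    filter_upwards [h.bwd.ae_mem] with y hy
    rw [hD, indicator_of_mem hy, h.bwd.left_inv y (h.bwd.subset hy)]
    simp; ring
  have e2 : ∫ x in Ω, pullGrad F G x k * θ x = ∫ y in Ω, inner ℝ (G y) (ψ y) := by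
    rw [← h.symm.integral_det_smul_comp (fun x => pullGrad F G x k * θ x)]
    apply integral_congr_ae
    filter_upwards [h.bwd.ae_mem] with y hy
    have h1 : pullGrad F G (F' y) k = inner ℝ (G y) (fderiv ℝ F (F' y) e) := by
      rw [pullGrad, h.bwd.left_inv y (h.bwd.subset hy), ← ContinuousLinearMap.adjoint_inner_left,
        he, EuclideanSpace.inner_single_right]
      simp
    rw [hψ, indicator_of_mem hy, h1, inner_smul_right, inner_smul_right]
    simp only [smul_eq_mul]
    ring
  rw [e1, e2, key]

theorem memH1_comp (hΩ : IsOpen Ω) [IsFiniteMeasure (volume.restrict Ω)]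
    (h : IsMeshIso Ω Λ F F' U U') {w : Sp d → ℝ} (hw : MemH1 Ω w) :
    MemH1 Ω (fun x => w (F x)) :=
  ⟨h.memLp_comp hw.1, _, h.isWeakGrad_comp hΩ hw.1 hw.isWeakGrad⟩

/-! ### Norms and inner products under mesh maps -/

/-- The determinants of `F` and of its inverse multiply to one and both are at most `Λ ^ d`, so each
lies between `Λ ^ (-d)` and `Λ ^ d`. -/
theorem abs_abs_det_sub_one_le (h : IsMeshIso Ω Λ F F' U U') {x : Sp d} (hx : x ∈ U) :
    |(|(fderiv ℝ F x).det| - 1)| ≤ (Λ : ℝ) ^ d - 1 := by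
  have h1 := h.abs_det_fderiv_le (h.fwd.subset hx)
  have h2 := h.symm.abs_det_fderiv_le (h.bwd.subset (h.fwd.mapsToU hx))
  have h3 : (fderiv ℝ F' (F x)).det * (fderiv ℝ F x).det = 1 := by
    have := congrArg ContinuousLinearMap.det (h.fderiv_comp hx)
    simp only [ContinuousLinearMap.det, ContinuousLinearMap.toLinearMap_comp,
      LinearMap.det_comp] at this
    exact this.trans LinearMap.det_id
  have h4 : |(fderiv ℝ F' (F x)).det| * |(fderiv ℝ F x).det| = 1 := by rw [← abs_mul, h3, abs_one]
  set p := |(fderiv ℝ F' (F x)).det|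
  set q := |(fderiv ℝ F x).det|
  have hp : 0 ≤ p := abs_nonneg _
  have hq : 0 ≤ q := abs_nonneg _
  have hM : 1 ≤ (Λ : ℝ) ^ d := by nlinarith
  rw [abs_le]
  constructor <;> nlinarith [sq_nonneg (q - 1)]

theorem norm_adjoint_le (h : IsMeshIso Ω Λ F F' U U') {x : Sp d} (hx : x ∈ Ω) (p : Sp d) :
    ‖ContinuousLinearMap.adjoint (fderiv ℝ F x) p‖ ≤ Λ * ‖p‖ := by
  refine (ContinuousLinearMap.le_opNorm _ _).trans ?_
  gcongr
  rw [LinearIsometryEquiv.norm_map]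
  exact h.fwd.locLip.norm_fderiv_le hx

theorem le_norm_adjoint (h : IsMeshIso Ω Λ F F' U U') {x : Sp d} (hx : x ∈ U) (p : Sp d) :
    ‖p‖ ≤ Λ * ‖ContinuousLinearMap.adjoint (fderiv ℝ F x) p‖ := by
  have hy := h.fwd.mapsToU hx
  have h1 := h.symm.fderiv_comp hy
  rw [h.fwd.left_inv x (h.fwd.subset hx)] at h1
  have h2 := congrArg ContinuousLinearMap.adjoint h1
  rw [ContinuousLinearMap.adjoint_comp] at h2
  have h3 : p = ContinuousLinearMap.adjoint (fderiv ℝ F' (F x))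
      (ContinuousLinearMap.adjoint (fderiv ℝ F x) p) := by
    have := congrArg (fun L => L p) h2
    simp only [ContinuousLinearMap.comp_apply] at this
    rw [this]
    apply ext_inner_left ℝ
    intro v
    rw [ContinuousLinearMap.adjoint_inner_right]; rfl
  conv_lhs => rw [h3]
  exact h.symm.norm_adjoint_le (h.bwd.subset hy) _

/-- For norms the bound follows from the two-sided estimate by `Λ`; polarization carries it over to
inner products. -/
theorem abs_inner_adjoint_sub_le (h : IsMeshIso Ω Λ F F' U U') (hΛ : 1 ≤ Λ) {x : Sp d}
    (hx : x ∈ U) (p q : Sp d) :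
    |inner ℝ (ContinuousLinearMap.adjoint (fderiv ℝ F x) p)
        (ContinuousLinearMap.adjoint (fderiv ℝ F x) q) - inner ℝ p q|
      ≤ ((Λ : ℝ) ^ 2 - 1) * ((‖p‖ ^ 2 + ‖q‖ ^ 2) / 2) := by
  set A := ContinuousLinearMap.adjoint (fderiv ℝ F x)
  have hΛ' : (1 : ℝ) ≤ Λ := by exact_mod_cast hΛ
  have hsq : ∀ v : Sp d, |‖A v‖ ^ 2 - ‖v‖ ^ 2| ≤ ((Λ : ℝ) ^ 2 - 1) * ‖v‖ ^ 2 := by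
    intro v
    have h1 : ‖A v‖ ^ 2 ≤ (Λ * ‖v‖) ^ 2 := by gcongr; exact h.norm_adjoint_le (h.fwd.subset hx) v
    have h2 : ‖v‖ ^ 2 ≤ (Λ * ‖A v‖) ^ 2 := by gcongr; exact h.le_norm_adjoint hx v
    rw [mul_pow] at h1 h2
    have hL : (1 : ℝ) ≤ (Λ : ℝ) ^ 2 := one_le_pow₀ hΛ'
    have h3 := sq_nonneg ‖A v‖
    have h4 := sq_nonneg ‖v‖
    rw [abs_le]
    constructor <;> nlinarith [mul_nonneg (sub_nonneg.2 hL) h4, mul_nonneg (sub_nonneg.2 hL) h3]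
  have i1 : inner ℝ (A p) (A q) = (‖A (p + q)‖ ^ 2 - ‖A (p - q)‖ ^ 2) / 4 := by
    rw [map_add, map_sub, norm_add_sq_real, norm_sub_sq_real]; ring
  have i2 : inner ℝ p q = (‖p + q‖ ^ 2 - ‖p - q‖ ^ 2) / 4 := by
    rw [norm_add_sq_real, norm_sub_sq_real]; ring
  have i3 : ‖p + q‖ ^ 2 + ‖p - q‖ ^ 2 = 2 * (‖p‖ ^ 2 + ‖q‖ ^ 2) := by
    rw [norm_add_sq_real, norm_sub_sq_real]; ring
  have h1 := abs_le.1 (hsq (p + q))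
  have h2 := abs_le.1 (hsq (p - q))
  rw [i1, i2, abs_le]
  constructor <;> nlinarith

end IsMeshIso

theorem integrable_sq_of_memLp {X : Type*} [MeasurableSpace X] {μ : Measure X} {f : X → ℝ}
    (hf : MemLp f 2 μ) : Integrable (fun x => f x ^ 2) μ :=
  (memLp_two_iff_integrable_sq hf.1).1 hf

theorem integrable_norm_sq_of_memLp {X E : Type*} [MeasurableSpace X] [NormedAddCommGroup E]
    {μ : Measure X} {f : X → E} (hf : MemLp f 2 μ) : Integrable (fun x => ‖f x‖ ^ 2) μ :=
  (memLp_two_iff_integrable_sq_norm hf.1).1 hf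

theorem integrable_inner_of_memLp {X : Type*} [MeasurableSpace X] {μ : Measure X}
    {f g : X → Sp d} (hf : MemLp f 2 μ) (hg : MemLp g 2 μ) :
    Integrable (fun x => inner ℝ (f x) (g x)) μ := by
  refine Integrable.mono' (integrable_mul_of_memLp hf.norm hg.norm) (hf.1.inner hg.1) ?_
  exact Eventually.of_forall fun x => abs_real_inner_le_norm _ _

namespace IsMeshIso

variable {Λ : ℝ≥0} {F F' : Sp d → Sp d} {U U' : Set (Sp d)}

/-- The change of variables moves the whole difference into the factor `|det| - 1`. For `Λ = 1 +
O(Δt)` the error is `O(Δt)`, small enough for a Gronwall argument. -/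
theorem abs_ip_comp_sub_le (h : IsMeshIso Ω Λ F F' U U') {P Q : Sp d → ℝ}
    (hP : MemLp P 2 (volume.restrict Ω)) (hQ : MemLp Q 2 (volume.restrict Ω)) :
    |ip Ω (fun x => P (F x)) (fun x => Q (F x)) - ip Ω P Q|
      ≤ ((Λ : ℝ) ^ d - 1) * ((norm0Sq Ω P + norm0Sq Ω Q) / 2) := by
  have hi := integrable_mul_of_memLp hP hQ
  have e1 : ip Ω (fun x => P (F x)) (fun x => Q (F x))
      = ∫ y in Ω, |(fderiv ℝ F' y).det| • (P y * Q y) := h.integral_comp fun y => P y * Q y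
  have hi' : Integrable (fun y => |(fderiv ℝ F' y).det| • (P y * Q y)) (volume.restrict Ω) := by
    refine hi.bdd_smul ((Λ : ℝ) ^ d) (aestronglyMeasurable_abs_det _ F') ?_
    filter_upwards [h.bwd.ae_mem] with y hy
    simpa using h.symm.abs_det_fderiv_le (h.bwd.subset hy)
  have hP2 := integrable_sq_of_memLp hP
  have hQ2 := integrable_sq_of_memLp hQ
  rw [e1, ip, ← integral_sub hi' hi, norm0Sq, norm0Sq, ← integral_add hP2 hQ2, ← integral_div,
    ← integral_const_mul, ← Real.norm_eq_abs]
  refine norm_integral_le_of_norm_le (((hP2.add hQ2).div_const 2).const_mul _) ?_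
  filter_upwards [h.bwd.ae_mem] with y hy
  have h1 := h.symm.abs_abs_det_sub_one_le hy
  have h2 : |P y * Q y| ≤ (P y ^ 2 + Q y ^ 2) / 2 := by
    rw [abs_le]; constructor <;> nlinarith [sq_nonneg (P y + Q y), sq_nonneg (P y - Q y)]
  have h3 : |(fderiv ℝ F' y).det| • (P y * Q y) - P y * Q y
      = (|(fderiv ℝ F' y).det| - 1) * (P y * Q y) := by simp; ring
  rw [h3, Real.norm_eq_abs, abs_mul]
  exact mul_le_mul h1 h2 (abs_nonneg _) ((abs_nonneg _).trans h1)

theorem norm0Sq_comp_le (h : IsMeshIso Ω Λ F F' U U') {P : Sp d → ℝ}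
    (hP : MemLp P 2 (volume.restrict Ω)) :
    norm0Sq Ω (fun x => P (F x)) ≤ (Λ : ℝ) ^ d * norm0Sq Ω P := by
  have h1 := (abs_le.1 (h.abs_ip_comp_sub_le hP hP)).2
  have h2 : ∀ v : Sp d → ℝ, ip Ω v v = norm0Sq Ω v := fun v => by simp [ip, norm0Sq, sq]
  rw [h2, h2] at h1
  linarith

theorem semi1Sq_comp_le (hΩ : IsOpen Ω) [IsFiniteMeasure (volume.restrict Ω)]
    (h : IsMeshIso Ω Λ F F' U U') {P : Sp d → ℝ} (hP : MemH1 Ω P) :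
    semi1Sq Ω (fun x => P (F x)) ≤ (Λ : ℝ) ^ (d + 2) * semi1Sq Ω P := by
  have hw := h.isWeakGrad_comp hΩ hP.1 hP.isWeakGrad
  have hG := hP.isWeakGrad.1
  have i0 : Integrable (fun y => ‖wgrad Ω P y‖ ^ 2) (volume.restrict Ω) :=
    integrable_norm_sq_of_memLp hG
  have i1 : Integrable (fun y => |(fderiv ℝ F' y).det| • ‖wgrad Ω P y‖ ^ 2)
      (volume.restrict Ω) := by
    refine i0.bdd_smul ((Λ : ℝ) ^ d) (aestronglyMeasurable_abs_det _ F') ?_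
    filter_upwards [h.bwd.ae_mem] with y hy
    simpa using h.symm.abs_det_fderiv_le (h.bwd.subset hy)
  rw [hw.semi1Sq_eq hΩ]
  calc ∫ x in Ω, ‖pullGrad F (wgrad Ω P) x‖ ^ 2
      ≤ ∫ x in Ω, (Λ : ℝ) ^ 2 * ‖wgrad Ω P (F x)‖ ^ 2 := by
        refine integral_mono_ae (integrable_norm_sq_of_memLp hw.1)
          ((integrable_norm_sq_of_memLp (h.memLp_comp hG)).const_mul _) ?_
        filter_upwards [h.fwd.ae_mem] with x hx
        rw [← mul_pow]
        gcongr
        exact h.norm_adjoint_le (h.fwd.subset hx) _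
    _ = (Λ : ℝ) ^ 2 * ∫ y in Ω, |(fderiv ℝ F' y).det| • ‖wgrad Ω P y‖ ^ 2 := by
        rw [integral_const_mul, h.integral_comp fun y => ‖wgrad Ω P y‖ ^ 2]
    _ ≤ (Λ : ℝ) ^ 2 * ((Λ : ℝ) ^ d * semi1Sq Ω P) := by
        gcongr
        rw [semi1Sq, ← integral_const_mul]
        refine integral_mono_ae i1 (i0.const_mul _) ?_
        filter_upwards [h.bwd.ae_mem] with y hy
        simp only [smul_eq_mul]
        gcongr
        exact h.symm.abs_det_fderiv_le (h.bwd.subset hy)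
    _ = _ := by ring

/-- The weighted gradient inner products before and after a mesh map are close. -/
theorem abs_weighted_comp_sub_le (hΩ : IsOpen Ω) [IsFiniteMeasure (volume.restrict Ω)]
    (h : IsMeshIso Ω Λ F F' U U') (hΛ : 1 ≤ Λ) {P Q : Sp d → ℝ} (hP : MemH1 Ω P)
    (hQ : MemH1 Ω Q) {a₁ a₂ : Sp d → ℝ} {A η : ℝ}
    (ha₁m : AEStronglyMeasurable a₁ (volume.restrict Ω))
    (ha₂m : AEStronglyMeasurable a₂ (volume.restrict Ω)) (ha₁ : ∀ x ∈ Ω, |a₁ x| ≤ A)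
    (ha₂ : ∀ x ∈ Ω, |a₂ x| ≤ A) (hη : ∀ x ∈ Ω, |a₁ x - a₂ (F x)| ≤ η) :
    |(∫ x in Ω, a₁ x * inner ℝ (wgrad Ω (fun x => P (F x)) x) (wgrad Ω (fun x => Q (F x)) x))
        - ∫ x in Ω, a₂ x * inner ℝ (wgrad Ω P x) (wgrad Ω Q x)|
      ≤ (A * ((Λ : ℝ) ^ (d + 2) - 1) + η) * ((semi1Sq Ω P + semi1Sq Ω Q) / 2) := by
  have hΛ' : (1 : ℝ) ≤ Λ := by exact_mod_cast hΛ
  have hGP := hP.isWeakGrad.1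
  have hGQ := hQ.isWeakGrad.1
  have hcP := (h.isWeakGrad_comp hΩ hP.1 hP.isWeakGrad)
  have hcQ := (h.isWeakGrad_comp hΩ hQ.1 hQ.isWeakGrad)
  set p := wgrad Ω P
  set q := wgrad Ω Q
  have hΩae : ∀ᵐ x ∂(volume.restrict Ω), x ∈ Ω := ae_restrict_mem hΩ.measurableSet
  have j1 : Integrable (fun x => a₁ x * inner ℝ (pullGrad F p x) (pullGrad F q x))
      (volume.restrict Ω) := by
    refine (integrable_inner_of_memLp hcP.1 hcQ.1).bdd_mul (c := A) ha₁m ?_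
    filter_upwards [hΩae] with x hx using ha₁ x hx
  have j2 : Integrable (fun x => a₂ x * inner ℝ (p x) (q x)) (volume.restrict Ω) := by
    refine (integrable_inner_of_memLp hGP hGQ).bdd_mul (c := A) ha₂m ?_
    filter_upwards [hΩae] with x hx using ha₂ x hx
  have e1 : ∫ x in Ω, a₁ x * inner ℝ (wgrad Ω (fun x => P (F x)) x) (wgrad Ω (fun x => Q (F x)) x)
      = ∫ y in Ω, |(fderiv ℝ F' y).det| • (a₁ (F' y) *
          inner ℝ (pullGrad F p (F' y)) (pullGrad F q (F' y))) := by
    rw [h.symm.integral_det_smul_comp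
      fun x => a₁ x * inner ℝ (pullGrad F p x) (pullGrad F q x)]
    apply integral_congr_ae
    filter_upwards [hcP.wgrad_eq hΩ, hcQ.wgrad_eq hΩ] with x h1 h2
    rw [h1, h2]
  have j3 : Integrable (fun y => |(fderiv ℝ F' y).det| • (a₁ (F' y) *
      inner ℝ (pullGrad F p (F' y)) (pullGrad F q (F' y)))) (volume.restrict Ω) := by
    refine (h.symm.integrable_comp j1).bdd_smul ((Λ : ℝ) ^ d)
      (aestronglyMeasurable_abs_det _ F') ?_
    filter_upwards [h.bwd.ae_mem] with y hy
    simpa using h.symm.abs_det_fderiv_le (h.bwd.subset hy)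
  have hP2 := integrable_norm_sq_of_memLp hGP
  have hQ2 := integrable_norm_sq_of_memLp hGQ
  rw [e1, ← integral_sub j3 j2, semi1Sq, semi1Sq, ← integral_add hP2 hQ2, ← integral_div,
    ← integral_const_mul, ← Real.norm_eq_abs]
  refine norm_integral_le_of_norm_le (((hP2.add hQ2).div_const 2).const_mul _) ?_
  filter_upwards [h.bwd.ae_mem] with y hy
  have hyΩ := h.bwd.subset hy
  have hFy := h.bwd.left_inv y hyΩ
  have hxU := h.bwd.mapsToU hy
  have b1 := h.abs_inner_adjoint_sub_le hΛ hxU (p y) (q y)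
  have b2 := h.symm.abs_abs_det_sub_one_le hy
  have b2' := h.symm.abs_det_fderiv_le hyΩ
  have b3 := hη (F' y) (h.fwd.subset hxU)
  have b4 := ha₁ (F' y) (h.fwd.subset hxU)
  rw [hFy] at b3
  have b5 : |inner ℝ (p y) (q y)| ≤ (‖p y‖ ^ 2 + ‖q y‖ ^ 2) / 2 := by
    refine (abs_real_inner_le_norm _ _).trans ?_
    nlinarith [sq_nonneg (‖p y‖ - ‖q y‖)]
  have hA : 0 ≤ A := (abs_nonneg _).trans b4
  have hη0 : 0 ≤ η := (abs_nonneg _).trans b3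
  simp only [pullGrad, hFy, smul_eq_mul]
  set X := inner ℝ (ContinuousLinearMap.adjoint (fderiv ℝ F (F' y)) (p y))
    (ContinuousLinearMap.adjoint (fderiv ℝ F (F' y)) (q y))
  set Y := inner ℝ (p y) (q y)
  set D := |(fderiv ℝ F' y).det|
  set N := (‖p y‖ ^ 2 + ‖q y‖ ^ 2) / 2
  have hN : 0 ≤ N := by positivity
  have hD : 0 ≤ D := abs_nonneg _
  -- Three sources of error are separated: the rotation and stretching of gradients, the volume
  -- factor, and the variation of the weight. The first two add up to `Λ ^ d * (Λ ^ 2 - 1) + (Λ ^ d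
  -- - 1) = Λ ^ (d + 2) - 1`.
  have e3 : D * (a₁ (F' y) * X) - a₂ y * Y = D * (a₁ (F' y) * (X - Y))
      + (a₁ (F' y) * ((D - 1) * Y)) + (a₁ (F' y) - a₂ y) * Y := by ring
  rw [e3, Real.norm_eq_abs]
  calc _ ≤ D * (|a₁ (F' y)| * |X - Y|) + |a₁ (F' y)| * (|D - 1| * |Y|)
          + |a₁ (F' y) - a₂ y| * |Y| := by
        refine (abs_add_three _ _ _).trans ?_
        simp only [abs_mul, abs_of_nonneg hD]
        exact le_rfl
    _ ≤ (Λ : ℝ) ^ d * (A * (((Λ : ℝ) ^ 2 - 1) * N)) + A * (((Λ : ℝ) ^ d - 1) * N) + η * N := by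
        gcongr
        exact (abs_nonneg _).trans b2
    _ = (A * ((Λ : ℝ) ^ (d + 2) - 1) + η) * N := by ring

end IsMeshIso

/-! ### Elements of a moving mesh -/

/-- The barycentric coordinates of a point of the reference element. -/
def bary (y : Sp d) : Fin (d + 1) → ℝ := Fin.cons (1 - ∑ k, y k) fun k => y k

theorem sum_bary (y : Sp d) : ∑ k, bary y k = 1 := by
  simp [bary, Fin.sum_univ_succ]

theorem bary_nonneg {y : Sp d} (hy : y ∈ refSimplex d) (k : Fin (d + 1)) : 0 ≤ bary y k := by
  refine Fin.cases ?_ (fun k => ?_) k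
  · simpa [bary] using hy.2
  · simpa [bary] using hy.1 k

namespace MovingMesh

variable (M : MovingMesh d)

/-- The linear part of the isoparametric map. -/
def lin (e : M.Elem) (t : ℝ) : Sp d →L[ℝ] Sp d :=
  Matrix.toEuclideanCLM (n := Fin d) (𝕜 := ℝ) (M.jac e t)

/-- The inverse of the linear part of the isoparametric map. -/
def linInv (e : M.Elem) (t : ℝ) : Sp d →L[ℝ] Sp d :=
  Matrix.toEuclideanCLM (n := Fin d) (𝕜 := ℝ) (M.jac e t)⁻¹

/-- The linear part of the motion of an element from time `t` to time `s`. -/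
def trans (e : M.Elem) (t s : ℝ) : Sp d →L[ℝ] Sp d := (M.lin e s).comp (M.linInv e t)

/-- The reference coordinates of a point. -/
def ref (e : M.Elem) (t : ℝ) (x : Sp d) : Sp d := M.linInv e t (x - M.pos (e 0) t)

/-- The affine motion of an element from time `t` to time `s`, extended to the whole space. -/
def move (e : M.Elem) (t s : ℝ) (x : Sp d) : Sp d := M.map e s (M.ref e t x)

variable {M}

theorem lin_apply (e : M.Elem) (t : ℝ) (y : Sp d) :
    M.lin e t y = ∑ k, y k • (M.pos (e k.succ) t - M.pos (e 0) t) := by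
  ext r
  rw [lin, Matrix.ofLp_toEuclideanCLM]
  simp [jac, Matrix.mulVec, dotProduct, mul_comm]

theorem map_eq (e : M.Elem) (t : ℝ) (y : Sp d) :
    M.map e t y = M.pos (e 0) t + M.lin e t y := by
  rw [lin_apply]; rfl

theorem map_eq_sum (e : M.Elem) (t : ℝ) (y : Sp d) :
    M.map e t y = ∑ k, bary y k • M.pos (e k) t := by
  simp only [map, bary, Fin.sum_univ_succ, Fin.cons_zero, Fin.cons_succ, sub_smul, one_smul,
    smul_sub, Finset.sum_sub_distrib, Finset.sum_smul]
  abel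

theorem linInv_lin {e : M.Elem} {t : ℝ} (h : 0 < |(M.jac e t).det|) (y : Sp d) :
    M.linInv e t (M.lin e t y) = y := by
  have h1 : IsUnit (M.jac e t).det := (abs_pos.1 h).isUnit
  have : M.linInv e t * M.lin e t = 1 := by
    rw [linInv, lin, ← map_mul, Matrix.nonsing_inv_mul _ h1, map_one]
  exact congrArg (fun L => L y) this

theorem lin_linInv {e : M.Elem} {t : ℝ} (h : 0 < |(M.jac e t).det|) (y : Sp d) :
    M.lin e t (M.linInv e t y) = y := by
  have h1 : IsUnit (M.jac e t).det := (abs_pos.1 h).isUnit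
  have : M.lin e t * M.linInv e t = 1 := by
    rw [linInv, lin, ← map_mul, Matrix.mul_nonsing_inv _ h1, map_one]
  exact congrArg (fun L => L y) this

theorem ref_map {e : M.Elem} {t : ℝ} (h : 0 < |(M.jac e t).det|) (y : Sp d) :
    M.ref e t (M.map e t y) = y := by
  rw [ref, map_eq, add_sub_cancel_left, linInv_lin h]

theorem map_ref {e : M.Elem} {t : ℝ} (h : 0 < |(M.jac e t).det|) (x : Sp d) :
    M.map e t (M.ref e t x) = x := by
  rw [ref, map_eq, lin_linInv h]; abel

theorem move_move {e : M.Elem} {t s r : ℝ} (h : 0 < |(M.jac e s).det|) (x : Sp d) :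
    M.move e s r (M.move e t s x) = M.move e t r x := by
  rw [move, move, ref_map h]; rfl

theorem move_self {e : M.Elem} {t : ℝ} (h : 0 < |(M.jac e t).det|) (x : Sp d) :
    M.move e t t x = x := map_ref h x

theorem hasFDerivAt_move (e : M.Elem) (t s : ℝ) (x : Sp d) :
    HasFDerivAt (M.move e t s) (M.trans e t s) x := by
  have h1 : HasFDerivAt (fun x => x - M.pos (e 0) t) (ContinuousLinearMap.id ℝ (Sp d)) x :=
    (hasFDerivAt_id x).sub_const _
  have h2 := (M.linInv e t).hasFDerivAt.comp x h1
  have h3 := ((M.lin e s).hasFDerivAt.comp x h2).const_add (M.pos (e 0) s)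
  have h4 : M.move e t s = fun x => M.pos (e 0) s + M.lin e s (M.linInv e t (x - M.pos (e 0) t)) := by
    ext1 x
    rw [move, map_eq, ref]
  rw [h4]
  exact h3

theorem continuous_move (e : M.Elem) (t s : ℝ) : Continuous (M.move e t s) :=
  continuous_iff_continuousAt.2 fun x => (hasFDerivAt_move e t s x).continuousAt

theorem continuous_ref (e : M.Elem) (t : ℝ) : Continuous (M.ref e t) := by
  unfold ref; fun_prop

theorem continuous_pos (k : Fin M.numV) : Continuous (M.pos k) := by
  unfold pos; fun_prop

theorem continuous_map_uncurry (e : M.Elem) :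
    Continuous fun p : ℝ × Sp d => M.map e p.1 p.2 := by
  unfold map
  have := fun k => (continuous_pos (M := M) k).comp (continuous_fst : Continuous (Prod.fst : ℝ × Sp d → ℝ))
  simp only [Function.comp_def] at this
  have h0 := this (e 0)
  refine h0.add (continuous_finsetSum _ fun k _ => ?_)
  exact ((EuclideanSpace.proj k : Sp d →L[ℝ] ℝ).continuous.comp continuous_snd).smul ((this (e k.succ)).sub h0)

theorem continuous_move_uncurry (e : M.Elem) (t : ℝ) :
    Continuous fun p : ℝ × Sp d => M.move e t p.1 p.2 :=
  (continuous_map_uncurry e).comp (continuous_fst.prodMk ((continuous_ref e t).comp continuous_snd))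

theorem continuous_jac (e : M.Elem) : Continuous (M.jac e) := by
  refine continuous_matrix fun r k => ?_
  simp only [jac, Matrix.of_apply]
  have := fun k => (EuclideanSpace.proj r : Sp d →L[ℝ] ℝ).continuous.comp
    (continuous_pos (M := M) k)
  exact (this _).sub (this _)

theorem continuous_toEuclideanCLM :
    Continuous (Matrix.toEuclideanCLM (n := Fin d) (𝕜 := ℝ)) :=
  LinearMap.continuous_of_finiteDimensional
    (Matrix.toEuclideanCLM (n := Fin d) (𝕜 := ℝ)).toAlgEquiv.toLinearMap

theorem continuous_lin (e : M.Elem) : Continuous (M.lin e) :=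
  continuous_toEuclideanCLM.comp (continuous_jac e)

theorem continuousAt_linInv {e : M.Elem} {t : ℝ} (h : 0 < |(M.jac e t).det|) :
    ContinuousAt (M.linInv e) t := by
  refine continuous_toEuclideanCLM.continuousAt.comp ?_
  have h1 : (M.jac e t).det ≠ 0 := abs_pos.1 h
  have : (fun s => (M.jac e s)⁻¹) = fun s => ((M.jac e s).det)⁻¹ • (M.jac e s).adjugate := by
    ext1 s; rw [Matrix.inv_def, Ring.inverse_eq_inv']
  change ContinuousAt (fun s => (M.jac e s)⁻¹) t
  rw [this]
  exact ((continuous_jac e).matrix_det.continuousAt.inv₀ h1).smul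
    (continuous_jac e).matrix_adjugate.continuousAt

theorem continuous_trans (e : M.Elem) (t : ℝ) : Continuous (M.trans e t) :=
  (continuous_lin e).clm_comp continuous_const

theorem cell_eq_image (e : M.Elem) (t : ℝ) : M.cell e t = M.map e t '' refSimplex d := by
  have h1 : M.cell e t = {x | ∃ w : Fin (d + 1) → ℝ, (∀ k, 0 ≤ w k) ∧ ∑ k, w k = 1 ∧
      x = ∑ k, w k • M.pos (e k) t} := by
    let f : (Fin (d + 1) → ℝ) →ₗ[ℝ] Sp d := Fintype.linearCombination ℝ (fun k => M.pos (e k) t)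
    have h2 : (range fun k => M.pos (e k) t)
        = f '' (range fun k : Fin (d + 1) => Pi.single k (1 : ℝ)) := by
      rw [← range_comp]
      congr 1; ext1 k
      simp [f, Fintype.linearCombination_apply_single]
    rw [cell, h2, ← LinearMap.image_convexHull, convexHull_rangle_single_eq_stdSimplex]
    ext x
    constructor
    · rintro ⟨w, hw, rfl⟩
      exact ⟨w, hw.1, hw.2, by simp [f, Fintype.linearCombination_apply]⟩
    · rintro ⟨w, hw, hw', rfl⟩
      exact ⟨w, ⟨hw, hw'⟩, by simp [f, Fintype.linearCombination_apply]⟩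
  rw [h1]
  ext x
  constructor
  · rintro ⟨w, hw, hw', rfl⟩
    refine ⟨WithLp.toLp 2 (fun k => w k.succ), ⟨fun k => hw _, ?_⟩, ?_⟩
    · rw [Fin.sum_univ_succ] at hw'
      simp only
      linarith [hw 0]
    · rw [map_eq_sum]
      congr 1; ext1 k
      congr 1
      refine Fin.cases ?_ (fun k => ?_) k
      · rw [Fin.sum_univ_succ] at hw'
        simp only [bary, Fin.cons_zero]
        linarith
      · simp [bary]
  · rintro ⟨y, hy, rfl⟩
    exact ⟨bary y, bary_nonneg hy, sum_bary y, map_eq_sum e t y⟩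

theorem isCompact_cell (e : M.Elem) (t : ℝ) : IsCompact (M.cell e t) :=
  (Set.finite_range _).isCompact_convexHull ℝ

theorem convex_cell (e : M.Elem) (t : ℝ) : Convex ℝ (M.cell e t) := convex_convexHull _ _

theorem ref_mem {e : M.Elem} {t : ℝ} (h : 0 < |(M.jac e t).det|) {x : Sp d}
    (hx : x ∈ M.cell e t) : M.ref e t x ∈ refSimplex d := by
  rw [cell_eq_image] at hx
  obtain ⟨y, hy, rfl⟩ := hx
  rwa [ref_map h]

theorem map_mem_cell {e : M.Elem} (t : ℝ) {y : Sp d} (hy : y ∈ refSimplex d) :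
    M.map e t y ∈ M.cell e t := by
  rw [cell_eq_image]; exact ⟨y, hy, rfl⟩

theorem move_mem_cell {e : M.Elem} {t : ℝ} (h : 0 < |(M.jac e t).det|) (s : ℝ) {x : Sp d}
    (hx : x ∈ M.cell e t) : M.move e t s x ∈ M.cell e s :=
  map_mem_cell s (ref_mem h hx)

/-- The vertices of a non-degenerate element are affinely independent. -/
theorem eq_zero_of_sum_smul_pos {e : M.Elem} {t : ℝ} (h : 0 < |(M.jac e t).det|)
    {c : Fin (d + 1) → ℝ} (h0 : ∑ k, c k = 0) (h1 : ∑ k, c k • M.pos (e k) t = 0) : c = 0 := by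
  have h2 : M.lin e t (WithLp.toLp 2 fun k => c k.succ) = 0 := by
    rw [lin_apply]
    rw [Fin.sum_univ_succ] at h0 h1
    have h3 : c 0 = - ∑ k : Fin d, c k.succ := by linarith
    rw [h3, neg_smul, Finset.sum_smul] at h1
    simp only [smul_sub, Finset.sum_sub_distrib]
    rw [← h1]; abel
  have h3 := linInv_lin h (WithLp.toLp 2 fun k => c k.succ)
  rw [h2, map_zero] at h3
  have h4 : ∀ k : Fin d, c k.succ = 0 := fun k => by
    have := congrArg (fun v : Sp d => v k) h3
    simpa using this.symm
  ext k
  refine Fin.cases ?_ (fun k => h4 k) k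
  rw [Fin.sum_univ_succ] at h0
  simpa [h4] using h0

theorem injective_elem {e : M.Elem} {t : ℝ} (h : 0 < |(M.jac e t).det|) :
    Function.Injective e := by
  intro k l hkl
  by_contra hne
  have := eq_zero_of_sum_smul_pos h (c := Pi.single k 1 - Pi.single l 1)
    (by simp) (by
      simp only [Pi.sub_apply, sub_smul, Finset.sum_sub_distrib, Pi.single_apply, ite_smul,
        one_smul, zero_smul, Finset.sum_ite_eq', Finset.mem_univ, if_true, hkl, sub_self])
  have h2 := congrFun this k
  simp [hne] at h2

theorem exists_weights {N : ℕ} {x : Sp d} (p : Fin N → Sp d) (S : Set (Fin N))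
    (hx : x ∈ convexHull ℝ (p '' S)) :
    ∃ w : Fin N → ℝ, (∑ v, w v = 1) ∧ (∀ v ∉ S, w v = 0) ∧ x = ∑ v, w v • p v := by
  have : convexHull ℝ (p '' S) ⊆ {x | ∃ w : Fin N → ℝ, (∑ v, w v = 1) ∧ (∀ v ∉ S, w v = 0) ∧
      x = ∑ v, w v • p v} := by
    apply convexHull_min
    · rintro _ ⟨v, hv, rfl⟩
      refine ⟨Pi.single v 1, by simp, fun v' hv' => ?_, ?_⟩
      · have : v' ≠ v := fun h => hv' (h ▸ hv)
        simp [this]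
      · simp [Pi.single_apply, ite_smul]
    · rintro _ ⟨w, h1, h2, rfl⟩ _ ⟨w', h1', h2', rfl⟩ a b - - hab
      refine ⟨fun v => a * w v + b * w' v, ?_, fun v hv => by simp [h2 v hv, h2' v hv], ?_⟩
      · rw [Finset.sum_add_distrib, ← Finset.mul_sum, ← Finset.mul_sum, h1, h1']; linarith
      · simp only [add_smul, Finset.sum_add_distrib, Finset.smul_sum, mul_smul]
  exact this hx

/-- Barycentric coordinates with respect to affinely independent vertices are unique, so weights
valid at time `t` are those of the reference point `y`. The reference point does not move, so they
stay valid at every time `s`. -/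
theorem map_eq_sum_weights {e : M.Elem} {t : ℝ} (h : 0 < |(M.jac e t).det|) {y : Sp d}
    {w : Fin M.numV → ℝ} (h1 : ∑ v, w v = 1) (h2 : ∀ v ∉ range e, w v = 0)
    (h3 : M.map e t y = ∑ v, w v • M.pos v t) (s : ℝ) :
    M.map e s y = ∑ v, w v • M.pos v s := by
  have hinj := injective_elem h
  have hs : ∀ {E : Type} [AddCommMonoid E] (f : Fin M.numV → E), (∀ v ∉ range e, f v = 0) →
      ∑ v, f v = ∑ k, f (e k) := by
    intro E _ f hf
    rw [← Finset.sum_image (s := Finset.univ) (g := e) (f := f) (fun a _ b _ hab => hinj hab)]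
    refine (Finset.sum_subset (Finset.subset_univ _) fun v _ hv => hf v ?_).symm
    rintro ⟨k, rfl⟩
    exact hv (Finset.mem_image_of_mem e (Finset.mem_univ k))
  have hsum : ∀ r, ∑ v, w v • M.pos v r = ∑ k, w (e k) • M.pos (e k) r := fun r =>
    hs (fun v => w v • M.pos v r) fun v hv => by simp [h2 v hv]
  rw [hs w h2] at h1
  rw [hsum, map_eq_sum] at h3
  have := eq_zero_of_sum_smul_pos h (c := fun k => bary y k - w (e k))
    (by rw [Finset.sum_sub_distrib, sum_bary, h1, sub_self])
    (by simp only [sub_smul, Finset.sum_sub_distrib, h3, sub_self])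
  rw [hsum, map_eq_sum]
  refine Finset.sum_congr rfl fun k _ => ?_
  have := congrFun this k
  simp only [Pi.zero_apply] at this
  rw [sub_eq_zero.1 this]

end MovingMesh

theorem _root_.LipschitzOnWith.congr_on {α β : Type*} [PseudoEMetricSpace α]
    [PseudoEMetricSpace β] {C : ℝ≥0} {f g : α → β} {s : Set α} (hf : LipschitzOnWith C f s)
    (h : EqOn g f s) : LipschitzOnWith C g s := fun x hx y hy => by
  rw [h hx, h hy]; exact hf hx hy

namespace MovingMesh

variable {M : MovingMesh d}

/-! ### The flow of a conforming mesh -/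

theorem IsTriangulation.det_pos {t : ℝ} (h : M.IsTriangulation Ω t) {e : M.Elem}
    (he : e ∈ M.elems) : 0 < |(M.jac e t).det| := h.1 e he

/-- This makes the flow independent of the element chosen to represent a point. By conformity a
common point of two elements is a combination of their common vertices; in both elements its image
at time `s` is the same combination of the moved vertices. -/
theorem IsTriangulation.map_congr {t : ℝ} (h : M.IsTriangulation Ω t) {e e' : M.Elem}
    (he : e ∈ M.elems) (he' : e' ∈ M.elems) {y y' : Sp d} (hy : y ∈ refSimplex d)
    (hy' : y' ∈ refSimplex d) (hyy' : M.map e t y = M.map e' t y') (s : ℝ) :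
    M.map e s y = M.map e' s y' := by
  have hx : M.map e t y ∈ M.cell e t ∩ M.cell e' t :=
    ⟨map_mem_cell t hy, by rw [hyy']; exact map_mem_cell t hy'⟩
  rw [h.2.1 e he e' he'] at hx
  obtain ⟨w, h1, h2, h3⟩ := exists_weights _ _ hx
  rw [map_eq_sum_weights (h.det_pos he) h1 (fun v hv => h2 v fun hv' => hv hv'.1) h3 s,
    map_eq_sum_weights (h.det_pos he') h1 (fun v hv => h2 v fun hv' => hv hv'.2)
      (hyy'.symm.trans h3) s]

theorem IsTriangulation.flow_map {t : ℝ} (h : M.IsTriangulation Ω t) {e : M.Elem}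
    (he : e ∈ M.elems) {y : Sp d} (hy : y ∈ refSimplex d) (s : ℝ) :
    M.flow t s (M.map e t y) = M.map e s y := by
  have hex : ∃ p, M.IsLabel t (M.map e t y) p := ⟨(e, y), he, hy, rfl⟩
  rw [flow, dif_pos hex]
  obtain ⟨h1, h2, h3⟩ := hex.choose_spec
  exact h.map_congr h1 he h2 hy h3 s

variable (M) in
/-- The union of the closed elements. -/
def body (t : ℝ) : Set (Sp d) := ⋃ e ∈ M.elems, M.cell e t

variable (M) in
/-- The union of the open elements. -/
def core (t : ℝ) : Set (Sp d) := ⋃ e ∈ M.elems, interior (M.cell e t)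

theorem mem_body {t : ℝ} {x : Sp d} : x ∈ M.body t ↔ ∃ e ∈ M.elems, x ∈ M.cell e t := by
  simp [body]

theorem mem_core {t : ℝ} {x : Sp d} :
    x ∈ M.core t ↔ ∃ e ∈ M.elems, x ∈ interior (M.cell e t) := by
  simp [core]

theorem IsTriangulation.flow_eq_move {t : ℝ} (h : M.IsTriangulation Ω t) {e : M.Elem}
    (he : e ∈ M.elems) {x : Sp d} (hx : x ∈ M.cell e t) (s : ℝ) :
    M.flow t s x = M.move e t s x := by
  have := h.flow_map he (ref_mem (h.det_pos he) hx) s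
  rw [map_ref (h.det_pos he)] at this
  exact this

theorem isCompact_body (t : ℝ) : IsCompact (M.body t) :=
  M.elems.finite_toSet.isCompact_biUnion fun e _ => isCompact_cell e t

theorem isClosed_body (t : ℝ) : IsClosed (M.body t) := (isCompact_body t).isClosed

theorem IsTriangulation.subset_body {t : ℝ} (h : M.IsTriangulation Ω t) : Ω ⊆ M.body t := by
  have := h.2.2
  rw [← this]
  exact interior_subset

theorem IsTriangulation.closure_subset_body {t : ℝ} (h : M.IsTriangulation Ω t) :
    closure Ω ⊆ M.body t := closure_minimal h.subset_body (isClosed_body t)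

theorem isOpen_core (t : ℝ) : IsOpen (M.core t) :=
  isOpen_biUnion fun _ _ => isOpen_interior

theorem IsTriangulation.core_subset {t : ℝ} (h : M.IsTriangulation Ω t) : M.core t ⊆ Ω := by
  have h1 := h.2.2
  rw [← h1]
  refine interior_maximal ?_ (isOpen_core t)
  exact iUnion₂_mono fun e _ => interior_subset

/-- What is missing lies on boundaries of convex cells, which are null sets. -/
theorem IsTriangulation.volume_diff_core {t : ℝ} (h : M.IsTriangulation Ω t) :
    volume (Ω \ M.core t) = 0 := by
  have : Ω \ M.core t ⊆ ⋃ e ∈ M.elems, frontier (M.cell e t) := by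
    rintro x ⟨hx, hx'⟩
    obtain ⟨e, he, hxe⟩ := mem_body.1 (h.subset_body hx)
    refine mem_iUnion₂.2 ⟨e, he, subset_closure hxe, fun hi => hx' (mem_core.2 ⟨e, he, hi⟩)⟩
  refine measure_mono_null this ?_
  exact (measure_biUnion_null_iff M.elems.countable_toSet).2
    fun e _ => (convex_cell e t).addHaar_frontier volume

theorem IsTriangulation.flow_mem_body {t : ℝ} (h : M.IsTriangulation Ω t) (s : ℝ) {x : Sp d}
    (hx : x ∈ M.body t) : M.flow t s x ∈ M.body s := by
  obtain ⟨e, he, hxe⟩ := mem_body.1 hx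
  rw [h.flow_eq_move he hxe]
  exact mem_body.2 ⟨e, he, move_mem_cell (h.det_pos he) s hxe⟩

theorem IsTriangulation.flow_flow {t s : ℝ} (h : M.IsTriangulation Ω t)
    (h' : M.IsTriangulation Ω s) (r : ℝ) {x : Sp d} (hx : x ∈ M.body t) :
    M.flow s r (M.flow t s x) = M.flow t r x := by
  obtain ⟨e, he, hxe⟩ := mem_body.1 hx
  rw [h.flow_eq_move he hxe, h.flow_eq_move he hxe,
    h'.flow_eq_move he (move_mem_cell (h.det_pos he) s hxe), move_move (h'.det_pos he)]

theorem IsTriangulation.flow_self {t : ℝ} (h : M.IsTriangulation Ω t) {x : Sp d}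
    (hx : x ∈ M.body t) : M.flow t t x = x := by
  obtain ⟨e, he, hxe⟩ := mem_body.1 hx
  rw [h.flow_eq_move he hxe, move_self (h.det_pos he)]

/-- The preimage of the old open cell under the reverse motion is open and contained in the new
cell. -/
theorem move_mem_interior {e : M.Elem} {t s : ℝ} (h : 0 < |(M.jac e t).det|)
    (h' : 0 < |(M.jac e s).det|) {x : Sp d} (hx : x ∈ interior (M.cell e t)) :
    M.move e t s x ∈ interior (M.cell e s) := by
  have hopen : IsOpen (M.move e s t ⁻¹' interior (M.cell e t)) :=
    isOpen_interior.preimage (continuous_move e s t)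
  refine interior_maximal (t := M.move e s t ⁻¹' interior (M.cell e t)) ?_ hopen ?_
  · intro z hz
    have := move_mem_cell h s (interior_subset hz)
    rwa [move_move h, move_self h'] at this
  · rw [mem_preimage, move_move h', move_self h]
    exact hx

theorem IsTriangulation.mapsTo_core {t s : ℝ} (h : M.IsTriangulation Ω t)
    (h' : M.IsTriangulation Ω s) : MapsTo (M.flow t s) (M.core t) (M.core s) := by
  intro x hx
  obtain ⟨e, he, hxe⟩ := mem_core.1 hx
  rw [h.flow_eq_move he (interior_subset hxe)]
  exact mem_core.2 ⟨e, he, move_mem_interior (h.det_pos he) (h'.det_pos he) hxe⟩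

theorem IsTriangulation.hasFDerivAt_flow {t : ℝ} (h : M.IsTriangulation Ω t) (s : ℝ) {e : M.Elem}
    (he : e ∈ M.elems) {x : Sp d} (hx : x ∈ interior (M.cell e t)) :
    HasFDerivAt (M.flow t s) (M.trans e t s) x := by
  refine (hasFDerivAt_move e t s x).congr_of_eventuallyEq ?_
  filter_upwards [isOpen_interior.mem_nhds hx] with z hz
  exact h.flow_eq_move he (interior_subset hz) s

/-- A function that is Lipschitz on the elements is Lipschitz on the balls in `Ω`. -/
theorem IsTriangulation.lipschitzOnWith_ball {F : Type*} [NormedAddCommGroup F] {t : ℝ}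
    (h : M.IsTriangulation Ω t) {C : ℝ≥0} {f : Sp d → F}
    (hf : ∀ e ∈ M.elems, LipschitzOnWith C f (M.cell e t)) {x : Sp d} {r : ℝ}
    (hr : ball x r ⊆ Ω) : LipschitzOnWith C f (ball x r) := by
  apply LipschitzOnWith.of_dist_le_mul
  intro y hy z hz
  rw [dist_eq_norm, dist_eq_norm]
  refine norm_sub_le_of_segment_subset_iUnion M.elems (K := fun e => M.cell e t)
    (fun e _ => (isCompact_cell e t).isClosed) hf ?_
  exact ((convex_ball x r).segment_subset hz hy).trans (hr.trans h.subset_body)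

theorem IsTriangulation.locLip {F : Type*} [NormedAddCommGroup F] {t : ℝ}
    (h : M.IsTriangulation Ω t) (hΩ : IsOpen Ω) {C : ℝ≥0} {f : Sp d → F}
    (hf : ∀ e ∈ M.elems, LipschitzOnWith C f (M.cell e t)) : LocLip Ω C f := by
  intro x hx
  obtain ⟨r, hr, hrΩ⟩ := Metric.isOpen_iff.1 hΩ x hx
  exact ⟨ball x r, ball_mem_nhds x hr, h.lipschitzOnWith_ball hf hrΩ⟩

theorem lipschitzWith_move {e : M.Elem} {t s : ℝ} {Λ : ℝ≥0} (hΛ : ‖M.trans e t s‖ ≤ Λ) :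
    LipschitzWith Λ (M.move e t s) := by
  apply lipschitzWith_of_nnnorm_fderiv_le (𝕜 := ℝ)
    (fun x => (hasFDerivAt_move e t s x).differentiableAt)
  intro x
  rw [(hasFDerivAt_move e t s x).fderiv]
  exact_mod_cast hΛ

theorem IsTriangulation.locLip_flow {t : ℝ} (h : M.IsTriangulation Ω t) (hΩ : IsOpen Ω) (s : ℝ)
    {Λ : ℝ≥0} (hΛ : ∀ e ∈ M.elems, ‖M.trans e t s‖ ≤ Λ) : LocLip Ω Λ (M.flow t s) := by
  refine h.locLip hΩ fun e he => ?_
  exact ((lipschitzWith_move (hΛ e he)).lipschitzOnWith (s := M.cell e t)).congr_on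
    fun x hx => (h.flow_eq_move he hx s)

/-! ### The flow as a bi-Lipschitz bijection of the domain. -/

/-- If the elements move little, the flow maps `Ω` to itself. -/
theorem IsTriangulation.mapsTo_flow_of_close {t s : ℝ} (h : M.IsTriangulation Ω t)
    (h' : M.IsTriangulation Ω s) (hΩ : IsOpen Ω)
    (hc : ∀ e ∈ M.elems, ‖M.trans e t s - ContinuousLinearMap.id ℝ (Sp d)‖ ≤ 1 / 2) :
    MapsTo (M.flow t s) Ω Ω := by
  intro x hx
  obtain ⟨r, hr, hrΩ⟩ := Metric.isOpen_iff.1 hΩ x hx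
  have hlip : LipschitzOnWith (1 / 2) (fun y => M.flow t s y - y) (ball x r) := by
    refine h.lipschitzOnWith_ball (fun e he => ?_) hrΩ
    have h1 : LipschitzWith (1 / 2) (fun y => M.move e t s y - y) := by
      have hd : ∀ y, HasFDerivAt (fun y => M.move e t s y - y)
          (M.trans e t s - ContinuousLinearMap.id ℝ (Sp d)) y := fun y =>
        (hasFDerivAt_move e t s y).sub (hasFDerivAt_id y)
      apply lipschitzWith_of_nnnorm_fderiv_le (𝕜 := ℝ) (fun y => (hd y).differentiableAt)
      intro y
      rw [(hd y).fderiv]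
      have := hc e he
      rw [← NNReal.coe_le_coe]
      simpa using this
    exact (h1.lipschitzOnWith (s := M.cell e t)).congr_on fun y hy => by
      simp only [h.flow_eq_move he hy s]
  have happ : ApproximatesLinearOn (M.flow t s) (ContinuousLinearMap.id ℝ (Sp d))
      (ball x r) (1 / 2) := by
    exact LipschitzOnWith.approximatesLinearOn hlip
  let inv : (ContinuousLinearMap.id ℝ (Sp d)).NonlinearRightInverse :=
    { toFun := id, nnnorm := 1, bound' := by simp, right_inv' := by simp }
  -- Since `flow - id` has Lipschitz constant `1/2` on the ball, the image of the closed ball of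
  -- radius `r / 2` contains one of radius `(1 - 1/2) * (r / 2) = r / 4`. The image point is
  -- therefore interior to the union of the cells at time `s`, that is, in `Ω`.
  have hsurj := happ.surjOn_closedBall_of_nonlinearRightInverse inv (ε := r / 2) (b := x)
    (by positivity) (closedBall_subset_ball (by linarith))
  have himg : closedBall (M.flow t s x) (r / 4) ⊆ M.body s := by
    intro z hz
    have hz' : z ∈ closedBall (M.flow t s x) ((((inv.nnnorm : ℝ))⁻¹ - ((1 / 2 : ℝ≥0) : ℝ)) * (r / 2)) := by
      convert hz using 2
      simp [inv]; ring
    obtain ⟨y, hy, rfl⟩ := hsurj hz'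
    exact h.flow_mem_body s (h.subset_body (hrΩ (closedBall_subset_ball (by linarith) hy)))
  rw [← h'.2.2]
  exact mem_interior.2 ⟨ball (M.flow t s x) (r / 4), ball_subset_closedBall.trans himg, isOpen_ball,
    mem_ball_self (by positivity)⟩

/-- A priori a point of `Ω` on an interior face might be carried to the boundary. For nearby times
this is excluded by `mapsTo_flow_of_close`; the relation that the flows in both directions preserve
`Ω` is symmetric and transitive, so on a connected set of times it spreads from nearby pairs to all
pairs. -/
theorem mapsTo_flow (hΩ : IsOpen Ω) {I : Set ℝ} (hI : IsPreconnected I)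
    (h : ∀ t ∈ I, M.IsTriangulation Ω t) {t s : ℝ} (ht : t ∈ I) (hs : s ∈ I) :
    MapsTo (M.flow t s) Ω Ω := by
  have key := hI.induction₂ (fun t s => MapsTo (M.flow t s) Ω Ω ∧ MapsTo (M.flow s t) Ω Ω)
    ?_ ?_ ?_ ht hs
  · exact key.1
  · intro t ht
    have hid : ∀ e ∈ M.elems, M.trans e t t = ContinuousLinearMap.id ℝ (Sp d) := fun e he => by
      ext1 x; exact lin_linInv ((h t ht).det_pos he) x
    have h1 : ∀ᶠ s in 𝓝[I] t, ∀ e ∈ M.elems,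
        ‖M.trans e t s - ContinuousLinearMap.id ℝ (Sp d)‖ < 1 / 2 := by
      refine (Filter.eventually_all_finset _).2 fun e he => ?_
      have : ContinuousAt (fun s => ‖M.trans e t s - ContinuousLinearMap.id ℝ (Sp d)‖) t :=
        ((continuous_trans e t).sub continuous_const).norm.continuousAt
      refine nhdsWithin_le_nhds (this.eventually_lt_const ?_)
      simp [hid e he]
    have h2 : ∀ᶠ s in 𝓝[I] t, ∀ e ∈ M.elems,
        ‖M.trans e s t - ContinuousLinearMap.id ℝ (Sp d)‖ < 1 / 2 := by
      refine (Filter.eventually_all_finset _).2 fun e he => ?_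
      have : ContinuousAt (fun s => ‖M.trans e s t - ContinuousLinearMap.id ℝ (Sp d)‖) t :=
        ((continuousAt_const.clm_comp (continuousAt_linInv ((h t ht).det_pos he))).sub
          continuousAt_const).norm
      refine nhdsWithin_le_nhds (this.eventually_lt_const ?_)
      simp [hid e he]
    filter_upwards [h1, h2, self_mem_nhdsWithin] with s hs1 hs2 hsI
    exact ⟨(h t ht).mapsTo_flow_of_close (h s hsI) hΩ fun e he => (hs1 e he).le,
      (h s hsI).mapsTo_flow_of_close (h t ht) hΩ fun e he => (hs2 e he).le⟩
  · rintro x y z hx hy hz ⟨h1, h2⟩ ⟨h3, h4⟩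
    refine ⟨fun p hp => ?_, fun p hp => ?_⟩
    · rw [← (h x hx).flow_flow (h y hy) z ((h x hx).subset_body hp)]
      exact h3 (h1 hp)
    · rw [← (h z hz).flow_flow (h y hy) x ((h z hz).subset_body hp)]
      exact h2 (h4 hp)
  · rintro x y - - ⟨h1, h2⟩
    exact ⟨h2, h1⟩

theorem isMeshIso_flow (hΩ : IsOpen Ω) {I : Set ℝ} (hI : IsPreconnected I)
    (h : ∀ t ∈ I, M.IsTriangulation Ω t) {Λ : ℝ≥0}
    (hΛ : ∀ e ∈ M.elems, ∀ t ∈ I, ∀ s ∈ I, ‖M.trans e t s‖ ≤ Λ)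
    {t s : ℝ} (ht : t ∈ I) (hs : s ∈ I) :
    IsMeshIso Ω Λ (M.flow t s) (M.flow s t) (M.core t) (M.core s) := by
  have half : ∀ t ∈ I, ∀ s ∈ I,
      IsMeshMap Ω Λ (M.flow t s) (M.flow s t) (M.core t) (M.core s) := fun t ht s hs =>
    { isOpen := isOpen_core t
      subset := (h t ht).core_subset
      null := (h t ht).volume_diff_core
      mapsTo := mapsTo_flow hΩ hI h ht hs
      mapsToU := (h t ht).mapsTo_core (h s hs)
      left_inv := fun x hx => by
        rw [(h t ht).flow_flow (h s hs) t ((h t ht).subset_body hx),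
          (h t ht).flow_self ((h t ht).subset_body hx)]
      diff := fun x hx => by
        obtain ⟨e, he, hxe⟩ := mem_core.1 hx
        exact ((h t ht).hasFDerivAt_flow s he hxe).differentiableAt
      locLip := (h t ht).locLip_flow hΩ s fun e he => hΛ e he t ht s hs }
  exact ⟨half t ht s hs, half s hs t ht⟩

/-- Both Jacobians are compared with the one at `t₀`. The orthogonal factors preserve norms, so
elements may rotate freely, and only the perturbations of size `δμ` distort lengths; the ratio is at
most `(1 + δμ)/(1 - δμ)`. -/
theorem norm_trans_le {t₀ δ μ t s : ℝ} (hδ : 0 ≤ δ) (hδμ : δ * μ ≤ 1 / 2) {e : M.Elem}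
    (he : e ∈ M.elems) (hdet : 0 < |(M.jac e t).det|)
    (ht : M.ShapeRegularAt t₀ δ μ t) (hs : M.ShapeRegularAt t₀ δ μ s) :
    ‖M.trans e t s‖ ≤ 1 + 4 * (δ * μ) := by
  obtain ⟨R, hR, H, hJ, hH⟩ := ht e he
  obtain ⟨R', hR', H', hJ', hH'⟩ := hs e he
  have hμ : 0 ≤ δ * μ := mul_nonneg hδ ((norm_nonneg _).trans hH)
  have iso : ∀ R ∈ Matrix.orthogonalGroup (Fin d) ℝ, ∀ v : Sp d,
      ‖Matrix.toEuclideanCLM (n := Fin d) (𝕜 := ℝ) R v‖ = ‖v‖ := by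
    intro R hR v
    set L := Matrix.toEuclideanCLM (n := Fin d) (𝕜 := ℝ) R
    have h1 : star L * L = 1 := by
      rw [← map_star, ← map_mul, (Matrix.mem_unitaryGroup_iff').1 hR, map_one]
    have h2 : inner ℝ (L v) (L v) = inner ℝ v v := by
      rw [← ContinuousLinearMap.adjoint_inner_right, ← ContinuousLinearMap.star_eq_adjoint]
      congr 1
      exact congrArg (fun A => A v) h1
    rw [real_inner_self_eq_norm_sq, real_inner_self_eq_norm_sq] at h2
    exact (sq_eq_sq₀ (norm_nonneg _) (norm_nonneg _)).1 h2
  have hpert : ∀ H : Matrix (Fin d) (Fin d) ℝ,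
      ‖Matrix.toEuclideanCLM (n := Fin d) (𝕜 := ℝ) H‖ ≤ μ → ∀ v : Sp d,
      ‖δ • Matrix.toEuclideanCLM (n := Fin d) (𝕜 := ℝ) H v‖ ≤ δ * μ * ‖v‖ := by
    intro H hH v
    rw [norm_smul, Real.norm_of_nonneg hδ, mul_assoc]
    gcongr
    exact (ContinuousLinearMap.le_opNorm _ _).trans (by gcongr)
  have hlin : ∀ {R H : Matrix (Fin d) (Fin d) ℝ} {t : ℝ}, M.jac e t = (R + δ • H) * M.jac e t₀ →
      ∀ v, M.lin e t v = Matrix.toEuclideanCLM (n := Fin d) (𝕜 := ℝ) R (M.lin e t₀ v)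
        + δ • Matrix.toEuclideanCLM (n := Fin d) (𝕜 := ℝ) H (M.lin e t₀ v) := by
    intro R H t hJ v
    rw [lin, hJ, map_mul, map_add, map_smul]
    rfl
  refine ContinuousLinearMap.opNorm_le_bound _ (by linarith) fun v => ?_
  set w := M.lin e t₀ (M.linInv e t v) with hw
  have h1 : v = Matrix.toEuclideanCLM (n := Fin d) (𝕜 := ℝ) R w
      + δ • Matrix.toEuclideanCLM (n := Fin d) (𝕜 := ℝ) H w := by
    rw [← hlin hJ, lin_linInv hdet]
  have h2 : M.trans e t s v = Matrix.toEuclideanCLM (n := Fin d) (𝕜 := ℝ) R' w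
      + δ • Matrix.toEuclideanCLM (n := Fin d) (𝕜 := ℝ) H' w := by
    rw [← hlin hJ']; rfl
  have h3 : ‖w‖ - δ * μ * ‖w‖ ≤ ‖v‖ := by
    have := norm_sub_le v (δ • Matrix.toEuclideanCLM (n := Fin d) (𝕜 := ℝ) H w)
    rw [show v - δ • Matrix.toEuclideanCLM (n := Fin d) (𝕜 := ℝ) H w
      = Matrix.toEuclideanCLM (n := Fin d) (𝕜 := ℝ) R w by
        conv_lhs => rw [h1]
        abel, iso R hR] at this
    linarith [hpert H hH w]
  have h4 : ‖M.trans e t s v‖ ≤ ‖w‖ + δ * μ * ‖w‖ := by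
    rw [h2]
    refine (norm_add_le _ _).trans ?_
    rw [iso R' hR']
    linarith [hpert H' hH' w]
  have h5 := norm_nonneg w
  -- With `x = δμ`, one has `(1 + 4x)(1 - x) = 1 + 3x - 4x²`, which is at least `1 + x` exactly
  -- because `0 ≤ x ≤ 1/2`.
  have h6 : (1 + δ * μ) * ‖w‖ ≤ (1 + 4 * (δ * μ)) * ((1 - δ * μ) * ‖w‖) := by
    rw [← mul_assoc]
    refine mul_le_mul_of_nonneg_right ?_ h5
    nlinarith
  have h7 : (1 + 4 * (δ * μ)) * ((1 - δ * μ) * ‖w‖) ≤ (1 + 4 * (δ * μ)) * ‖v‖ := by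
    refine mul_le_mul_of_nonneg_left ?_ (by linarith)
    linarith
  linarith

/-! ### Continuity of the flow and of the mesh velocity -/

theorem IsTriangulation.continuousOn_flow {t : ℝ} (h : M.IsTriangulation Ω t) :
    ContinuousOn (fun p : ℝ × Sp d => M.flow t p.1 p.2) (univ ×ˢ M.core t) := by
  rintro ⟨s, x⟩ ⟨-, hx⟩
  obtain ⟨e, he, hxe⟩ := mem_core.1 hx
  refine ContinuousAt.continuousWithinAt ?_
  refine (continuous_move_uncurry e t).continuousAt.congr ?_
  have : univ ×ˢ interior (M.cell e t) ∈ 𝓝 (s, x) :=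
    prod_mem_nhds univ_mem (isOpen_interior.mem_nhds hxe)
  filter_upwards [this] with p hp
  exact (h.flow_eq_move he (interior_subset hp.2) p.1).symm

theorem IsTriangulation.continuousOn_fderiv_flow {t : ℝ} (h : M.IsTriangulation Ω t) :
    ContinuousOn (fun p : ℝ × Sp d => fderiv ℝ (M.flow t p.1) p.2) (univ ×ˢ M.core t) := by
  rintro ⟨s, x⟩ ⟨-, hx⟩
  obtain ⟨e, he, hxe⟩ := mem_core.1 hx
  refine ContinuousAt.continuousWithinAt ?_
  refine ((continuous_trans e t).comp continuous_fst).continuousAt.congr ?_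
  have : univ ×ˢ interior (M.cell e t) ∈ 𝓝 (s, x) :=
    prod_mem_nhds univ_mem (isOpen_interior.mem_nhds hxe)
  filter_upwards [this] with p hp
  exact ((h.hasFDerivAt_flow p.1 he hp.2).fderiv).symm

/-- The points of the mesh move along quadratic curves. -/
theorem IsTriangulation.exists_quadratic_flow {t : ℝ} (h : M.IsTriangulation Ω t) {x : Sp d}
    (hx : x ∈ M.body t) :
    ∃ q₀ q₁ q₂ : Sp d, ∀ s, M.flow t s x = q₀ + s • q₁ + s ^ 2 • q₂ := by
  obtain ⟨e, he, hxe⟩ := mem_body.1 hx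
  set y := M.ref e t x
  refine ⟨∑ k, bary y k • M.coeff (e k) 0, ∑ k, bary y k • M.coeff (e k) 1,
    ∑ k, bary y k • M.coeff (e k) 2, fun s => ?_⟩
  rw [h.flow_eq_move he hxe, move, map_eq_sum, Finset.smul_sum, Finset.smul_sum,
    ← Finset.sum_add_distrib, ← Finset.sum_add_distrib]
  refine Finset.sum_congr rfl fun k _ => ?_
  simp only [pos, Fin.sum_univ_three]
  simp only [Fin.val_zero, Fin.val_one, Fin.val_two, pow_zero, pow_one]
  module

theorem hasDerivAt_quadratic (q₀ q₁ q₂ : Sp d) (t : ℝ) :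
    HasDerivAt (fun s : ℝ => q₀ + s • q₁ + s ^ 2 • q₂) (q₁ + (2 * t) • q₂) t := by
  have h1 : HasDerivAt (fun s : ℝ => s • q₁) ((1 : ℝ) • q₁) t := (hasDerivAt_id t).smul_const q₁
  have h2 : HasDerivAt (fun s : ℝ => s ^ 2 • q₂) ((2 * t) • q₂) t := by
    have := (hasDerivAt_pow 2 t).smul_const q₂
    simpa using this
  have := (h1.const_add q₀).add h2
  rw [one_smul] at this
  exact this

/-- The displacement along a quadratic curve is given by the trapezoid rule. -/
theorem IsTriangulation.flow_sub_eq {t r : ℝ} (h : M.IsTriangulation Ω t)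
    (h' : M.IsTriangulation Ω r) {x : Sp d} (hx : x ∈ M.body t) :
    M.flow t r x - x = ((r - t) / 2) • (M.vel t x + M.vel r (M.flow t r x)) := by
  obtain ⟨q₀, q₁, q₂, hq⟩ := h.exists_quadratic_flow hx
  have h1 : M.vel t x = q₁ + (2 * t) • q₂ := by
    rw [vel, show (fun s => M.flow t s x) = _ from funext hq]
    exact (hasDerivAt_quadratic q₀ q₁ q₂ t).deriv
  have h2 : M.vel r (M.flow t r x) = q₁ + (2 * r) • q₂ := by
    rw [vel, show (fun s => M.flow r s (M.flow t r x)) = fun s => q₀ + s • q₁ + s ^ 2 • q₂ from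
      funext fun s => by rw [h.flow_flow h' s hx, hq s]]
    exact (hasDerivAt_quadratic q₀ q₁ q₂ r).deriv
  have h3 : x = q₀ + t • q₁ + t ^ 2 • q₂ := by rw [← hq t, h.flow_self hx]
  conv_lhs => rw [hq r, h3]
  rw [h1, h2]
  module

/-- Inside an element the velocity is the barycentric combination of the vertex velocities. The
point of the statement is the measurability of the convection coefficient. -/
theorem IsTriangulation.continuousOn_vel {t : ℝ} (h : M.IsTriangulation Ω t) :
    ContinuousOn (M.vel t) (M.core t) := by
  intro x hx
  obtain ⟨e, he, hxe⟩ := mem_core.1 hx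
  refine ContinuousAt.continuousWithinAt ?_
  have hb : ∀ k, Continuous fun x => bary (M.ref e t x) k := by
    intro k
    have hc : ∀ j : Fin d, Continuous fun x => M.ref e t x j := fun j =>
      (EuclideanSpace.proj j : Sp d →L[ℝ] ℝ).continuous.comp (continuous_ref e t)
    refine Fin.cases ?_ (fun k => ?_) k
    · simp only [bary, Fin.cons_zero]
      exact continuous_const.sub (continuous_finsetSum _ fun j _ => hc j)
    · simp only [bary, Fin.cons_succ]
      exact hc k
  have hc : Continuous fun x => ∑ k, bary (M.ref e t x) k • deriv (M.pos (e k)) t :=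
    continuous_finsetSum _ fun k _ => (hb k).smul continuous_const
  refine hc.continuousAt.congr ?_
  filter_upwards [isOpen_interior.mem_nhds hxe] with z hz
  rw [vel, show (fun s => M.flow t s z) = fun s => ∑ k, bary (M.ref e t z) k • M.pos (e k) s from
    funext fun s => by rw [h.flow_eq_move he (interior_subset hz), move, map_eq_sum]]
  have hd : ∀ k, DifferentiableAt ℝ (M.pos k) t := fun k => by unfold pos; fun_prop
  have := HasDerivAt.fun_sum (u := Finset.univ) (x := t)
    fun k (_ : k ∈ Finset.univ) => ((hd (e k)).hasDerivAt.const_smul (bary (M.ref e t z) k))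
  exact this.deriv.symm

theorem IsTriangulation.restrict_eq {t : ℝ} (h : M.IsTriangulation Ω t) :
    (volume : Measure (Sp d)).restrict Ω = volume.restrict (M.core t) := by
  apply Measure.restrict_congr_set
  exact (ae_eq_set.2 ⟨h.volume_diff_core, by simp [sdiff_eq_empty.2 h.core_subset]⟩)

theorem IsTriangulation.aestronglyMeasurable_vel {t : ℝ} (h : M.IsTriangulation Ω t) :
    AEStronglyMeasurable (M.vel t) (volume.restrict Ω) := by
  rw [h.restrict_eq]
  exact h.continuousOn_vel.aestronglyMeasurable (isOpen_core t).measurableSet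

end MovingMesh

/-! ### Finite element functions -/

/-- Integration by parts supplies line derivatives, which are the components of the gradient
wherever `f` is differentiable; the Lipschitz constant bounds it, so it is square integrable on a
set of finite measure. -/
theorem isWeakGrad_gradient (hΩ : IsOpen Ω) [IsFiniteMeasure (volume.restrict Ω)] {C : ℝ≥0}
    {f : Sp d → ℝ} (hf : LocLip Ω C f)
    (hd : ∀ᵐ x ∂(volume.restrict Ω), DifferentiableAt ℝ f x) :
    IsWeakGrad Ω f (gradient f) := by
  have hm : Measurable (gradient f) := by
    have h1 := (InnerProductSpace.toDual ℝ (Sp d)).symm.continuous.measurable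
    exact h1.comp (measurable_fderiv ℝ f)
  refine ⟨MemLp.of_bound (C := C) hm.aestronglyMeasurable ?_, fun θ h1 h2 h3 k => ?_⟩
  · filter_upwards [ae_restrict_mem hΩ.measurableSet] with x hx
    rw [gradient, LinearIsometryEquiv.norm_map]
    exact hf.norm_fderiv_le hx
  · rw [integral_mul_fderiv_eq_neg_lineDeriv hΩ hf h1 h2 h3]
    congr 1
    apply integral_congr_ae
    filter_upwards [hd] with x hx
    rw [hx.lineDeriv_eq_fderiv]
    congr 1
    have h4 : inner ℝ (gradient f x) (EuclideanSpace.single k (1 : ℝ))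
        = fderiv ℝ f x (EuclideanSpace.single k 1) := by
      rw [gradient, InnerProductSpace.toDual_symm_apply]
    rw [← h4, EuclideanSpace.inner_single_right]
    simp

theorem contDiff_eval (P : MvPolynomial (Fin d) ℝ) {f : Sp d → Sp d} (hf : ContDiff ℝ 1 f) :
    ContDiff ℝ 1 fun x => MvPolynomial.eval (fun k => f x k) P := by
  induction P using MvPolynomial.induction_on with
  | C a => simpa using contDiff_const
  | add p q hp hq => simpa using hp.add hq
  | mul_X p k hp =>
    simp only [map_mul, MvPolynomial.eval_X]
    exact hp.mul ((EuclideanSpace.proj k : Sp d →L[ℝ] ℝ).contDiff.comp hf)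

theorem exists_lipschitzOnWith_of_contDiff {f : Sp d → ℝ} (hf : ContDiff ℝ 1 f) {K : Set (Sp d)}
    (hK : IsCompact K) (hKc : Convex ℝ K) : ∃ C : ℝ≥0, LipschitzOnWith C f K := by
  obtain ⟨B, hB⟩ := hK.exists_bound_of_continuousOn
    (hf.continuous_fderiv one_ne_zero).continuousOn
  refine ⟨B.toNNReal, hKc.lipschitzOnWith_of_nnnorm_fderiv_le (𝕜 := ℝ)
    (fun x _ => hf.differentiable one_ne_zero x) fun x hx => ?_⟩
  rw [← NNReal.coe_le_coe, coe_nnnorm]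
  exact (hB x hx).trans (Real.le_coe_toNNReal B)

namespace MovingMesh

variable {M : MovingMesh d}

theorem contDiff_ref (e : M.Elem) (t : ℝ) : ContDiff ℝ 1 (M.ref e t) := by
  unfold ref; fun_prop

/-- On each element a finite element function coincides with a smooth function. -/
theorem exists_contDiff_eqOn {t : ℝ} {φ : Sp d → ℝ} (hφ : φ ∈ M.sliceSpace t) {e : M.Elem}
    (he : e ∈ M.elems) (hdet : 0 < |(M.jac e t).det|) :
    ∃ f : Sp d → ℝ, ContDiff ℝ 1 f ∧ EqOn φ f (M.cell e t) := by
  obtain ⟨P, -, hP⟩ := hφ e he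
  refine ⟨_, contDiff_eval P (contDiff_ref e t), fun x hx => ?_⟩
  have := hP _ (ref_mem hdet hx)
  rwa [map_ref hdet] at this

theorem IsTriangulation.exists_lipschitz {t : ℝ} (h : M.IsTriangulation Ω t) {φ : Sp d → ℝ}
    (hφ : φ ∈ M.sliceSpace t) :
    ∃ C : ℝ≥0, ∀ e ∈ M.elems, LipschitzOnWith C φ (M.cell e t) := by
  have : ∀ e : M.elems, ∃ C : ℝ≥0, LipschitzOnWith C φ (M.cell e t) := by
    rintro ⟨e, he⟩
    obtain ⟨f, hf, hφf⟩ := exists_contDiff_eqOn hφ he (h.det_pos he)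
    obtain ⟨C, hC⟩ := exists_lipschitzOnWith_of_contDiff hf (isCompact_cell e t) (convex_cell e t)
    exact ⟨C, hC.congr_on hφf⟩
  choose C hC using this
  refine ⟨∑ e, C e, fun e he => (hC ⟨e, he⟩).weaken ?_⟩
  exact Finset.single_le_sum (f := C) (fun _ _ => zero_le) (Finset.mem_univ (⟨e, he⟩ : M.elems))

theorem IsTriangulation.continuousOn_body {t : ℝ} (h : M.IsTriangulation Ω t) {φ : Sp d → ℝ}
    (hφ : φ ∈ M.sliceSpace t) : ContinuousOn φ (M.body t) := by
  obtain ⟨C, hC⟩ := h.exists_lipschitz hφ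
  have : M.body t = ⋃ e : M.elems, M.cell e t := by
    ext x; simp [body]
  rw [this]
  exact (locallyFinite_of_finite _).continuousOn_iUnion
    (fun e => (isCompact_cell e.1 t).isClosed) fun e => (hC e e.2).continuousOn

theorem IsTriangulation.ae_mem_core {t : ℝ} (h : M.IsTriangulation Ω t) :
    ∀ᵐ x ∂(volume.restrict Ω), x ∈ M.core t := by
  rw [h.restrict_eq]
  exact ae_restrict_mem (isOpen_core t).measurableSet

/-- Piecewise smooth and continuous means Lipschitz on balls in `Ω`, because a segment there is
covered by the finitely many closed elements; differentiability holds off the faces. -/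
theorem IsTriangulation.memH1 (hΩ : IsOpen Ω) [IsFiniteMeasure (volume.restrict Ω)] {t : ℝ}
    (h : M.IsTriangulation Ω t) {φ : Sp d → ℝ} (hφ : φ ∈ M.sliceSpace t) : MemH1 Ω φ := by
  obtain ⟨C, hC⟩ := h.exists_lipschitz hφ
  have hL : LocLip Ω C φ := h.locLip hΩ hC
  obtain ⟨B, hB⟩ := (isCompact_body t).exists_bound_of_continuousOn (h.continuousOn_body hφ)
  refine ⟨MemLp.of_bound (C := B)
    (hL.continuousOn.aestronglyMeasurable hΩ.measurableSet) ?_, _, isWeakGrad_gradient hΩ hL ?_⟩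
  · filter_upwards [ae_restrict_mem hΩ.measurableSet] with x hx
    exact hB x (h.subset_body hx)
  · filter_upwards [h.ae_mem_core] with x hx
    obtain ⟨e, he, hxe⟩ := mem_core.1 hx
    obtain ⟨f, hf, hφf⟩ := exists_contDiff_eqOn hφ he (h.det_pos he)
    refine (hf.differentiable one_ne_zero x).congr_of_eventuallyEq ?_
    filter_upwards [isOpen_interior.mem_nhds hxe] with z hz
    exact hφf (interior_subset hz)

theorem sliceSpace_add {t : ℝ} {φ ψ : Sp d → ℝ} (hφ : φ ∈ M.sliceSpace t)
    (hψ : ψ ∈ M.sliceSpace t) : (fun x => φ x + ψ x) ∈ M.sliceSpace t := by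
  intro e he
  obtain ⟨P, hP, hP'⟩ := hφ e he
  obtain ⟨Q, hQ, hQ'⟩ := hψ e he
  refine ⟨P + Q, (MvPolynomial.totalDegree_add _ _).trans (max_le hP hQ), fun y hy => ?_⟩
  simp only
  rw [hP' y hy, hQ' y hy, map_add]

theorem sliceSpace_const_mul {t : ℝ} {φ : Sp d → ℝ} (hφ : φ ∈ M.sliceSpace t) (c : ℝ) :
    (fun x => c * φ x) ∈ M.sliceSpace t := by
  intro e he
  obtain ⟨P, hP, hP'⟩ := hφ e he
  refine ⟨c • P, (MvPolynomial.totalDegree_smul_le _ _).trans hP, fun y hy => ?_⟩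
  simp only
  rw [hP' y hy, MvPolynomial.smul_eval]

theorem IsFEFunction.sub {I : Set ℝ} {φ ψ : ℝ → Sp d → ℝ} (hφ : M.IsFEFunction I φ)
    (hψ : M.IsFEFunction I ψ) : M.IsFEFunction I (fun t x => φ t x - ψ t x) := by
  intro e he
  obtain ⟨P, hP, hP'⟩ := hφ e he
  obtain ⟨Q, hQ, hQ'⟩ := hψ e he
  refine ⟨fun j => P j - Q j, fun j => (MvPolynomial.totalDegree_sub _ _).trans
    (max_le (hP j) (hQ j)), fun t ht y hy => ?_⟩
  simp only
  rw [hP' t ht y hy, hQ' t ht y hy, ← Finset.sum_sub_distrib]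
  refine Finset.sum_congr rfl fun j _ => ?_
  rw [map_sub, mul_sub]

/-- Following the mesh leaves the reference coordinate fixed, so freezing the time factor at `s`
gives one quadratic per element, read on the mesh at time `t`. -/
theorem IsFEFunction.shift_mem {I : Set ℝ} {φ : ℝ → Sp d → ℝ} (hφ : M.IsFEFunction I φ) {s t : ℝ}
    (hs : s ∈ I) (ht : M.IsTriangulation Ω t) : M.shift φ s t ∈ M.sliceSpace t := by
  intro e he
  obtain ⟨P, hP, hP'⟩ := hφ e he
  refine ⟨∑ j : Fin 3, (s ^ (j : ℕ)) • P j, ?_, fun y hy => ?_⟩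
  · refine (MvPolynomial.totalDegree_finsetSum _ _).trans (Finset.sup_le fun j _ => ?_)
    exact (MvPolynomial.totalDegree_smul_le _ _).trans (hP j)
  · rw [shift, ht.flow_map he hy, hP' s hs y hy, map_sum]
    refine Finset.sum_congr rfl fun j _ => ?_
    rw [MvPolynomial.smul_eval]

theorem IsFEFunction.mem_sliceSpace {I : Set ℝ} {φ : ℝ → Sp d → ℝ} (hφ : M.IsFEFunction I φ)
    {t : ℝ} (ht : t ∈ I) : φ t ∈ M.sliceSpace t := by
  intro e he
  obtain ⟨P, hP, hP'⟩ := hφ e he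
  refine ⟨∑ j : Fin 3, (t ^ (j : ℕ)) • P j, ?_, fun y hy => ?_⟩
  · refine (MvPolynomial.totalDegree_finsetSum _ _).trans (Finset.sup_le fun j _ => ?_)
    exact (MvPolynomial.totalDegree_smul_le _ _).trans (hP j)
  · rw [hP' t ht y hy, map_sum]
    refine Finset.sum_congr rfl fun j _ => ?_
    rw [MvPolynomial.smul_eval]

/-- Along the characteristics, finite element functions are quadratic in time. -/
theorem IsFEFunction.exists_quadratic {I : Set ℝ} {φ : ℝ → Sp d → ℝ} (hφ : M.IsFEFunction I φ)
    {t : ℝ} (ht : M.IsTriangulation Ω t) {x : Sp d} (hx : x ∈ M.body t) :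
    ∃ c₀ c₁ c₂ : ℝ, ∀ s ∈ I, φ s (M.flow t s x) = c₀ + c₁ * s + c₂ * s ^ 2 := by
  obtain ⟨e, he, hxe⟩ := mem_body.1 hx
  obtain ⟨P, -, hP⟩ := hφ e he
  set y := M.ref e t x
  have hy : y ∈ refSimplex d := ref_mem (ht.det_pos he) hxe
  refine ⟨MvPolynomial.eval (fun k => y k) (P 0), MvPolynomial.eval (fun k => y k) (P 1),
    MvPolynomial.eval (fun k => y k) (P 2), fun s hs => ?_⟩
  rw [ht.flow_eq_move he hxe, move, hP s hs y hy, Fin.sum_univ_three]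
  simp only [Fin.val_zero, Fin.val_one, Fin.val_two, pow_zero, pow_one]
  ring

end MovingMesh

/-! ### Calculus of the norms -/

theorem norm0Sq_nonneg (Ω : Set (Sp d)) (v : Sp d → ℝ) : 0 ≤ norm0Sq Ω v :=
  integral_nonneg fun x => sq_nonneg (v x)

theorem semi1Sq_nonneg (Ω : Set (Sp d)) (v : Sp d → ℝ) : 0 ≤ semi1Sq Ω v :=
  integral_nonneg fun _ => sq_nonneg _

theorem norm1Sq_nonneg (Ω : Set (Sp d)) (v : Sp d → ℝ) : 0 ≤ norm1Sq Ω v :=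
  add_nonneg (norm0Sq_nonneg Ω v) (semi1Sq_nonneg Ω v)

theorem norm0Sq_le_norm1Sq (Ω : Set (Sp d)) (v : Sp d → ℝ) : norm0Sq Ω v ≤ norm1Sq Ω v :=
  le_add_of_nonneg_right (semi1Sq_nonneg Ω v)

theorem semi1Sq_le_norm1Sq (Ω : Set (Sp d)) (v : Sp d → ℝ) : semi1Sq Ω v ≤ norm1Sq Ω v :=
  le_add_of_nonneg_left (norm0Sq_nonneg Ω v)

theorem ip_self (Ω : Set (Sp d)) (v : Sp d → ℝ) : ip Ω v v = norm0Sq Ω v := by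
  simp [ip, norm0Sq, sq]

section congr

variable {v v' w : Sp d → ℝ}

theorem ip_congr (h : v =ᵐ[volume.restrict Ω] v') : ip Ω v w = ip Ω v' w :=
  integral_congr_ae (by filter_upwards [h] with x hx; rw [hx])

theorem norm0Sq_congr (h : v =ᵐ[volume.restrict Ω] v') : norm0Sq Ω v = norm0Sq Ω v' :=
  integral_congr_ae (by filter_upwards [h] with x hx; rw [hx])

theorem semi1Sq_congr (h : v =ᵐ[volume.restrict Ω] v') : semi1Sq Ω v = semi1Sq Ω v' := by
  rw [semi1Sq, wgrad_congr h, semi1Sq]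

theorem norm1Sq_congr (h : v =ᵐ[volume.restrict Ω] v') : norm1Sq Ω v = norm1Sq Ω v' := by
  rw [norm1Sq, norm1Sq, norm0Sq_congr h, semi1Sq_congr h]

end congr

theorem ip_sub_left {u v w : Sp d → ℝ} (hu : MemLp u 2 (volume.restrict Ω))
    (hv : MemLp v 2 (volume.restrict Ω)) (hw : MemLp w 2 (volume.restrict Ω)) :
    ip Ω (fun x => u x - v x) w = ip Ω u w - ip Ω v w := by
  simp only [ip, sub_mul]
  exact integral_sub (integrable_mul_of_memLp hu hw) (integrable_mul_of_memLp hv hw)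

theorem ip_const_mul_left (c : ℝ) (u w : Sp d → ℝ) :
    ip Ω (fun x => c * u x) w = c * ip Ω u w := by
  simp only [ip, mul_assoc]
  exact integral_const_mul _ _

theorem abs_integral_mul_le_sqrt {X : Type*} [MeasurableSpace X] {μ : Measure X} {f g : X → ℝ}
    (hf : MemLp f 2 μ) (hg : MemLp g 2 μ) :
    |∫ x, f x * g x ∂μ| ≤ √(∫ x, f x ^ 2 ∂μ) * √(∫ x, g x ^ 2 ∂μ) := by
  have h := integral_mul_le_Lp_mul_Lq_of_nonneg (μ := μ) Real.HolderConjugate.two_two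
    (f := fun x => |f x|) (g := fun x => |g x|) (Eventually.of_forall fun x => abs_nonneg _)
    (Eventually.of_forall fun x => abs_nonneg _) (by simpa using hf.norm) (by simpa using hg.norm)
  refine (abs_integral_le_integral_abs).trans ?_
  simp only [abs_mul]
  refine h.trans (le_of_eq ?_)
  simp only [Real.sqrt_eq_rpow, Real.rpow_two, sq_abs]

theorem abs_ip_le {v w : Sp d → ℝ} (hv : MemLp v 2 (volume.restrict Ω))
    (hw : MemLp w 2 (volume.restrict Ω)) : |ip Ω v w| ≤ √(norm0Sq Ω v) * √(norm0Sq Ω w) :=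
  abs_integral_mul_le_sqrt hv hw

/-- The Cauchy-Schwarz inequality with a bounded integrand. -/
theorem integral_abs_le_of_le_mul {E F : Type*} [NormedAddCommGroup E] [NormedAddCommGroup F]
    {X : Type*} [MeasurableSpace X] {μ : Measure X} {f : X → E} {g : X → F} {h : X → ℝ} {K : ℝ}
    (hK : 0 ≤ K) (hf : MemLp f 2 μ) (hg : MemLp g 2 μ)
    (hle : ∀ᵐ x ∂μ, |h x| ≤ K * (‖f x‖ * ‖g x‖)) :
    |∫ x, h x ∂μ| ≤ K * (√(∫ x, ‖f x‖ ^ 2 ∂μ) * √(∫ x, ‖g x‖ ^ 2 ∂μ)) := by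
  have h1 := abs_integral_mul_le_sqrt hf.norm hg.norm
  have hi := integrable_mul_of_memLp hf.norm hg.norm
  rw [← Real.norm_eq_abs]
  calc ‖∫ x, h x ∂μ‖ ≤ ∫ x, K * (‖f x‖ * ‖g x‖) ∂μ :=
        norm_integral_le_of_norm_le (hi.const_mul K) hle
    _ = K * ∫ x, ‖f x‖ * ‖g x‖ ∂μ := integral_const_mul _ _
    _ ≤ _ := by
        gcongr
        exact (le_abs_self _).trans h1

theorem norm0Sq_add_le {v w : Sp d → ℝ} (hv : MemLp v 2 (volume.restrict Ω))
    (hw : MemLp w 2 (volume.restrict Ω)) :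
    norm0Sq Ω (fun x => v x + w x) ≤ 2 * norm0Sq Ω v + 2 * norm0Sq Ω w := by
  have h1 := integrable_sq_of_memLp hv
  have h2 := integrable_sq_of_memLp hw
  rw [norm0Sq, norm0Sq, norm0Sq, ← integral_const_mul, ← integral_const_mul,
    ← integral_add (h1.const_mul 2) (h2.const_mul 2)]
  refine integral_mono (integrable_sq_of_memLp (hv.add hw)) ((h1.const_mul 2).add (h2.const_mul 2))
    fun x => ?_
  simp only
  nlinarith [sq_nonneg (v x - w x)]

theorem norm0Sq_const_mul (c : ℝ) (v : Sp d → ℝ) :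
    norm0Sq Ω (fun x => c * v x) = c ^ 2 * norm0Sq Ω v := by
  simp only [norm0Sq, mul_pow]
  exact integral_const_mul _ _

theorem norm0Sq_sub_le {v w : Sp d → ℝ} (hv : MemLp v 2 (volume.restrict Ω))
    (hw : MemLp w 2 (volume.restrict Ω)) :
    norm0Sq Ω (fun x => v x - w x) ≤ 2 * norm0Sq Ω v + 2 * norm0Sq Ω w := by
  have h1 := norm0Sq_add_le hv (hw.const_mul (-1))
  rw [norm0Sq_const_mul] at h1
  simpa [sub_eq_add_neg] using h1

section semi

variable {v w : Sp d → ℝ}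

theorem semi1Sq_const_mul (hΩ : IsOpen Ω) [IsFiniteMeasure (volume.restrict Ω)]
    (hv : MemH1 Ω v) (c : ℝ) : semi1Sq Ω (fun x => c * v x) = c ^ 2 * semi1Sq Ω v := by
  rw [(hv.isWeakGrad.const_mul c).semi1Sq_eq hΩ]
  simp only [semi1Sq, norm_smul, mul_pow, Real.norm_eq_abs, sq_abs]
  exact integral_const_mul _ _

theorem semi1Sq_add_le (hΩ : IsOpen Ω) [IsFiniteMeasure (volume.restrict Ω)]
    (hv : MemH1 Ω v) (hw : MemH1 Ω w) :
    semi1Sq Ω (fun x => v x + w x) ≤ 2 * semi1Sq Ω v + 2 * semi1Sq Ω w := by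
  have hg := hv.isWeakGrad.add hw.isWeakGrad hv.1 hw.1
  have h1 := integrable_norm_sq_of_memLp hv.isWeakGrad.1
  have h2 := integrable_norm_sq_of_memLp hw.isWeakGrad.1
  rw [hg.semi1Sq_eq hΩ, semi1Sq, semi1Sq, ← integral_const_mul, ← integral_const_mul,
    ← integral_add (h1.const_mul 2) (h2.const_mul 2)]
  refine integral_mono (integrable_norm_sq_of_memLp hg.1) ((h1.const_mul 2).add (h2.const_mul 2))
    fun x => ?_
  simp only
  have := parallelogram_law_with_norm ℝ (wgrad Ω v x) (wgrad Ω w x)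
  nlinarith [sq_nonneg ‖wgrad Ω v x - wgrad Ω w x‖]

theorem semi1Sq_sub_le (hΩ : IsOpen Ω) [IsFiniteMeasure (volume.restrict Ω)]
    (hv : MemH1 Ω v) (hw : MemH1 Ω w) :
    semi1Sq Ω (fun x => v x - w x) ≤ 2 * semi1Sq Ω v + 2 * semi1Sq Ω w := by
  have h1 := semi1Sq_add_le hΩ hv (hw.const_mul (-1))
  rw [semi1Sq_const_mul hΩ hw] at h1
  simpa [sub_eq_add_neg] using h1

theorem norm1Sq_const_mul (hΩ : IsOpen Ω) [IsFiniteMeasure (volume.restrict Ω)]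
    (hv : MemH1 Ω v) (c : ℝ) : norm1Sq Ω (fun x => c * v x) = c ^ 2 * norm1Sq Ω v := by
  rw [norm1Sq, norm1Sq, norm0Sq_const_mul, semi1Sq_const_mul hΩ hv]; ring

theorem norm1Sq_sub_le (hΩ : IsOpen Ω) [IsFiniteMeasure (volume.restrict Ω)]
    (hv : MemH1 Ω v) (hw : MemH1 Ω w) :
    norm1Sq Ω (fun x => v x - w x) ≤ 2 * norm1Sq Ω v + 2 * norm1Sq Ω w := by
  have h1 := norm0Sq_sub_le hv.1 hw.1
  have h2 := semi1Sq_sub_le hΩ hv hw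
  simp only [norm1Sq]
  linarith

end semi

/-! ### The dual semi-norm -/

theorem negNorm_nonneg (Ω : Set (Sp d)) (V : Set (Sp d → ℝ)) (v : Sp d → ℝ) :
    0 ≤ negNorm Ω V v := by
  apply Real.sSup_nonneg
  rintro r ⟨χ, -, -, rfl⟩
  positivity

/-- The sign condition on `B` covers the case of no admissible test function, where the supremum
takes its default value `0`. -/
theorem negNorm_le {V : Set (Sp d → ℝ)} {v : Sp d → ℝ} {B : ℝ} (hB : 0 ≤ B)
    (h : ∀ χ ∈ V, |ip Ω v χ| ≤ B * √(norm1Sq Ω χ)) : negNorm Ω V v ≤ B := by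
  refine Real.sSup_le ?_ hB
  rintro r ⟨χ, hχ, h0, rfl⟩
  have : 0 < √(norm1Sq Ω χ) := Real.sqrt_pos.2 (lt_of_le_of_ne (norm1Sq_nonneg Ω χ) (Ne.symm h0))
  rw [div_le_iff₀ this]
  exact h χ hχ

/-- Square integrability of `v` makes the quotients bounded, so that the supremum is a genuine one.
Test functions of zero norm are left out of the supremum, but they satisfy the inequality by
Cauchy-Schwarz. -/
theorem abs_ip_le_negNorm {V : Set (Sp d → ℝ)} {v χ : Sp d → ℝ}
    (hv : MemLp v 2 (volume.restrict Ω)) (hV : ∀ χ ∈ V, MemLp χ 2 (volume.restrict Ω))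
    (hχ : χ ∈ V) : |ip Ω v χ| ≤ negNorm Ω V v * √(norm1Sq Ω χ) := by
  have key : ∀ χ ∈ V, |ip Ω v χ| ≤ √(norm0Sq Ω v) * √(norm1Sq Ω χ) := fun χ hχ =>
    (abs_ip_le hv (hV χ hχ)).trans
      (by gcongr; exact norm0Sq_le_norm1Sq Ω χ)
  by_cases h0 : norm1Sq Ω χ = 0
  · have := key χ hχ
    rw [h0] at this ⊢
    simpa using this
  · have hpos : 0 < √(norm1Sq Ω χ) :=
      Real.sqrt_pos.2 (lt_of_le_of_ne (norm1Sq_nonneg Ω χ) (Ne.symm h0))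
    rw [← div_le_iff₀ hpos]
    refine le_csSup ⟨√(norm0Sq Ω v), ?_⟩ ⟨χ, hχ, h0, rfl⟩
    rintro r ⟨χ', hχ', h0', rfl⟩
    have : 0 < √(norm1Sq Ω χ') :=
      Real.sqrt_pos.2 (lt_of_le_of_ne (norm1Sq_nonneg Ω χ') (Ne.symm h0'))
    rw [div_le_iff₀ this]
    exact key χ' hχ'

theorem negNorm_congr {V : Set (Sp d → ℝ)} {v v' : Sp d → ℝ}
    (h : v =ᵐ[volume.restrict Ω] v') : negNorm Ω V v = negNorm Ω V v' := by
  unfold negNorm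
  simp only [ip_congr h]

theorem negNorm_sub_sq_le {V : Set (Sp d → ℝ)} {v w : Sp d → ℝ}
    (hv : MemLp v 2 (volume.restrict Ω)) (hw : MemLp w 2 (volume.restrict Ω))
    (hV : ∀ χ ∈ V, MemLp χ 2 (volume.restrict Ω)) :
    negNorm Ω V (fun x => v x - w x) ^ 2 ≤ 2 * negNorm Ω V v ^ 2 + 2 * negNorm Ω V w ^ 2 := by
  have h1 : negNorm Ω V (fun x => v x - w x) ≤ negNorm Ω V v + negNorm Ω V w := by
    refine negNorm_le (add_nonneg (negNorm_nonneg _ _ _) (negNorm_nonneg _ _ _)) fun χ hχ => ?_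
    rw [ip_sub_left hv hw (hV χ hχ), add_mul]
    exact (abs_sub _ _).trans
      (add_le_add (abs_ip_le_negNorm hv hV hχ) (abs_ip_le_negNorm hw hV hχ))
  have h0 := negNorm_nonneg Ω V (fun x => v x - w x)
  nlinarith [sq_nonneg (negNorm Ω V v - negNorm Ω V w)]

/-! ### Bilinear forms -/

/-- The bilinear form with given coefficients. -/
def gform (Ω : Set (Sp d)) (α : Sp d → ℝ) (β : Sp d → Sp d) (γ : Sp d → ℝ)
    (v χ : Sp d → ℝ) : ℝ :=
  ∫ x in Ω, (α x * inner ℝ (wgrad Ω v x) (wgrad Ω χ x)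
    + inner ℝ (β x) (wgrad Ω v x) * χ x + γ x * v x * χ x)

/-- The diffusion part of the bilinear form. -/
def diffForm (Ω : Set (Sp d)) (α : Sp d → ℝ) (v χ : Sp d → ℝ) : ℝ :=
  ∫ x in Ω, α x * inner ℝ (wgrad Ω v x) (wgrad Ω χ x)

/-- Measurable coefficients with bounds. -/
structure CoeffBounds (Ω : Set (Sp d)) (A κ B : ℝ) (α : Sp d → ℝ) (β : Sp d → Sp d)
    (γ : Sp d → ℝ) : Prop where
  mα : AEStronglyMeasurable α (volume.restrict Ω)
  mβ : AEStronglyMeasurable β (volume.restrict Ω)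
  mγ : AEStronglyMeasurable γ (volume.restrict Ω)
  bα : ∀ x ∈ Ω, |α x| ≤ A
  bβ : ∀ x ∈ Ω, ‖β x‖ ≤ κ
  bγ : ∀ x ∈ Ω, |γ x| ≤ B

namespace CoeffBounds

variable {A κ B : ℝ} {α : Sp d → ℝ} {β : Sp d → Sp d} {γ : Sp d → ℝ} {v w χ : Sp d → ℝ}

theorem integrable_diff (hΩ : IsOpen Ω) (h : CoeffBounds Ω A κ B α β γ)
    (hv : MemH1 Ω v) (hχ : MemH1 Ω χ) :
    Integrable (fun x => α x * inner ℝ (wgrad Ω v x) (wgrad Ω χ x)) (volume.restrict Ω) := by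
  refine (integrable_inner_of_memLp hv.isWeakGrad.1 hχ.isWeakGrad.1).bdd_mul (c := A) h.mα ?_
  filter_upwards [ae_restrict_mem hΩ.measurableSet] with x hx using h.bα x hx

theorem memLp_conv (hΩ : IsOpen Ω) (h : CoeffBounds Ω A κ B α β γ) (hv : MemH1 Ω v) :
    MemLp (fun x => inner ℝ (β x) (wgrad Ω v x)) 2 (volume.restrict Ω) := by
  refine MemLp.of_le_mul (c := κ) hv.isWeakGrad.1 (h.mβ.inner hv.isWeakGrad.1.1) ?_
  filter_upwards [ae_restrict_mem hΩ.measurableSet] with x hx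
  refine (abs_real_inner_le_norm _ _).trans ?_
  gcongr
  exact h.bβ x hx

theorem memLp_react (hΩ : IsOpen Ω) (h : CoeffBounds Ω A κ B α β γ) (hv : MemH1 Ω v) :
    MemLp (fun x => γ x * v x) 2 (volume.restrict Ω) := by
  refine MemLp.of_le_mul (c := B) hv.1 (h.mγ.mul hv.1.1) ?_
  filter_upwards [ae_restrict_mem hΩ.measurableSet] with x hx
  rw [norm_mul]
  gcongr
  exact h.bγ x hx

theorem gform_eq (hΩ : IsOpen Ω) (h : CoeffBounds Ω A κ B α β γ) (hv : MemH1 Ω v)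
    (hχ : MemH1 Ω χ) :
    gform Ω α β γ v χ = diffForm Ω α v χ + ip Ω (fun x => inner ℝ (β x) (wgrad Ω v x)) χ
      + ip Ω (fun x => γ x * v x) χ := by
  have h1 := h.integrable_diff hΩ hv hχ
  have h2 := integrable_mul_of_memLp (h.memLp_conv hΩ hv) hχ.1
  have h3 := integrable_mul_of_memLp (h.memLp_react hΩ hv) hχ.1
  rw [gform, integral_add (by exact h1.add h2) h3, integral_add h1 h2]
  rfl

/-- Convection and reaction need only be bounded with one factor in `L²`; only the diffusion part
has to be compared precisely between the two meshes. -/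
theorem abs_lower_le (hΩ : IsOpen Ω) (h : CoeffBounds Ω A κ B α β γ)
    (hκ : 0 ≤ κ) (hB : 0 ≤ B) (hv : MemH1 Ω v) (hχ : MemH1 Ω χ) :
    |gform Ω α β γ v χ - diffForm Ω α v χ|
      ≤ κ * (√(semi1Sq Ω v) * √(norm0Sq Ω χ)) + B * (√(norm0Sq Ω v) * √(norm0Sq Ω χ)) := by
  rw [h.gform_eq hΩ hv hχ, add_assoc, add_sub_cancel_left]
  refine (abs_add_le _ _).trans (add_le_add ?_ ?_)
  · have := integral_abs_le_of_le_mul (h := fun x => inner ℝ (β x) (wgrad Ω v x) * χ x) hκ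
      hv.isWeakGrad.1 hχ.1 (by
        filter_upwards [ae_restrict_mem hΩ.measurableSet] with x hx
        rw [abs_mul, ← mul_assoc]
        refine mul_le_mul_of_nonneg_right ((abs_real_inner_le_norm _ _).trans ?_) (abs_nonneg _)
        gcongr
        exact h.bβ x hx)
    simpa [norm0Sq, semi1Sq, ip] using this
  · have := integral_abs_le_of_le_mul (h := fun x => γ x * v x * χ x) hB
      hv.1 hχ.1 (by
        filter_upwards [ae_restrict_mem hΩ.measurableSet] with x hx
        rw [abs_mul, abs_mul, mul_assoc]
        refine mul_le_mul_of_nonneg_right (h.bγ x hx) (by positivity))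
    simpa [norm0Sq, ip] using this

theorem abs_diffForm_le (hΩ : IsOpen Ω) (h : CoeffBounds Ω A κ B α β γ) (hA : 0 ≤ A)
    (hv : MemH1 Ω v) (hχ : MemH1 Ω χ) :
    |diffForm Ω α v χ| ≤ A * (√(semi1Sq Ω v) * √(semi1Sq Ω χ)) := by
  have := integral_abs_le_of_le_mul
    (h := fun x => α x * inner ℝ (wgrad Ω v x) (wgrad Ω χ x)) hA
    hv.isWeakGrad.1 hχ.isWeakGrad.1 (by
      filter_upwards [ae_restrict_mem hΩ.measurableSet] with x hx
      rw [abs_mul]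
      exact mul_le_mul (h.bα x hx) (abs_real_inner_le_norm _ _) (abs_nonneg _) hA)
  exact this

theorem abs_gform_le (hΩ : IsOpen Ω) (h : CoeffBounds Ω A κ B α β γ)
    (hA : 0 ≤ A) (hκ : 0 ≤ κ) (hB : 0 ≤ B) (hv : MemH1 Ω v) (hχ : MemH1 Ω χ) :
    |gform Ω α β γ v χ| ≤ (A + κ + B) * (√(norm1Sq Ω v) * √(norm1Sq Ω χ)) := by
  have h1 := h.abs_lower_le hΩ hκ hB hv hχ
  have h2 := h.abs_diffForm_le hΩ hA hv hχ
  have h3 : |gform Ω α β γ v χ| ≤ |gform Ω α β γ v χ - diffForm Ω α v χ| + |diffForm Ω α v χ| := by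
    have := abs_add_le (gform Ω α β γ v χ - diffForm Ω α v χ) (diffForm Ω α v χ)
    rwa [sub_add_cancel] at this
  have a1 := Real.sqrt_le_sqrt (semi1Sq_le_norm1Sq Ω v)
  have a2 := Real.sqrt_le_sqrt (norm0Sq_le_norm1Sq Ω v)
  have a3 := Real.sqrt_le_sqrt (semi1Sq_le_norm1Sq Ω χ)
  have a4 := Real.sqrt_le_sqrt (norm0Sq_le_norm1Sq Ω χ)
  calc _ ≤ _ := h3
    _ ≤ _ := add_le_add h1 h2
    _ ≤ κ * (√(norm1Sq Ω v) * √(norm1Sq Ω χ)) + B * (√(norm1Sq Ω v) * √(norm1Sq Ω χ))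
        + A * (√(norm1Sq Ω v) * √(norm1Sq Ω χ)) := by gcongr
    _ = _ := by ring

theorem gform_sub_left (hΩ : IsOpen Ω) [IsFiniteMeasure (volume.restrict Ω)]
    (h : CoeffBounds Ω A κ B α β γ) (hv : MemH1 Ω v) (hw : MemH1 Ω w) (hχ : MemH1 Ω χ) :
    gform Ω α β γ (fun x => v x - w x) χ = gform Ω α β γ v χ - gform Ω α β γ w χ := by
  have i : ∀ {v}, MemH1 Ω v → Integrable (fun x => α x * inner ℝ (wgrad Ω v x) (wgrad Ω χ x)
      + inner ℝ (β x) (wgrad Ω v x) * χ x + γ x * v x * χ x) (volume.restrict Ω) := fun hv =>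
    ((h.integrable_diff hΩ hv hχ).add (integrable_mul_of_memLp (h.memLp_conv hΩ hv) hχ.1)).add
      (integrable_mul_of_memLp (h.memLp_react hΩ hv) hχ.1)
  rw [gform, gform, gform, ← integral_sub (i hv) (i hw)]
  apply integral_congr_ae
  filter_upwards [wgrad_sub hΩ hv hw] with x hx
  rw [hx, inner_sub_left, inner_sub_right]
  ring

theorem diffForm_add_right (hΩ : IsOpen Ω) [IsFiniteMeasure (volume.restrict Ω)]
    (h : CoeffBounds Ω A κ B α β γ) (hv : MemH1 Ω v) (hw : MemH1 Ω w) (hχ : MemH1 Ω χ) :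
    diffForm Ω α v (fun x => w x + χ x) = diffForm Ω α v w + diffForm Ω α v χ := by
  rw [diffForm, diffForm, diffForm, ← integral_add (h.integrable_diff hΩ hv hw)
    (h.integrable_diff hΩ hv hχ)]
  apply integral_congr_ae
  filter_upwards [wgrad_add hΩ hw hχ] with x hx
  rw [hx, inner_add_right]
  ring

theorem diffForm_const_mul_right (hΩ : IsOpen Ω) [IsFiniteMeasure (volume.restrict Ω)]
    (hχ : MemH1 Ω χ) (c : ℝ) :
    diffForm Ω α v (fun x => c * χ x) = c * diffForm Ω α v χ := by
  rw [diffForm, diffForm, ← integral_const_mul]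
  apply integral_congr_ae
  filter_upwards [wgrad_const_mul hΩ hχ c] with x hx
  rw [hx, inner_smul_right]
  ring

theorem diffForm_self_ge (hΩ : IsOpen Ω) (h : CoeffBounds Ω A κ B α β γ) {a₀ : ℝ}
    (ha : ∀ x ∈ Ω, a₀ ≤ α x) (hv : MemH1 Ω v) : a₀ * semi1Sq Ω v ≤ diffForm Ω α v v := by
  rw [semi1Sq, ← integral_const_mul, diffForm]
  refine integral_mono_ae ((integrable_norm_sq_of_memLp hv.isWeakGrad.1).const_mul _)
    (h.integrable_diff hΩ hv hv) ?_
  filter_upwards [ae_restrict_mem hΩ.measurableSet] with x hx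
  rw [real_inner_self_eq_norm_sq]
  gcongr
  exact ha x hx

theorem abs_diffForm_le_half (hΩ : IsOpen Ω) (h : CoeffBounds Ω A κ B α β γ)
    (ha : ∀ x ∈ Ω, 0 ≤ α x) (hv : MemH1 Ω v) (hχ : MemH1 Ω χ) :
    |diffForm Ω α v χ| ≤ (diffForm Ω α v v + diffForm Ω α χ χ) / 2 := by
  have h1 := h.integrable_diff hΩ hv hv
  have h2 := h.integrable_diff hΩ hχ hχ
  simp only [diffForm]
  rw [← integral_add h1 h2, ← integral_div, ← Real.norm_eq_abs]
  refine norm_integral_le_of_norm_le ((h1.add h2).div_const 2) ?_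
  filter_upwards [ae_restrict_mem hΩ.measurableSet] with x hx
  rw [real_inner_self_eq_norm_sq, real_inner_self_eq_norm_sq, Real.norm_eq_abs, abs_mul,
    abs_of_nonneg (ha x hx)]
  have h3 := abs_real_inner_le_norm (wgrad Ω v x) (wgrad Ω χ x)
  have h4 : |inner ℝ (wgrad Ω v x) (wgrad Ω χ x)| ≤ (‖wgrad Ω v x‖ ^ 2 + ‖wgrad Ω χ x‖ ^ 2) / 2 := by
    nlinarith [sq_nonneg (‖wgrad Ω v x‖ - ‖wgrad Ω χ x‖)]
  have := mul_le_mul_of_nonneg_left h4 (ha x hx)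
  linarith

end CoeffBounds

/-! ### The second difference of a function with integrable second derivative -/

/-- Integration by parts for absolutely continuous functions: `q` is merely integrable, and its
primitive has derivative `q` almost everywhere. -/
theorem integral_sub_mul_eq {q : ℝ → ℝ} {m b : ℝ} (hq : IntervalIntegrable q volume m b) :
    ∫ s in m..b, (b - s) * q s = ∫ s in m..b, ∫ σ in m..s, q σ := by
  have h1 : AbsolutelyContinuousOnInterval (fun s : ℝ => b - s) m b := by
    have : LipschitzWith 1 (fun s : ℝ => b - s) :=
      LipschitzWith.of_dist_le_mul fun x y => by
        rw [Real.dist_eq, Real.dist_eq, show b - x - (b - y) = -(x - y) by ring, abs_neg]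
        simp
    exact (this.lipschitzOnWith).absolutelyContinuousOnInterval
  have h2 := hq.absolutelyContinuousOnInterval_intervalIntegral left_mem_uIcc
  have h3 := h1.integral_mul_deriv_eq_deriv_mul h2
  have h4 : ∫ s in m..b, (b - s) * deriv (fun x => ∫ v in m..x, q v) s
      = ∫ s in m..b, (b - s) * q s := by
    apply intervalIntegral.integral_congr_ae
    filter_upwards [hq.ae_hasDerivAt_integral] with s hs hs'
    rw [(hs (uIoc_subset_uIcc hs') m left_mem_uIcc).deriv]
  have h5 : ∀ x, deriv (fun s : ℝ => b - s) x = -1 := fun x => by simp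
  rw [← h4, h3]
  simp [h5]

/-- Taylor's formula with integral remainder. -/
theorem taylor_integral {h g q : ℝ → ℝ} {α β : ℝ} (hd : DifferentiableOn ℝ h (Icc α β))
    (hg : ∀ t ∈ Icc α β, derivWithin h (Icc α β) t = g t)
    (hq : IntervalIntegrable q volume α β) (hgq : ∀ t ∈ Icc α β, g t = g α + ∫ s in α..t, q s)
    {m b : ℝ} (hm : m ∈ Icc α β) (hb : b ∈ Icc α β) :
    ∫ s in m..b, (b - s) * q s = h b - h m - (b - m) * g m := by
  have hαβ : α ≤ β := hm.1.trans hm.2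
  have hsub : uIcc m b ⊆ Icc α β := by
    rw [← uIcc_of_le hαβ] at hm hb ⊢
    exact uIcc_subset_uIcc hm hb
  have hqi : ∀ x ∈ Icc α β, ∀ y ∈ Icc α β, IntervalIntegrable q volume x y := fun x hx y hy =>
    hq.mono_set (by rw [← uIcc_of_le hαβ] at hx hy; exact uIcc_subset_uIcc hx hy)
  have hα : α ∈ Icc α β := left_mem_Icc.2 hαβ
  have hgc : ContinuousOn g (Icc α β) := by
    have h1 : ContinuousOn (fun t => g α + ∫ s in α..t, q s) (Icc α β) :=
      continuousOn_const.add (by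
        have := intervalIntegral.continuousOn_primitive_interval (a := α) (b := β)
          ((intervalIntegrable_iff_integrableOn_Icc_of_le hαβ).1 hq |>.mono_set
            (by rw [uIcc_of_le hαβ]))
        rwa [uIcc_of_le hαβ] at this)
    exact h1.congr hgq
  -- The derivative is given within the closed interval only; at interior points it is two-sided,
  -- which is all that the fundamental theorem asks for besides continuity.
  have hftc : ∫ s in m..b, g s = h b - h m := by
    refine intervalIntegral.integral_eq_sub_of_hasDeriv_right (hd.continuousOn.mono hsub)
      (fun x hx => ?_) (hgc.mono hsub).intervalIntegrable
    have hx' : x ∈ Ioo α β :=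
      ⟨(le_min hm.1 hb.1).trans_lt hx.1, hx.2.trans_le (max_le hm.2 hb.2)⟩
    have h1 := (hd x ⟨hx'.1.le, hx'.2.le⟩).hasDerivWithinAt
    rw [hg x ⟨hx'.1.le, hx'.2.le⟩] at h1
    exact (h1.hasDerivAt (Icc_mem_nhds hx'.1 hx'.2)).hasDerivWithinAt
  rw [integral_sub_mul_eq (hqi m hm b hb)]
  have h2 : ∫ s in m..b, ∫ σ in m..s, q σ = ∫ s in m..b, (g s - g m) := by
    apply intervalIntegral.integral_congr
    intro s hs
    have hs' := hsub hs
    simp only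
    rw [hgq s hs', hgq m hm, ← intervalIntegral.integral_add_adjacent_intervals
      (hqi α hα m hm) (hqi m hm s hs')]
    ring
  rw [h2, intervalIntegral.integral_sub ((hgc.mono hsub).intervalIntegrable)
    intervalIntegrable_const, hftc]
  simp

/-- Taylor's formula at the midpoint towards both ends; the first-order terms cancel and the two
remainders join into the hat kernel `r - |s - m|`. -/
theorem second_difference {h g q : ℝ → ℝ} {α β : ℝ} (hd : DifferentiableOn ℝ h (Icc α β))
    (hg : ∀ t ∈ Icc α β, derivWithin h (Icc α β) t = g t)
    (hq : IntervalIntegrable q volume α β) (hgq : ∀ t ∈ Icc α β, g t = g α + ∫ s in α..t, q s)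
    {m r : ℝ} (hr : 0 ≤ r) (h1 : m - r ∈ Icc α β) (h2 : m + r ∈ Icc α β) :
    h (m + r) + h (m - r) - 2 * h m = ∫ s in Ioc (m - r) (m + r), (r - |s - m|) * q s := by
  have hm : m ∈ Icc α β := ⟨by linarith [h1.1], by linarith [h2.2]⟩
  have e1 := taylor_integral hd hg hq hgq hm h1
  have e2 := taylor_integral hd hg hq hgq hm h2
  have hαβ : α ≤ β := hm.1.trans hm.2
  have hqi : ∀ x ∈ Icc α β, ∀ y ∈ Icc α β, IntervalIntegrable q volume x y := fun x hx y hy =>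
    hq.mono_set (by rw [← uIcc_of_le hαβ] at hx hy; exact uIcc_subset_uIcc hx hy)
  have hi : ∀ x ∈ Icc α β, ∀ y ∈ Icc α β,
      IntervalIntegrable (fun s => (r - |s - m|) * q s) volume x y := fun x hx y hy =>
    (hqi x hx y hy).continuousOn_mul (by fun_prop)
  rw [← intervalIntegral.integral_of_le (by linarith),
    ← intervalIntegral.integral_add_adjacent_intervals (hi _ h1 m hm) (hi m hm _ h2)]
  have e3 : ∫ s in (m - r)..m, (r - |s - m|) * q s = ∫ s in m..(m - r), (m - r - s) * q s := by
    rw [intervalIntegral.integral_symm m, ← intervalIntegral.integral_neg]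
    apply intervalIntegral.integral_congr
    intro s hs
    rw [uIcc_of_ge (by linarith)] at hs
    simp only
    rw [abs_of_nonpos (by linarith [hs.2])]
    ring
  have e4 : ∫ s in m..(m + r), (r - |s - m|) * q s = ∫ s in m..(m + r), (m + r - s) * q s := by
    apply intervalIntegral.integral_congr
    intro s hs
    rw [uIcc_of_le (by linarith)] at hs
    simp only
    rw [abs_of_nonneg (by linarith [hs.1])]
    ring
  rw [e3, e4, e1, e2]
  ring

/-! ### Time averages of square integrable functions -/

/-- The weighted integral in time of a function of time and space. -/
def timeAverage {X Y E : Type*} [MeasurableSpace X] [NormedAddCommGroup E] [NormedSpace ℝ E]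
    (ν : Measure X) (k : X → ℝ) (f : X × Y → E) : Y → E := fun y => ∫ s, k s • f (s, y) ∂ν

section timeAverage

variable {X Y E : Type*} [MeasurableSpace X] [MeasurableSpace Y] [NormedAddCommGroup E]
  [NormedSpace ℝ E] {ν : Measure X} {μ : Measure Y} [IsFiniteMeasure ν] [IsFiniteMeasure μ]
  {k : X → ℝ} {R : ℝ} {f : X × Y → E}

theorem aestronglyMeasurable_timeAverage (hk : Measurable k)
    (hf : AEStronglyMeasurable f (ν.prod μ)) :
    AEStronglyMeasurable (timeAverage ν k f) μ := by
  have h1 : AEStronglyMeasurable (fun p : X × Y => k p.1 • f p) (ν.prod μ) :=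
    (hk.comp measurable_fst).aestronglyMeasurable.smul hf
  exact h1.prod_swap.integral_prod_right'

/-- Cauchy-Schwarz in time at fixed `y`, against the constant function `1`; this is where the length
of the time interval enters. -/
theorem ae_norm_timeAverage_sq_le (hR : 0 ≤ R) (hkR : ∀ᵐ s ∂ν, |k s| ≤ R)
    (hf : MemLp f 2 (ν.prod μ)) :
    ∀ᵐ y ∂μ, ‖timeAverage ν k f y‖ ^ 2 ≤ R ^ 2 * ν.real univ * ∫ s, ‖f (s, y)‖ ^ 2 ∂ν := by
  have h1 := (integrable_norm_sq_of_memLp hf).prod_left_ae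
  have h2 : ∀ᵐ y ∂μ, AEStronglyMeasurable (fun s => f (s, y)) ν := hf.1.prod_swap.prodMk_left
  filter_upwards [h1, h2] with y h1 h2
  have h3 : MemLp (fun s => f (s, y)) 2 ν := (memLp_two_iff_integrable_sq_norm h2).2 h1
  have h4 := integral_abs_le_of_le_mul (μ := ν) (f := fun s => f (s, y)) (g := fun _ => (1 : ℝ))
    (h := fun s => ‖k s • f (s, y)‖) hR h3 (memLp_const 1) (by
      filter_upwards [hkR] with s hs
      rw [abs_of_nonneg (norm_nonneg _), norm_smul, norm_one, mul_one]
      gcongr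
      exact hs)
  have h5 : ‖timeAverage ν k f y‖ ≤ R * (√(∫ s, ‖f (s, y)‖ ^ 2 ∂ν) * √(ν.real univ)) := by
    refine (norm_integral_le_integral_norm _).trans ((le_abs_self _).trans (h4.trans (le_of_eq ?_)))
    simp
  calc ‖timeAverage ν k f y‖ ^ 2 ≤ (R * (√(∫ s, ‖f (s, y)‖ ^ 2 ∂ν) * √(ν.real univ))) ^ 2 := by
        gcongr
    _ = R ^ 2 * ν.real univ * ∫ s, ‖f (s, y)‖ ^ 2 ∂ν := by
        rw [mul_pow, mul_pow, Real.sq_sqrt (integral_nonneg fun _ => sq_nonneg _),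
          Real.sq_sqrt measureReal_nonneg]
        ring

theorem memLp_timeAverage (hk : Measurable k) (hR : 0 ≤ R) (hkR : ∀ᵐ s ∂ν, |k s| ≤ R)
    (hf : MemLp f 2 (ν.prod μ)) : MemLp (timeAverage ν k f) 2 μ := by
  have hm := aestronglyMeasurable_timeAverage hk hf.1
  rw [memLp_two_iff_integrable_sq_norm hm]
  refine Integrable.mono' ((integrable_norm_sq_of_memLp hf).integral_prod_right.const_mul
    (R ^ 2 * ν.real univ)) (hm.norm.pow 2) ?_
  filter_upwards [ae_norm_timeAverage_sq_le hR hkR hf] with y hy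
  rwa [Real.norm_of_nonneg (sq_nonneg _)]

theorem integral_norm_timeAverage_sq_le (hk : Measurable k) (hR : 0 ≤ R)
    (hkR : ∀ᵐ s ∂ν, |k s| ≤ R) (hf : MemLp f 2 (ν.prod μ)) :
    ∫ y, ‖timeAverage ν k f y‖ ^ 2 ∂μ
      ≤ R ^ 2 * ν.real univ * ∫ s, ∫ y, ‖f (s, y)‖ ^ 2 ∂μ ∂ν := by
  have hi := integrable_norm_sq_of_memLp hf
  rw [integral_integral_swap (f := fun s y => ‖f (s, y)‖ ^ 2) hi, ← integral_const_mul]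
  exact integral_mono_ae (integrable_norm_sq_of_memLp (memLp_timeAverage hk hR hkR hf))
    (hi.integral_prod_right.const_mul _) (ae_norm_timeAverage_sq_le hR hkR hf)

end timeAverage

/-! ### Weak gradients of time averages -/

theorem integral_prod_mul_test {ν : Measure ℝ} [IsFiniteMeasure ν]
    [IsFiniteMeasure (volume.restrict Ω)] {k : ℝ → ℝ} {R : ℝ} (hk : Measurable k)
    (hkR : ∀ᵐ s ∂ν, |k s| ≤ R) {A : ℝ × Sp d → ℝ} (hA : MemLp A 2 (ν.prod (volume.restrict Ω)))
    {θ : Sp d → ℝ} (hθ : MemLp θ 2 (volume.restrict Ω)) :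
    ∫ x in Ω, timeAverage ν k A x * θ x = ∫ s, k s * (∫ x in Ω, A (s, x) * θ x) ∂ν := by
  have hθ' : MemLp (fun p : ℝ × Sp d => θ p.2) 2 (ν.prod (volume.restrict Ω)) := hθ.comp_snd ν
  have h1 : Integrable (fun p : ℝ × Sp d => k p.1 * (A p * θ p.2))
      (ν.prod (volume.restrict Ω)) := by
    refine (integrable_mul_of_memLp hA hθ').bdd_mul (c := R)
      (hk.comp measurable_fst).aestronglyMeasurable ?_
    exact Measure.quasiMeasurePreserving_fst.ae hkR
  have h2 := integral_integral_swap (f := fun s x => k s * (A (s, x) * θ x)) h1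
  simp only [integral_const_mul] at h2
  rw [h2]
  congr 1
  ext x
  rw [timeAverage, ← integral_mul_const]
  congr 1
  ext s
  rw [smul_eq_mul, mul_assoc]

theorem isWeakGrad_timeAverage {ν : Measure ℝ} [IsFiniteMeasure ν]
    [IsFiniteMeasure (volume.restrict Ω)] {k : ℝ → ℝ} {R : ℝ} (hk : Measurable k) (hR : 0 ≤ R)
    (hkR : ∀ᵐ s ∂ν, |k s| ≤ R) {A : ℝ × Sp d → ℝ} (hA : MemLp A 2 (ν.prod (volume.restrict Ω)))
    {B : ℝ × Sp d → Sp d} (hB : MemLp B 2 (ν.prod (volume.restrict Ω)))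
    (h : ∀ᵐ s ∂ν, IsWeakGrad Ω (fun x => A (s, x)) (fun x => B (s, x))) :
    IsWeakGrad Ω (timeAverage ν k A) (timeAverage ν k B) := by
  refine ⟨memLp_timeAverage hk hR hkR hB, fun θ h1 h2 h3 j => ?_⟩
  have hBj : MemLp (fun p => B p j) 2 (ν.prod (volume.restrict Ω)) :=
    (EuclideanSpace.proj j : Sp d →L[ℝ] ℝ).comp_memLp' hB
  rw [integral_prod_mul_test hk hkR hA (memLp_fderiv_of_test h1 h2 _)]
  -- Taking a component commutes with a vector-valued integral only where the time slice is
  -- integrable, which is known for almost every `x`.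
  have e1 : ∫ x in Ω, timeAverage ν k B x j * θ x
      = ∫ x in Ω, timeAverage ν k (fun p => B p j) x * θ x := by
    apply integral_congr_ae
    have h4 := (integrable_norm_sq_of_memLp hB).prod_left_ae
    have h5 : ∀ᵐ y ∂(volume.restrict Ω), AEStronglyMeasurable (fun s => B (s, y)) ν :=
      hB.1.prod_swap.prodMk_left
    filter_upwards [h4, h5] with x h4 h5
    have h6 : Integrable (fun s => B (s, x)) ν :=
      ((memLp_two_iff_integrable_sq_norm h5).2 h4).integrable one_le_two
    have h7 : Integrable (fun s => k s • B (s, x)) ν :=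
      h6.bdd_smul R hk.aestronglyMeasurable hkR
    have := (EuclideanSpace.proj j : Sp d →L[ℝ] ℝ).integral_comp_comm h7
    exact congrArg (· * θ x) this.symm
  rw [e1, integral_prod_mul_test hk hkR hBj (memLp_of_test h1.continuous h2), ← integral_neg]
  apply integral_congr_ae
  filter_upwards [h] with s hs
  rw [hs.2 θ h1 h2 h3 j]
  ring

/-- A measurable function whose time slices are controlled by those of an `L²` function. -/
theorem memLp_of_slice_le {X Y E E' : Type*} [MeasurableSpace X] [MeasurableSpace Y]
    [NormedAddCommGroup E] [NormedAddCommGroup E'] {ν : Measure X} {μ : Measure Y}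
    [SFinite ν] [SFinite μ] {f : X × Y → E} {f' : X × Y → E'}
    {C : ℝ} (hf : MemLp f 2 (ν.prod μ)) (hf' : AEStronglyMeasurable f' (ν.prod μ))
    (h : ∀ᵐ s ∂ν, MemLp (fun y => f' (s, y)) 2 μ
      ∧ ∫ y, ‖f' (s, y)‖ ^ 2 ∂μ ≤ C * ∫ y, ‖f (s, y)‖ ^ 2 ∂μ) :
    MemLp f' 2 (ν.prod μ)
      ∧ ∫ s, ∫ y, ‖f' (s, y)‖ ^ 2 ∂μ ∂ν ≤ C * ∫ s, ∫ y, ‖f (s, y)‖ ^ 2 ∂μ ∂ν := by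
  have hi := (integrable_norm_sq_of_memLp hf).integral_prod_left
  have hm : AEStronglyMeasurable (fun p => ‖f' p‖ ^ 2) (ν.prod μ) := hf'.norm.pow 2
  have hi' : Integrable (fun s => ∫ y, ‖f' (s, y)‖ ^ 2 ∂μ) ν := by
    refine Integrable.mono' (hi.const_mul C) hm.integral_prod_right' ?_
    filter_upwards [h] with s hs
    rw [Real.norm_of_nonneg (integral_nonneg fun _ => sq_nonneg _)]
    exact hs.2
  constructor
  · rw [memLp_two_iff_integrable_sq_norm hf', integrable_prod_iff hm]
    refine ⟨?_, ?_⟩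
    · filter_upwards [h] with s hs
      exact integrable_norm_sq_of_memLp hs.1
    · simpa using hi'
  · rw [← integral_const_mul]
    exact integral_mono_ae hi' (hi.const_mul C) (by filter_upwards [h] with s hs; exact hs.2)

/-! ### Transport of space-time functions along the mesh -/

namespace MovingMesh

variable {M : MovingMesh d}

section spacetime

variable {I J : Set ℝ} {Λ : ℝ≥0} {m : ℝ}

open Classical in
/-- A Borel measurable version of the space-time transport along the mesh. -/
def spaceTimeFlow (M : MovingMesh d) (m : ℝ) (p : ℝ × Sp d) : ℝ × Sp d :=
  if p ∈ univ ×ˢ M.core m then (p.1, M.flow m p.1 p.2) else p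

theorem IsTriangulation.measurable_spaceTimeFlow (h : M.IsTriangulation Ω m) :
    Measurable (M.spaceTimeFlow m) := by
  classical
  have ho : IsOpen ((univ : Set ℝ) ×ˢ M.core m) := isOpen_univ.prod (isOpen_core m)
  have h1 : ContinuousOn (fun p : ℝ × Sp d => (p.1, M.flow m p.1 p.2)) (univ ×ˢ M.core m) :=
    continuousOn_fst.prodMk h.continuousOn_flow
  exact h1.measurable_piecewise (g := id) continuousOn_id ho.measurableSet

theorem ae_mem_core_prod (h : M.IsTriangulation Ω m) (ν : Measure ℝ) [SFinite ν]
    [SFinite (volume.restrict Ω)] :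
    ∀ᵐ p ∂(ν.prod (volume.restrict Ω)), p ∈ (univ : Set ℝ) ×ˢ M.core m := by
  filter_upwards [Measure.quasiMeasurePreserving_snd.ae h.ae_mem_core] with p hp
  exact ⟨mem_univ _, hp⟩

/-- By Fubini a null set of space-time has null slices at almost every time, and at each such time
in `I` the flow pulls null sets back to null sets. Hence measurable space-time functions remain
measurable after transport. -/
theorem quasiMeasurePreserving_spaceTimeFlow
    (hm : M.IsTriangulation Ω m)
    (hiso : ∀ s ∈ I, IsMeshIso Ω Λ (M.flow m s) (M.flow s m) (M.core m) (M.core s))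
    {ν : Measure ℝ} [SFinite ν] [SFinite (volume.restrict Ω)] (hν : ∀ᵐ s ∂ν, s ∈ I) :
    Measure.QuasiMeasurePreserving (M.spaceTimeFlow m) (ν.prod (volume.restrict Ω))
      (ν.prod (volume.restrict Ω)) := by
  refine ⟨hm.measurable_spaceTimeFlow, Measure.AbsolutelyContinuous.mk fun t ht h0 => ?_⟩
  rw [Measure.map_apply hm.measurable_spaceTimeFlow ht,
    Measure.measure_prod_null (hm.measurable_spaceTimeFlow ht)]
  rw [Measure.measure_prod_null ht] at h0
  filter_upwards [h0, hν] with s hs hsI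
  have h1 : ∀ᵐ x ∂(volume.restrict Ω), (s, x) ∉ t := by
    simpa only [ae_iff, not_not] using! hs
  have h2 := (hiso s hsI).ae_comp h1
  have h3 : ∀ᵐ x ∂(volume.restrict Ω), M.spaceTimeFlow m (s, x) ∉ t := by
    filter_upwards [h2, hm.ae_mem_core] with x hx hxc
    rwa [spaceTimeFlow, if_pos ⟨mem_univ _, hxc⟩]
  simpa only [ae_iff, not_not] using! h3

theorem aestronglyMeasurable_spaceTime_comp {E : Type*} [NormedAddCommGroup E]
    (hm : M.IsTriangulation Ω m)
    (hiso : ∀ s ∈ I, IsMeshIso Ω Λ (M.flow m s) (M.flow s m) (M.core m) (M.core s))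
    {ν : Measure ℝ} [SFinite ν] [SFinite (volume.restrict Ω)] (hν : ∀ᵐ s ∂ν, s ∈ I)
    {f : ℝ × Sp d → E} (hf : AEStronglyMeasurable f (ν.prod (volume.restrict Ω))) :
    AEStronglyMeasurable (fun p => f (p.1, M.flow m p.1 p.2)) (ν.prod (volume.restrict Ω)) := by
  refine (hf.comp_quasiMeasurePreserving
    (quasiMeasurePreserving_spaceTimeFlow hm hiso hν)).congr ?_
  filter_upwards [ae_mem_core_prod hm ν] with p hp
  simp only [Function.comp_apply, spaceTimeFlow, if_pos hp]

theorem aestronglyMeasurable_spaceTime_pullGrad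
    (hm : M.IsTriangulation Ω m)
    (hiso : ∀ s ∈ I, IsMeshIso Ω Λ (M.flow m s) (M.flow s m) (M.core m) (M.core s))
    {ν : Measure ℝ} [SFinite ν] [SFinite (volume.restrict Ω)] (hν : ∀ᵐ s ∂ν, s ∈ I)
    {G : ℝ → Sp d → Sp d}
    (hG : AEStronglyMeasurable (Function.uncurry G) (ν.prod (volume.restrict Ω))) :
    AEStronglyMeasurable (fun p : ℝ × Sp d => IsMeshIso.pullGrad (M.flow m p.1) (G p.1) p.2)
      (ν.prod (volume.restrict Ω)) := by
  have h1 := aestronglyMeasurable_spaceTime_comp hm hiso hν hG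
  have ho : IsOpen ((univ : Set ℝ) ×ˢ M.core m) := isOpen_univ.prod (isOpen_core m)
  have h2 : AEStronglyMeasurable (fun p : ℝ × Sp d => fderiv ℝ (M.flow m p.1) p.2)
      (ν.prod (volume.restrict Ω)) := by
    have := hm.continuousOn_fderiv_flow.aestronglyMeasurable (μ := ν.prod (volume.restrict Ω))
      ho.measurableSet
    rwa [Measure.restrict_eq_self_of_ae_mem (ae_mem_core_prod hm ν)] at this
  have h3 : AEStronglyMeasurable
      (fun p : ℝ × Sp d => ContinuousLinearMap.adjoint (fderiv ℝ (M.flow m p.1) p.2))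
      (ν.prod (volume.restrict Ω)) :=
    (ContinuousLinearMap.adjoint (𝕜 := ℝ) (E := Sp d)
      (F := Sp d)).continuous.comp_aestronglyMeasurable h2
  exact (isBoundedBilinearMap_apply (𝕜 := ℝ) (E := Sp d)
    (F := Sp d)).continuous.comp_aestronglyMeasurable (h3.prodMk h1)

end spacetime

end MovingMesh

/-! ### Consistency of the trapezoid approximation -/

namespace SpaceTimeMesh

variable {T : ℝ} {S : SpaceTimeMesh d Ω T} {i : Fin (S.N + 1)} {Λ : ℝ≥0}

theorem dt_pos (i : Fin (S.N + 1)) : 0 < S.dt i :=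
  sub_pos.2 (S.strictMono i.castSucc_lt_succ)

theorem right_eq (i : Fin (S.N + 1)) : S.right i = S.left i + S.dt i := by
  rw [dt]; ring

theorem left_mem (i : Fin (S.N + 1)) : S.left i ∈ S.slab i :=
  ⟨le_rfl, by linarith [S.dt_pos i, S.right_eq i]⟩

theorem right_mem (i : Fin (S.N + 1)) : S.right i ∈ S.slab i :=
  ⟨by linarith [S.dt_pos i, S.right_eq i], le_rfl⟩

theorem tmid_mem (i : Fin (S.N + 1)) : S.tmid (2 / 3) i ∈ S.slab i := by
  constructor <;> rw [tmid] <;> linarith [S.dt_pos i, S.right_eq i]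

theorem zeta_mem (i : Fin (S.N + 1)) : S.zeta (2 / 3) i ∈ S.slab i := by
  constructor <;> rw [zeta] <;> linarith [S.dt_pos i, S.right_eq i]

theorem tri {t : ℝ} (ht : t ∈ S.slab i) : (S.mesh i).IsTriangulation Ω t :=
  S.triangulation i t ht

/-- The transport maps of a time partition distort lengths at most by the factor `Λ`. -/
def HasDistortion (S : SpaceTimeMesh d Ω T) (i : Fin (S.N + 1)) (Λ : ℝ≥0) : Prop :=
  ∀ t ∈ S.slab i, ∀ s ∈ S.slab i, IsMeshIso Ω Λ ((S.mesh i).flow t s) ((S.mesh i).flow s t)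
    ((S.mesh i).core t) ((S.mesh i).core s)

/-- The curve through the transported point is the curve through `x`, so the characteristic
derivative along it is an ordinary one-variable derivative. -/
theorem charDeriv_flow {w : ℝ → Sp d → ℝ} {r t : ℝ} (hr : r ∈ S.slab i) (ht : t ∈ S.slab i)
    {x : Sp d} (hx : x ∈ (S.mesh i).body r) :
    S.charDeriv i w t ((S.mesh i).flow r t x)
      = derivWithin (fun s => w s ((S.mesh i).flow r s x)) (S.slab i) t := by
  rw [charDeriv]
  congr 1
  ext s
  rw [(S.tri hr).flow_flow (S.tri ht) s hx]

/-- The mid-step node is the midpoint of the first two basis nodes, at distance `Δt/3` from each, so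
the difference is minus half a second difference. The regularity, given along curves labelled by
their starting points, is relabelled by positions at the mid-step node. -/
theorem HasSecondCharDeriv.sub_trap_eq (hiso : S.HasDistortion i Λ) {u : ℝ → Sp d → ℝ}
    (hu : S.HasSecondCharDeriv u) :
    (fun x => u (S.tmid (2 / 3) i) x - S.trap (2 / 3) i u x) =ᵐ[volume.restrict Ω]
      timeAverage (volume.restrict (Ioc (S.left i) (S.zeta (2 / 3) i)))
        (fun s => -(S.dt i / 3 - |s - S.tmid (2 / 3) i|) / 2)
        (fun p => S.charDeriv i (S.charDeriv i u) p.1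
          ((S.mesh i).flow (S.tmid (2 / 3) i) p.1 p.2)) := by
  have hm := S.tmid_mem i
  have hl := S.left_mem i
  have h1 := (hiso _ hm _ hl).ae_comp (hu i).1
  filter_upwards [h1, (S.tri hm).ae_mem_core] with x hx hxc
  have hxb : x ∈ (S.mesh i).body (S.tmid (2 / 3) i) :=
    (S.tri hm).subset_body ((S.tri hm).core_subset hxc)
  have hγ : ∀ s, (S.mesh i).flow (S.left i) s ((S.mesh i).flow (S.tmid (2 / 3) i) (S.left i) x)
      = (S.mesh i).flow (S.tmid (2 / 3) i) s x := fun s => (S.tri hm).flow_flow (S.tri hl) s hxb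
  simp only [hγ] at hx
  obtain ⟨hd, hq, hg⟩ := hx
  have e := second_difference (h := fun s => u s ((S.mesh i).flow (S.tmid (2 / 3) i) s x))
    (g := fun t => S.charDeriv i u t ((S.mesh i).flow (S.tmid (2 / 3) i) t x))
    (r := S.dt i / 3) (m := S.tmid (2 / 3) i) hd (fun t ht => (charDeriv_flow hm ht hxb).symm) hq hg
    (by linarith [S.dt_pos i])
    (by constructor <;> rw [tmid] <;> linarith [S.dt_pos i, S.right_eq i])
    (by constructor <;> rw [tmid] <;> linarith [S.dt_pos i, S.right_eq i])
  have e1 : S.tmid (2 / 3) i - S.dt i / 3 = S.left i := by rw [tmid]; ring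
  have e2 : S.tmid (2 / 3) i + S.dt i / 3 = S.zeta (2 / 3) i := by rw [tmid, zeta]; ring
  simp only [e1, e2, (S.tri hm).flow_self hxb] at e
  rw [timeAverage]
  have e3 : ∀ s : ℝ, (-(S.dt i / 3 - |s - S.tmid (2 / 3) i|) / 2)
      • S.charDeriv i (S.charDeriv i u) s ((S.mesh i).flow (S.tmid (2 / 3) i) s x)
      = -(1 / 2) * ((S.dt i / 3 - |s - S.tmid (2 / 3) i|) *
        S.charDeriv i (S.charDeriv i u) s ((S.mesh i).flow (S.tmid (2 / 3) i) s x)) := fun s => by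
    rw [smul_eq_mul]; ring
  simp only [e3]
  rw [integral_const_mul, ← e]
  simp only [trap, MovingMesh.shift]
  ring

/-- Transport along the flow and averaging in time both preserve `H¹`, with the gradient acted on
accordingly, so the hat-kernel formula holds for the weak gradient too. Transport costs a factor
`2`. -/
theorem norm1Sq_sub_trap_le (hΩ : IsOpen Ω) [IsFiniteMeasure (volume.restrict Ω)]
    (hiso : S.HasDistortion i Λ) (hΛ1 : 1 ≤ Λ) (hΛ : (Λ : ℝ) ^ (d + 2) ≤ 2) {u : ℝ → Sp d → ℝ}
    (hu : S.HasSecondCharDeriv u) :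
    MemH1 Ω (fun x => u (S.tmid (2 / 3) i) x - S.trap (2 / 3) i u x) ∧
    S.dt i * norm1Sq Ω (fun x => u (S.tmid (2 / 3) i) x - S.trap (2 / 3) i u x)
      ≤ ∫ t in (S.left i)..(S.right i),
          norm1Sq Ω (fun x => S.dt i ^ 2 * S.charDeriv i (S.charDeriv i u) t x) := by
  obtain ⟨G, hz, hG, hzG⟩ := (hu i).2
  have hm := S.tmid_mem i
  have hdt := S.dt_pos i
  set z := S.charDeriv i (S.charDeriv i u) with hzdef
  set m := S.tmid (2 / 3) i with hmdef
  set J := Ioc (S.left i) (S.zeta (2 / 3) i) with hJ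
  have hJI : J ⊆ S.slab i := fun s hs => ⟨hs.1.le, hs.2.trans (S.zeta_mem i).2⟩
  set ν := (volume : Measure ℝ).restrict J with hν
  have hνI : ∀ᵐ s ∂ν, s ∈ S.slab i := by
    filter_upwards [ae_restrict_mem measurableSet_Ioc] with s hs using hJI hs
  have hvol : (volume.restrict (S.slab i ×ˢ Ω) : Measure (ℝ × Sp d))
      = (volume.restrict (S.slab i)).prod (volume.restrict Ω) := by
    rw [Measure.prod_restrict]; rfl
  rw [hvol] at hz hG
  have hle : ν.prod (volume.restrict Ω) ≤ (volume.restrict (S.slab i)).prod (volume.restrict Ω) := by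
    rw [Measure.prod_restrict, Measure.prod_restrict]
    exact Measure.restrict_mono (prod_mono hJI le_rfl) le_rfl
  have hzJ := hz.mono_measure hle
  have hGJ := hG.mono_measure hle
  have hzGJ : ∀ᵐ t ∂ν, IsWeakGrad Ω (z t) (G t) :=
    ae_mono (Measure.restrict_mono hJI le_rfl) hzG
  have hfinI : IsFiniteMeasure ((volume : Measure ℝ).restrict (S.slab i)) := by
    rw [slab]; infer_instance
  have slice : ∀ {ρ : Measure ℝ} [IsFiniteMeasure ρ],
      MemLp (Function.uncurry z) 2 (ρ.prod (volume.restrict Ω)) →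
      ∀ᵐ s ∂ρ, MemLp (z s) 2 (volume.restrict Ω) := fun {ρ} _ hρ => by
    filter_upwards [(integrable_norm_sq_of_memLp hρ).prod_right_ae, hρ.1.prodMk_left] with s h1 h2
    exact (memLp_two_iff_integrable_sq_norm h2).2 h1
  have hzs := slice hzJ
  have isoM : ∀ s ∈ S.slab i, IsMeshIso Ω Λ ((S.mesh i).flow m s) ((S.mesh i).flow s m)
    ((S.mesh i).core m) ((S.mesh i).core s) := fun s hs => hiso m hm s hs
  have hΛd : (Λ : ℝ) ^ d ≤ 2 := (pow_le_pow_right₀ (by exact_mod_cast hΛ1) (by omega)).trans hΛ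
  -- the transported functions
  obtain ⟨hA, hAle⟩ := memLp_of_slice_le (C := 2) hzJ
    (MovingMesh.aestronglyMeasurable_spaceTime_comp (S.tri hm) isoM hνI hzJ.1) (by
      filter_upwards [hzs, hνI] with s hs hsI
      refine ⟨(isoM s hsI).memLp_comp hs, ?_⟩
      have h1 := (isoM s hsI).norm0Sq_comp_le hs
      have h2 := norm0Sq_nonneg Ω (z s)
      simp only [norm0Sq, Function.uncurry, Real.norm_eq_abs, sq_abs] at h1 h2 ⊢
      nlinarith)
  obtain ⟨hB, hBle⟩ := memLp_of_slice_le (C := 2) hGJ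
    (MovingMesh.aestronglyMeasurable_spaceTime_pullGrad (S.tri hm) isoM hνI hGJ.1) (by
      filter_upwards [hzs, hνI, hzGJ] with s hs hsI hsG
      refine ⟨(isoM s hsI).memLp_pullGrad hsG.1, ?_⟩
      have h0 : MemH1 Ω (z s) := ⟨hs, _, hsG⟩
      have h1 := (isoM s hsI).semi1Sq_comp_le hΩ h0
      have h2 := semi1Sq_nonneg Ω (z s)
      rw [((isoM s hsI).isWeakGrad_comp hΩ hs hsG).semi1Sq_eq hΩ] at h1
      rw [hsG.semi1Sq_eq hΩ] at h1 h2
      simp only [Function.uncurry]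
      nlinarith)
  simp only [Function.uncurry] at hA hAle hBle
  have hkm : Measurable (fun s => -(S.dt i / 3 - |s - m|) / 2) := by fun_prop
  have hkR : ∀ᵐ s ∂ν, |-(S.dt i / 3 - |s - m|) / 2| ≤ S.dt i / 6 := by
    filter_upwards [ae_restrict_mem measurableSet_Ioc] with s hs
    have h1 : |s - m| ≤ S.dt i / 3 := by
      have := hs.1
      have := hs.2
      rw [zeta] at this
      rw [abs_le, hmdef, tmid]
      constructor <;> linarith
    rw [abs_le]
    constructor <;> linarith [abs_nonneg (s - m)]
  have hR : 0 ≤ S.dt i / 6 := by linarith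
  have hEq : (fun x => u m x - S.trap (2 / 3) i u x) =ᵐ[volume.restrict Ω]
      timeAverage ν (fun s => -(S.dt i / 3 - |s - m|) / 2)
        (fun p => z p.1 ((S.mesh i).flow m p.1 p.2)) := hu.sub_trap_eq hiso
  have hWG := isWeakGrad_timeAverage hkm hR hkR hA hB (by
    filter_upwards [hzs, hνI, hzGJ] with s hs hsI hsG
    exact (isoM s hsI).isWeakGrad_comp hΩ hs hsG)
  have hH1 : MemH1 Ω (fun x => u m x - S.trap (2 / 3) i u x) :=
    MemH1.congr ⟨memLp_timeAverage hkm hR hkR hA, _, hWG⟩ hEq.symm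
  refine ⟨hH1, ?_⟩
  have b0 := integral_norm_timeAverage_sq_le hkm hR hkR hA
  have b1 := integral_norm_timeAverage_sq_le hkm hR hkR hB
  have hνr : ν.real univ = 2 / 3 * S.dt i := by
    rw [hν, measureReal_restrict_apply_univ, hJ, Real.volume_real_Ioc_of_le, zeta]
    · ring
    · rw [zeta]; linarith
  have hN : norm1Sq Ω (fun x => u m x - S.trap (2 / 3) i u x)
      ≤ (S.dt i / 6) ^ 2 * (2 / 3 * S.dt i) * (2 * ((∫ s, (∫ y in Ω, ‖z s y‖ ^ 2) ∂ν)
        + ∫ s, (∫ y in Ω, ‖G s y‖ ^ 2) ∂ν)) := by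
    rw [norm1Sq_congr hEq, norm1Sq, hWG.semi1Sq_eq hΩ]
    rw [hνr] at b0 b1
    have c0 : norm0Sq Ω (timeAverage ν (fun s => -(S.dt i / 3 - |s - m|) / 2)
        fun p => z p.1 ((S.mesh i).flow m p.1 p.2)) = ∫ y in Ω,
        ‖timeAverage ν (fun s => -(S.dt i / 3 - |s - m|) / 2)
          (fun p => z p.1 ((S.mesh i).flow m p.1 p.2)) y‖ ^ 2 := by
      simp only [norm0Sq, Real.norm_eq_abs, sq_abs]
    rw [c0]
    have hp : 0 ≤ (S.dt i / 6) ^ 2 * (2 / 3 * S.dt i) := by positivity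
    have d0 := mul_le_mul_of_nonneg_left hAle hp
    have d1 := mul_le_mul_of_nonneg_left hBle hp
    linarith
  have mono : ∀ {E : Type} [NormedAddCommGroup E] (f : ℝ → Sp d → E),
      MemLp (Function.uncurry f) 2 ((volume.restrict (S.slab i)).prod (volume.restrict Ω)) →
      ∫ s, (∫ y in Ω, ‖f s y‖ ^ 2) ∂ν ≤ ∫ s in S.slab i, ∫ y in Ω, ‖f s y‖ ^ 2 := fun f hf =>
    setIntegral_mono_set (integrable_norm_sq_of_memLp hf).integral_prod_left
      (Eventually.of_forall fun s => integral_nonneg fun _ => sq_nonneg _)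
      (Eventually.of_forall hJI)
  have m0 := mono z hz
  have m1 := mono G hG
  have hfin : ∫ t in (S.left i)..(S.right i), norm1Sq Ω (fun x => S.dt i ^ 2 * z t x)
      = S.dt i ^ 4 * ((∫ s in S.slab i, ∫ y in Ω, ‖z s y‖ ^ 2)
        + ∫ s in S.slab i, ∫ y in Ω, ‖G s y‖ ^ 2) := by
    have hadd := integral_add (integrable_norm_sq_of_memLp hz).integral_prod_left
      (integrable_norm_sq_of_memLp hG).integral_prod_left
    simp only [Function.uncurry] at hadd
    rw [← hadd, ← integral_const_mul,
      intervalIntegral.integral_of_le (S.right_mem i).1, ← integral_Icc_eq_integral_Ioc]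
    apply integral_congr_ae
    filter_upwards [slice hz, hzG] with s hs hsG
    rw [norm1Sq_const_mul hΩ ⟨hs, _, hsG⟩, norm1Sq, hsG.semi1Sq_eq hΩ]
    simp only [norm0Sq, Real.norm_eq_abs, sq_abs]
    ring
  rw [hfin]
  have p0 : 0 ≤ ∫ s in S.slab i, ∫ y in Ω, ‖z s y‖ ^ 2 :=
    integral_nonneg fun s => integral_nonneg fun _ => sq_nonneg _
  have p1 : 0 ≤ ∫ s in S.slab i, ∫ y in Ω, ‖G s y‖ ^ 2 :=
    integral_nonneg fun s => integral_nonneg fun _ => sq_nonneg _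
  -- The kernel is at most `Δt/6` on an interval of length `2Δt/3`. With the transport factor `2`
  -- and one more `Δt` this makes `Δt⁴/27`, below the `Δt⁴` of the claim.
  calc _ ≤ S.dt i * ((S.dt i / 6) ^ 2 * (2 / 3 * S.dt i)
        * (2 * ((∫ s in S.slab i, ∫ y in Ω, ‖z s y‖ ^ 2)
        + ∫ s in S.slab i, ∫ y in Ω, ‖G s y‖ ^ 2))) := by
        gcongr
        refine hN.trans ?_
        gcongr
    _ = S.dt i ^ 4 * (1 / 27 * ((∫ s in S.slab i, ∫ y in Ω, ‖z s y‖ ^ 2)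
        + ∫ s in S.slab i, ∫ y in Ω, ‖G s y‖ ^ 2)) := by ring
    _ ≤ _ := by
        gcongr
        linarith

end SpaceTimeMesh

/-! ### The energy estimate for one time step -/

theorem sqrt_mul_sqrt_le {p q ε : ℝ} (hp : 0 ≤ p) (hq : 0 ≤ q) (hε : 0 < ε) :
    √p * √q ≤ ε * p + q / (4 * ε) := by
  have h1 := sq_nonneg (2 * ε * √p - √q)
  have h2 := Real.sq_sqrt hp
  have h3 := Real.sq_sqrt hq
  have h4 : ε * p + q / (4 * ε) - √p * √q = (2 * ε * √p - √q) ^ 2 / (4 * ε) := by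
    nth_rw 1 [← h2]
    nth_rw 1 [← h3]
    field_simp
    ring
  have : 0 ≤ (2 * ε * √p - √q) ^ 2 / (4 * ε) := by positivity
  linarith

theorem mul_sqrt_le {D q ε : ℝ} (hq : 0 ≤ q) (hε : 0 < ε) :
    D * √q ≤ ε * q + D ^ 2 / (4 * ε) := by
  have h1 := sqrt_mul_sqrt_le hq (sq_nonneg D) hε
  have h2 : D * √q ≤ √q * √(D ^ 2) := by
    rw [Real.sqrt_sq_eq_abs, mul_comm]
    gcongr
    exact le_abs_self D
  linarith

/-- The right-hand side equals `‖Z2‖² - ‖Z0‖² + ‖P‖² + ‖W‖²/4 - (W, P)/4`: with weight `5/4` the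
total coefficient of `(W, M)` is `5/4 + 1 - 5/4 - 1/4 + 1/4 = 1`, up to the regrouping of `Z2 = M +
P`, and `(W, M) = ‖M‖² + ‖W‖²/4 - ‖Z0‖²` telescopes against `2 (P, Z2) = ‖Z2‖² - ‖M‖² + ‖P‖²`. The
surplus over the left side is `‖P - W/4‖²/2 + 3‖W‖²/32`. -/
theorem ip_stage_identity {Z0 Z1 Z2 M W P V : Sp d → ℝ}
    (h0 : MemLp Z0 2 (volume.restrict Ω)) (h1 : MemLp Z1 2 (volume.restrict Ω))
    (h2 : MemLp Z2 2 (volume.restrict Ω))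
    (hM : M = fun x => (Z0 x + Z1 x) / 2) (hW : W = fun x => Z1 x - Z0 x)
    (hP : P = fun x => Z2 x - M x) (hV : V = fun x => 5 / 4 * M x + Z2 x) :
    norm0Sq Ω Z2 - norm0Sq Ω Z0 + 1 / 2 * norm0Sq Ω P + 1 / 8 * norm0Sq Ω W
      ≤ ip Ω W V + 1 / 4 * ip Ω (fun x => 8 * P x - 5 * W x) Z2 := by
  have hMm : MemLp M 2 (volume.restrict Ω) := by
    rw [hM]; simpa [div_eq_inv_mul] using (h0.add h1).const_mul (2⁻¹ : ℝ)
  have hWm : MemLp W 2 (volume.restrict Ω) := by rw [hW]; exact h1.sub h0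
  have hPm : MemLp P 2 (volume.restrict Ω) := by rw [hP]; exact h2.sub hMm
  have hVm : MemLp V 2 (volume.restrict Ω) := by rw [hV]; exact (hMm.const_mul _).add h2
  have hQm : MemLp (fun x => 8 * P x - 5 * W x) 2 (volume.restrict Ω) :=
    (hPm.const_mul _).sub (hWm.const_mul _)
  have i0 := integrable_sq_of_memLp h0
  have i2 := integrable_sq_of_memLp h2
  have iP := integrable_sq_of_memLp hPm
  have iW := integrable_sq_of_memLp hWm
  have j1 := integrable_mul_of_memLp hWm hVm
  have j2 := integrable_mul_of_memLp hQm h2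
  have q1 : Integrable (fun x => Z2 x ^ 2 - Z0 x ^ 2) (volume.restrict Ω) := i2.sub i0
  have q2 : Integrable (fun x => Z2 x ^ 2 - Z0 x ^ 2 + 1 / 2 * P x ^ 2) (volume.restrict Ω) :=
    q1.add (iP.const_mul _)
  simp only [norm0Sq, ip]
  rw [← integral_sub i2 i0, ← integral_const_mul, ← integral_const_mul,
    ← integral_add q1 (iP.const_mul _), ← integral_add q2 (iW.const_mul _),
    ← integral_const_mul, ← integral_add j1 (j2.const_mul _)]
  refine integral_mono (q2.add (iW.const_mul _)) (j1.add (j2.const_mul _)) fun x => ?_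
  simp only [hV, hP, hM, hW]
  nlinarith [sq_nonneg (Z2 x - (Z0 x + Z1 x) / 2 - (Z1 x - Z0 x) / 4), sq_nonneg (Z1 x - Z0 x)]

/-- The growth constant of one time step. -/
def growthConst (a₀ κ B c₀ : ℝ) : ℝ := 2 * c₀ + 45 * (κ ^ 2 / a₀) + 4 * B + a₀

theorem growthConst_pos {a₀ κ B c₀ : ℝ} (ha : 0 < a₀) (hB : 0 ≤ B) (hc : 0 ≤ c₀) :
    0 < growthConst a₀ κ B c₀ := by
  rw [growthConst]; positivity

/-- The bookkeeping of the energy estimate in real numbers: `n` stands for squared `L²` norms, `s`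
for squared semi-norms, `E₁` and `E₂` for the transport errors of the `L²` product and of the
diffusion form, `L₁` and `L₂` for lower order terms, `Φ₁` and `Φ₂` for the data. -/
theorem one_step_arith {n0 n2 nP nW nM nV sM s2 k c₀ a₀ κ B D₁ D₂ R L₁ L₂ E₁ E₂ Φ₁ Φ₂ : ℝ}
    (ha : 0 < a₀) (hκ : 0 ≤ κ) (hB : 0 ≤ B) (hc : 0 ≤ c₀) (hk : 0 < k)
    (hkK : growthConst a₀ κ B c₀ * k ≤ 1 / 8)
    (h2 : 0 ≤ n2) (hP : 0 ≤ nP) (hW : 0 ≤ nW) (hM : 0 ≤ nM) (hsM : 0 ≤ sM) (hs2 : 0 ≤ s2)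
    (hnM : nM ≤ 2 * n2 + 2 * nP) (hnV : nV ≤ 4 * (nM + n2))
    (hE₁ : |E₁| ≤ c₀ * k * ((nW + nV) / 2))
    (hE₂ : |E₂| ≤ a₀ / 48 * ((sM + 4 * (sM + s2)) / 2))
    (hL₁ : |L₁| ≤ κ * (√(2 * sM) * √(8 * (nM + n2))) + B * (4 * (nM + n2)))
    (hL₂ : |L₂| ≤ κ * (√s2 * √n2) + B * n2)
    (hΦ₁ : |Φ₁| ≤ D₁ * √(8 * (nM + n2 + (sM + s2))))
    (hΦ₂ : |Φ₂| ≤ D₂ * √(n2 + s2))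
    (hR : n2 - n0 + 1 / 2 * nP + 1 / 8 * nW + k * (a₀ / 6 * (sM + s2)) ≤ R)
    (hid : R = 2 * k / 3 * Φ₁ + k / 2 * Φ₂ - E₁ - 2 * k / 3 * (E₂ + L₁) - k / 2 * L₂) :
    n2 + 1 / 4 * nP + 1 / 16 * nW + a₀ / 24 * k * (sM + s2)
      ≤ (1 + 6 * growthConst a₀ κ B c₀ * k) * n0 + 100 / a₀ * k * (D₁ ^ 2 + D₂ ^ 2) := by
  set K := growthConst a₀ κ B c₀ with hK
  have hKpos : 0 < K := growthConst_pos ha hB hc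
  have hq : κ * (√(2 * sM) * √(8 * (nM + n2))) = 4 * (κ * (√sM * √(nM + n2))) := by
    have h1 : √(2 * sM) * √(8 * (nM + n2)) = 4 * (√sM * √(nM + n2)) := by
      rw [← Real.sqrt_mul (by positivity), ← Real.sqrt_mul hsM,
        show 2 * sM * (8 * (nM + n2)) = 4 ^ 2 * (sM * (nM + n2)) by ring,
        Real.sqrt_mul (by positivity), Real.sqrt_sq (by norm_num)]
    rw [h1]; ring
  -- the lower order terms
  have y1 : 8 / 3 * (κ * (√sM * √(nM + n2))) ≤ a₀ / 24 * sM + 128 / 3 * (κ ^ 2 / a₀) * (nM + n2) := by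
    have h := sqrt_mul_sqrt_le (p := sM) (q := (8 / 3 * κ) ^ 2 * (nM + n2)) (ε := a₀ / 24) hsM
      (by positivity) (by positivity)
    rw [Real.sqrt_mul (by positivity), Real.sqrt_sq (by positivity)] at h
    have e : (8 / 3 * κ) ^ 2 * (nM + n2) / (4 * (a₀ / 24))
      = 128 / 3 * (κ ^ 2 / a₀) * (nM + n2) := by field_simp; ring
    rw [e] at h
    linarith
  have y2 : 1 / 2 * (κ * (√s2 * √n2)) ≤ a₀ / 24 * s2 + 3 / 2 * (κ ^ 2 / a₀) * n2 := by
    have h := sqrt_mul_sqrt_le (p := s2) (q := (1 / 2 * κ) ^ 2 * n2) (ε := a₀ / 24) hs2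
      (by positivity) (by positivity)
    rw [Real.sqrt_mul (by positivity), Real.sqrt_sq (by positivity)] at h
    have e : (1 / 2 * κ) ^ 2 * n2 / (4 * (a₀ / 24)) = 3 / 2 * (κ ^ 2 / a₀) * n2 := by
      field_simp; ring
    rw [e] at h
    linarith
  have y3 : 2 / 3 * (D₁ * √(8 * (nM + n2 + (sM + s2))))
      ≤ a₀ / 48 * (nM + n2 + (sM + s2)) + 128 / 3 / a₀ * D₁ ^ 2 := by
    have h := mul_sqrt_le (D := 2 / 3 * D₁) (q := 8 * (nM + n2 + (sM + s2))) (ε := a₀ / 384)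
      (by positivity) (by positivity)
    have e : (2 / 3 * D₁) ^ 2 / (4 * (a₀ / 384)) = 128 / 3 / a₀ * D₁ ^ 2 := by field_simp; ring
    rw [e] at h
    linarith
  have y4 : 1 / 2 * (D₂ * √(n2 + s2)) ≤ a₀ / 48 * (n2 + s2) + 3 / a₀ * D₂ ^ 2 := by
    have h := mul_sqrt_le (D := 1 / 2 * D₂) (q := n2 + s2) (ε := a₀ / 48)
      (by positivity) (by positivity)
    have e : (1 / 2 * D₂) ^ 2 / (4 * (a₀ / 48)) = 3 / a₀ * D₂ ^ 2 := by field_simp; ring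
    rw [e] at h
    linarith
  have hD : 128 / 3 / a₀ * D₁ ^ 2 + 3 / a₀ * D₂ ^ 2 ≤ 43 / a₀ * (D₁ ^ 2 + D₂ ^ 2) := by
    have e1 : 128 / 3 / a₀ * D₁ ^ 2 ≤ 43 / a₀ * D₁ ^ 2 := by gcongr; norm_num
    have e2 : 3 / a₀ * D₂ ^ 2 ≤ 43 / a₀ * D₂ ^ 2 := by gcongr; norm_num
    linarith
  have hκa : 0 ≤ κ ^ 2 / a₀ := by positivity
  rw [hq] at hL₁
  -- everything but the factor `k`
  have main : 2 / 3 * Φ₁ + 1 / 2 * Φ₂ - 2 / 3 * (E₂ + L₁) - 1 / 2 * L₂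
      ≤ a₀ / 8 * (sM + s2) + (K - 2 * c₀) * (nM + n2) + 43 / a₀ * (D₁ ^ 2 + D₂ ^ 2) := by
    have b1 := (le_abs_self Φ₁).trans hΦ₁
    have b2 := (le_abs_self Φ₂).trans hΦ₂
    have b3 := (neg_le_abs E₂).trans hE₂
    have b4 := (neg_le_abs L₁).trans hL₁
    have b5 := (neg_le_abs L₂).trans hL₂
    have b6 : (K - 2 * c₀) * (nM + n2)
      = 45 * ((κ ^ 2 / a₀) * (nM + n2)) + 4 * (B * (nM + n2)) + a₀ * (nM + n2) := by
      rw [hK, growthConst]; ring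
    have p1 : 0 ≤ (κ ^ 2 / a₀) * nM := by positivity
    have p2 : 0 ≤ (κ ^ 2 / a₀) * n2 := by positivity
    have p3 : 0 ≤ B * nM := by positivity
    have p4 : 0 ≤ B * n2 := by positivity
    have p5 : 0 ≤ a₀ * nM := by positivity
    have p6 : 0 ≤ a₀ * n2 := by positivity
    have p7 : 0 ≤ a₀ * sM := by positivity
    have p8 : 0 ≤ a₀ * s2 := by positivity
    rw [b6]
    linarith
  have hE : -E₁ ≤ 1 / 16 * nW + k * (2 * c₀ * (nM + n2)) := by
    have b1 := (neg_le_abs E₁).trans hE₁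
    have b2 : c₀ * k ≤ 1 / 16 := by
      have : 0 ≤ (45 * (κ ^ 2 / a₀) + 4 * B + a₀) * k := by positivity
      have e : K * k = 2 * (c₀ * k) + (45 * (κ ^ 2 / a₀) + 4 * B + a₀) * k := by
        rw [hK, growthConst]; ring
      linarith
    have b3 : c₀ * k * nW ≤ 1 / 16 * nW := by gcongr
    have b4 : c₀ * k * nV ≤ c₀ * k * (4 * (nM + n2)) := by gcongr
    linarith
  have hkm := mul_le_mul_of_nonneg_left main hk.le
  -- The norm of `M` is not controlled by itself; `M = Z2 - P` trades it for `Z2` and for the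
  -- damping term in `P`, of which half is used up.
  have hN : k * (K * (nM + n2)) ≤ 3 * (K * k) * n2 + 1 / 4 * nP := by
    have b1 : K * k * (nM + n2) ≤ K * k * (3 * n2 + 2 * nP) :=
      mul_le_mul_of_nonneg_left (by linarith) (by positivity)
    have b2 : K * k * nP ≤ 1 / 8 * nP := by gcongr
    linarith
  have tot : (1 - 3 * (K * k)) * n2 + (1 / 4 * nP + 1 / 16 * nW + a₀ / 24 * k * (sM + s2))
      ≤ n0 + k * (43 / a₀ * (D₁ ^ 2 + D₂ ^ 2)) := by
    linarith
  have hx : 0 ≤ K * k := by positivity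
  have hX : 0 ≤ 1 / 4 * nP + 1 / 16 * nW + a₀ / 24 * k * (sM + s2) := by positivity
  -- Multiplication by `1 + 6Kk` removes the factor `1 - 3Kk` in front of `n2`, since `(1 + 6x)(1 -
  -- 3x) = 1 + 3x(1 - 6x) ≥ 1` for `0 ≤ x ≤ 1/8`.
  have hmul := mul_le_mul_of_nonneg_left tot (show 0 ≤ 1 + 6 * (K * k) by positivity)
  have g1 : n2 ≤ (1 + 6 * (K * k)) * ((1 - 3 * (K * k)) * n2) := by
    have : 0 ≤ (3 * (K * k) * (1 - 6 * (K * k))) * n2 :=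
      mul_nonneg (mul_nonneg (by positivity) (by linarith)) h2
    linarith
  have g2 := mul_nonneg hx hX
  have hDn : 0 ≤ k * (43 / a₀ * (D₁ ^ 2 + D₂ ^ 2)) := by positivity
  have g3 : (1 + 6 * (K * k)) * (k * (43 / a₀ * (D₁ ^ 2 + D₂ ^ 2)))
      ≤ 100 / a₀ * k * (D₁ ^ 2 + D₂ ^ 2) := by
    have b1 : (1 + 6 * (K * k)) * (k * (43 / a₀ * (D₁ ^ 2 + D₂ ^ 2)))
      ≤ 2 * (k * (43 / a₀ * (D₁ ^ 2 + D₂ ^ 2))) := by gcongr; linarith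
    have b2 : 100 / a₀ * k * (D₁ ^ 2 + D₂ ^ 2)
      = 100 / 43 * (k * (43 / a₀ * (D₁ ^ 2 + D₂ ^ 2))) := by ring
    linarith
  linarith

theorem norm0Sq_half_sum_add {M Z2 : Sp d → ℝ} (hM : MemLp M 2 (volume.restrict Ω))
    (h2 : MemLp Z2 2 (volume.restrict Ω)) :
    norm0Sq Ω (fun x => 5 / 4 * M x + Z2 x) ≤ 4 * (norm0Sq Ω M + norm0Sq Ω Z2) := by
  have h := norm0Sq_add_le (hM.const_mul (5 / 4)) h2
  rw [norm0Sq_const_mul] at h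
  linarith [norm0Sq_nonneg Ω M, norm0Sq_nonneg Ω Z2]

theorem semi1Sq_half_sum_add (hΩ : IsOpen Ω) [IsFiniteMeasure (volume.restrict Ω)]
    {M Z2 : Sp d → ℝ} (hM : MemH1 Ω M) (h2 : MemH1 Ω Z2) :
    semi1Sq Ω (fun x => 5 / 4 * M x + Z2 x) ≤ 4 * (semi1Sq Ω M + semi1Sq Ω Z2) := by
  have h := semi1Sq_add_le hΩ (hM.const_mul (5 / 4)) h2
  rw [semi1Sq_const_mul hΩ hM] at h
  linarith [semi1Sq_nonneg Ω M, semi1Sq_nonneg Ω Z2]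

/-- The energy estimate for one time step; `F` transports the mesh of the first stage to that of the
second stage, and the equations of the two stages are tested with `5/4 M + Z2` and `Z2`. -/
theorem one_step_energy_le (hΩ : IsOpen Ω) [IsFiniteMeasure (volume.restrict Ω)] {Λ : ℝ≥0}
    {F F' : Sp d → Sp d} {U U' : Set (Sp d)} (h : IsMeshIso Ω Λ F F' U U') (hΛ1 : 1 ≤ Λ)
    {A κ B a₀ η k c₀ D₁ D₂ Φ₁ Φ₂ : ℝ} (ha : 0 < a₀) (hκ : 0 ≤ κ) (hB : 0 ≤ B)
    (hc : 0 ≤ c₀) (hk : 0 < k) (hkK : growthConst a₀ κ B c₀ * k ≤ 1 / 8)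
    (hΛ2 : (Λ : ℝ) ^ (d + 2) ≤ 2) (hΛk : (Λ : ℝ) ^ d - 1 ≤ c₀ * k)
    (hε : A * ((Λ : ℝ) ^ (d + 2) - 1) + η ≤ a₀ / 48)
    {α₁ α₂ γ₁ γ₂ : Sp d → ℝ} {β₁ β₂ : Sp d → Sp d}
    (C₁ : CoeffBounds Ω A κ B α₁ β₁ γ₁) (C₂ : CoeffBounds Ω A κ B α₂ β₂ γ₂)
    (ha₂ : ∀ x ∈ Ω, a₀ ≤ α₂ x) (hη : ∀ x ∈ Ω, |α₁ x - α₂ (F x)| ≤ η)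
    {Z0 Z1 Z2 M W P V : Sp d → ℝ} (h0 : MemH1 Ω Z0) (h1 : MemH1 Ω Z1) (h2 : MemH1 Ω Z2)
    (hM : M = fun x => (Z0 x + Z1 x) / 2) (hW : W = fun x => Z1 x - Z0 x)
    (hP : P = fun x => Z2 x - M x) (hV : V = fun x => 5 / 4 * M x + Z2 x)
    (e₁ : ip Ω (fun x => W (F x)) (fun x => V (F x))
      + 2 * k / 3 * gform Ω α₁ β₁ γ₁ (fun x => M (F x)) (fun x => V (F x)) = 2 * k / 3 * Φ₁)
    (b₁ : |Φ₁| ≤ D₁ * √(norm1Sq Ω fun x => V (F x)))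
    (e₂ : ip Ω (fun x => 8 * P x - 5 * W x) Z2 + 2 * k * gform Ω α₂ β₂ γ₂ Z2 Z2 = 2 * k * Φ₂)
    (b₂ : |Φ₂| ≤ D₂ * √(norm1Sq Ω Z2)) (hD₁ : 0 ≤ D₁) :
    norm0Sq Ω Z2 + 1 / 4 * norm0Sq Ω P + 1 / 16 * norm0Sq Ω W
        + a₀ / 24 * k * (semi1Sq Ω M + semi1Sq Ω Z2)
      ≤ (1 + 6 * growthConst a₀ κ B c₀ * k) * norm0Sq Ω Z0
        + 100 / a₀ * k * (D₁ ^ 2 + D₂ ^ 2) := by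
  have hMm : MemH1 Ω M := by
    rw [hM]; simpa [div_eq_inv_mul] using (h0.add h1).const_mul (2⁻¹ : ℝ)
  have hWm : MemH1 Ω W := by rw [hW]; exact h1.sub h0
  have hPm : MemH1 Ω P := by rw [hP]; exact h2.sub hMm
  have hVm : MemH1 Ω V := by rw [hV]; exact (hMm.const_mul _).add h2
  have hMF := h.memH1_comp hΩ hMm
  have hVF := h.memH1_comp hΩ hVm
  have hΛ1' : (1 : ℝ) ≤ Λ := by exact_mod_cast hΛ1
  have hΛd : (Λ : ℝ) ^ d ≤ 2 := (pow_le_pow_right₀ hΛ1' (by omega)).trans hΛ2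
  have nV : norm0Sq Ω V ≤ 4 * (norm0Sq Ω M + norm0Sq Ω Z2) := by
    rw [hV]; exact norm0Sq_half_sum_add hMm.1 h2.1
  have sV : semi1Sq Ω V ≤ 4 * (semi1Sq Ω M + semi1Sq Ω Z2) := by
    rw [hV]; exact semi1Sq_half_sum_add hΩ hMm h2
  have comp0 : ∀ {X}, MemH1 Ω X → norm0Sq Ω (fun x => X (F x)) ≤ 2 * norm0Sq Ω X := fun {X} hX =>
    (h.norm0Sq_comp_le hX.1).trans (mul_le_mul_of_nonneg_right hΛd (norm0Sq_nonneg _ _))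
  have comp1 : ∀ {X}, MemH1 Ω X → semi1Sq Ω (fun x => X (F x)) ≤ 2 * semi1Sq Ω X := fun {X} hX =>
    (h.semi1Sq_comp_le hΩ hX).trans (mul_le_mul_of_nonneg_right hΛ2 (semi1Sq_nonneg _ _))
  have hD := h.abs_weighted_comp_sub_le hΩ hΛ1 hMm hVm C₁.mα C₂.mα C₁.bα C₂.bα hη
  have nM0 := norm0Sq_nonneg Ω M
  have n20 := norm0Sq_nonneg Ω Z2
  have sM0 := semi1Sq_nonneg Ω M
  have s20 := semi1Sq_nonneg Ω Z2
  have l₁ := C₁.abs_lower_le hΩ hκ hB hMF hVF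
  have l₂ := C₂.abs_lower_le hΩ hκ hB h2 h2
  have hDV : diffForm Ω α₂ M V = 5 / 4 * diffForm Ω α₂ M M + diffForm Ω α₂ M Z2 := by
    rw [hV, C₂.diffForm_add_right hΩ hMm (hMm.const_mul _) h2,
      CoeffBounds.diffForm_const_mul_right hΩ hMm]
  have d1 := C₂.diffForm_self_ge hΩ ha₂ hMm
  have d2 := C₂.diffForm_self_ge hΩ ha₂ h2
  have d3 := (abs_le.1 (C₂.abs_diffForm_le_half hΩ (fun x hx => ha.le.trans (ha₂ x hx)) hMm h2)).1
  have hst := ip_stage_identity (Ω := Ω) h0.1 h1.1 h2.1 hM hW hP hV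
  refine one_step_arith (nV := norm0Sq Ω V) (nM := norm0Sq Ω M) (D₁ := D₁) (D₂ := D₂)
    (E₁ := ip Ω (fun x => W (F x)) (fun x => V (F x)) - ip Ω W V)
    (E₂ := diffForm Ω α₁ (fun x => M (F x)) (fun x => V (F x)) - diffForm Ω α₂ M V)
    (L₁ := gform Ω α₁ β₁ γ₁ (fun x => M (F x)) (fun x => V (F x))
      - diffForm Ω α₁ (fun x => M (F x)) (fun x => V (F x)))
    (L₂ := gform Ω α₂ β₂ γ₂ Z2 Z2 - diffForm Ω α₂ Z2 Z2) (Φ₁ := Φ₁) (Φ₂ := Φ₂)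
    ha hκ hB hc hk hkK n20 (norm0Sq_nonneg _ _) (norm0Sq_nonneg _ _) nM0 sM0 s20 ?_ nV ?_ ?_ ?_ ?_
    ?_ ?_ (R := ip Ω W V + 1 / 4 * ip Ω (fun x => 8 * P x - 5 * W x) Z2
      + (2 * k / 3 * diffForm Ω α₂ M V + k / 2 * diffForm Ω α₂ Z2 Z2)) ?_ ?_
  · have e : M = fun x => Z2 x - P x := by rw [hP]; simp
    rw [e]
    exact norm0Sq_sub_le h2.1 hPm.1
  · refine (h.abs_ip_comp_sub_le hWm.1 hVm.1).trans (mul_le_mul_of_nonneg_right hΛk ?_)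
    have := norm0Sq_nonneg Ω W
    have := norm0Sq_nonneg Ω V
    positivity
  · refine hD.trans ?_
    refine mul_le_mul hε (by linarith) ?_ (by positivity)
    have := semi1Sq_nonneg Ω V
    positivity
  · refine l₁.trans (add_le_add ?_ ?_)
    · have := comp1 hMm
      have : norm0Sq Ω (fun x => V (F x)) ≤ 8 * (norm0Sq Ω M + norm0Sq Ω Z2) := by
        linarith [comp0 hVm]
      gcongr
    · refine mul_le_mul_of_nonneg_left ?_ hB
      have c1 := comp0 hMm
      have c2 := comp0 hVm
      rw [← Real.sqrt_mul (norm0Sq_nonneg _ _)]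
      refine Real.sqrt_le_iff.2 ⟨by positivity, ?_⟩
      calc _ ≤ (2 * norm0Sq Ω M) * (8 * (norm0Sq Ω M + norm0Sq Ω Z2)) :=
            mul_le_mul c1 (by linarith) (norm0Sq_nonneg _ _) (by positivity)
        _ ≤ _ := by nlinarith [mul_nonneg nM0 n20]
  · have e : √(norm0Sq Ω Z2) * √(norm0Sq Ω Z2) = norm0Sq Ω Z2 := Real.mul_self_sqrt n20
    rw [e] at l₂
    exact l₂
  · refine b₁.trans ?_
    gcongr
    rw [norm1Sq]
    linarith [comp0 hVm, comp1 hVm]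
  · exact b₂
  · rw [hDV]
    -- Bounding the mixed term `diffForm M Z2` by half the sum of the two energies leaves `1/2` of
    -- that of `M` and `1/6` of that of `Z2`, because `5/6 - 1/3 = 1/2` and `1/2 - 1/3 = 1/6`.
    have q1 : k * (a₀ / 6 * (semi1Sq Ω M + semi1Sq Ω Z2))
      ≤ k * (2 / 3 * (5 / 4 * diffForm Ω α₂ M M + diffForm Ω α₂ M Z2)
        + 1 / 2 * diffForm Ω α₂ Z2 Z2) := by
      gcongr
      have := mul_nonneg ha.le sM0
      linarith
    linarith
  · linarith

/-! ### Finite element functions on one time partition -/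

namespace MovingMesh

variable {M : MovingMesh d}

theorem sliceSpace_congr {t : ℝ} {φ ψ : Sp d → ℝ}
    (hφ : φ ∈ M.sliceSpace t) (hb : ∀ x ∈ M.body t, φ x = ψ x) : ψ ∈ M.sliceSpace t := by
  intro e he
  obtain ⟨P, hP, hP'⟩ := hφ e he
  refine ⟨P, hP, fun y hy => ?_⟩
  rw [← hP' y hy, hb]
  refine mem_body.2 ⟨e, he, ?_⟩
  rw [cell_eq_image]
  exact mem_image_of_mem _ hy

theorem IsTriangulation.ae_mem_body {t : ℝ} (h : M.IsTriangulation Ω t) :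
    ∀ᵐ x ∂(volume.restrict Ω), x ∈ M.body t := by
  filter_upwards [h.ae_mem_core] with x hx using h.subset_body (h.core_subset hx)

theorem IsTriangulation.shift_flow {t s : ℝ} (h : M.IsTriangulation Ω t)
    (h' : M.IsTriangulation Ω s) (w : ℝ → Sp d → ℝ) (r : ℝ) {x : Sp d} (hx : x ∈ M.body t) :
    M.shift w r s (M.flow t s x) = M.shift w r t x := by
  rw [shift, shift, h.flow_flow h' r hx]

theorem IsTriangulation.shift_self {t : ℝ} (h : M.IsTriangulation Ω t) (w : ℝ → Sp d → ℝ)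
    {x : Sp d} (hx : x ∈ M.body t) : M.shift w t t x = w t x := by
  rw [shift, h.flow_self hx]

end MovingMesh

theorem gform_congr {α : Sp d → ℝ} {β : Sp d → Sp d} {γ : Sp d → ℝ} {v v' χ χ' : Sp d → ℝ}
    (hv : v =ᵐ[volume.restrict Ω] v') (hχ : χ =ᵐ[volume.restrict Ω] χ') :
    gform Ω α β γ v χ = gform Ω α β γ v' χ' := by
  rw [gform, gform, wgrad_congr hv, wgrad_congr hχ]
  apply integral_congr_ae
  filter_upwards [hv, hχ] with x h1 h2
  rw [h1, h2]

namespace SpaceTimeMesh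

variable {T : ℝ} {S : SpaceTimeMesh d Ω T} {i : Fin (S.N + 1)} {Λ : ℝ≥0}

/-- Differentiability along almost every characteristic. -/
def DiffAlong (S : SpaceTimeMesh d Ω T) (i : Fin (S.N + 1)) (w : ℝ → Sp d → ℝ) (t : ℝ) : Prop :=
  ∀ᵐ x ∂(volume.restrict Ω),
    DifferentiableWithinAt ℝ (fun s => w s ((S.mesh i).flow t s x)) (S.slab i) t

theorem uniqueDiffWithinAt_slab {t : ℝ} (ht : t ∈ S.slab i) :
    UniqueDiffWithinAt ℝ (S.slab i) t :=
  uniqueDiffOn_Icc (sub_pos.1 (S.dt_pos i)) t ht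

/-- The same curves, relabelled by their position at time `t` instead of at the start of the step.
-/
theorem HasSecondCharDeriv.diffAlong (hiso : S.HasDistortion i Λ) {u : ℝ → Sp d → ℝ}
    (hu : S.HasSecondCharDeriv u) {t : ℝ} (ht : t ∈ S.slab i) : S.DiffAlong i u t := by
  have hl := S.left_mem i
  filter_upwards [(hiso _ ht _ hl).ae_comp (hu i).1, (S.tri ht).ae_mem_body] with x hx hxb
  have hγ : ∀ s, (S.mesh i).flow (S.left i) s ((S.mesh i).flow t (S.left i) x)
      = (S.mesh i).flow t s x := fun s => (S.tri ht).flow_flow (S.tri hl) s hxb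
  simp only [hγ] at hx
  exact hx.1 t ht

theorem charDeriv_sub {w w' : ℝ → Sp d → ℝ} {t : ℝ} (hw : S.DiffAlong i w t)
    (hw' : S.DiffAlong i w' t) :
    S.charDeriv i (fun s x => w s x - w' s x) t =ᵐ[volume.restrict Ω]
      fun x => S.charDeriv i w t x - S.charDeriv i w' t x := by
  filter_upwards [hw, hw'] with x h1 h2
  exact derivWithin_fun_sub h1 h2

section fe

variable {z : ℝ → Sp d → ℝ}

theorem hasDerivWithinAt_fe (hz : (S.mesh i).IsFEFunction (S.slab i) z) {t : ℝ}
    (ht : t ∈ S.slab i) {x : Sp d} (hx : x ∈ (S.mesh i).body t) :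
    ∃ c₀ c₁ c₂ : ℝ, (∀ s ∈ S.slab i, z s ((S.mesh i).flow t s x) = c₀ + c₁ * s + c₂ * s ^ 2) ∧
      HasDerivWithinAt (fun s => z s ((S.mesh i).flow t s x)) (c₁ + 2 * c₂ * t) (S.slab i) t := by
  obtain ⟨c₀, c₁, c₂, h⟩ := hz.exists_quadratic (S.tri ht) hx
  refine ⟨c₀, c₁, c₂, h, ?_⟩
  have h1 : HasDerivAt (fun s : ℝ => c₀ + c₁ * s + c₂ * s ^ 2) (c₁ + 2 * c₂ * t) t := by
    have := (((hasDerivAt_id' t).const_mul c₁).const_add c₀).fun_add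
      ((hasDerivAt_pow 2 t).const_mul c₂)
    exact this.congr_deriv (by norm_num; ring)
  exact h1.hasDerivWithinAt.congr h (h t ht)

theorem diffAlong_fe (hz : (S.mesh i).IsFEFunction (S.slab i) z) {t : ℝ} (ht : t ∈ S.slab i) :
    S.DiffAlong i z t := by
  filter_upwards [(S.tri ht).ae_mem_body] with x hx
  obtain ⟨_, _, _, -, h⟩ := hasDerivWithinAt_fe hz ht hx
  exact h.differentiableWithinAt

/-- The mid-step node is the midpoint of the first two basis nodes, and the central difference is
exact for quadratics. -/
theorem charDeriv_tmid_fe (hz : (S.mesh i).IsFEFunction (S.slab i) z) {x : Sp d}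
    (hx : x ∈ (S.mesh i).body (S.tmid (2 / 3) i)) :
    S.charDeriv i z (S.tmid (2 / 3) i) x
      = ((S.mesh i).shift z (S.zeta (2 / 3) i) (S.tmid (2 / 3) i) x
        - (S.mesh i).shift z (S.left i) (S.tmid (2 / 3) i) x) / (2 / 3 * S.dt i) := by
  obtain ⟨c₀, c₁, c₂, h, hd⟩ := hasDerivWithinAt_fe hz (S.tmid_mem i) hx
  have := (S.dt_pos i).ne'
  rw [charDeriv, hd.derivWithin (uniqueDiffWithinAt_slab (S.tmid_mem i)), MovingMesh.shift,
    MovingMesh.shift, h _ (S.zeta_mem i), h _ (S.left_mem i), zeta, tmid]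
  field_simp
  ring

/-- The variable-step second-order backward difference is exact for quadratics, so the second stage
is collocation at the end of the step. -/
theorem charDeriv_right_fe (hz : (S.mesh i).IsFEFunction (S.slab i) z) {x : Sp d}
    (hx : x ∈ (S.mesh i).body (S.right i)) :
    S.charDeriv i z (S.right i) x
      = (2 / 3 * (2 - 2 / 3) * z (S.right i) x
        - (S.mesh i).shift z (S.zeta (2 / 3) i) (S.right i) x
        + (1 - 2 / 3) ^ 2 * (S.mesh i).shift z (S.left i) (S.right i) x)
          / (2 / 3 * (1 - 2 / 3) * S.dt i) := by
  obtain ⟨c₀, c₁, c₂, h, hd⟩ := hasDerivWithinAt_fe hz (S.right_mem i) hx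
  have := (S.dt_pos i).ne'
  have h2 := h _ (S.right_mem i)
  rw [(S.tri (S.right_mem i)).flow_self hx] at h2
  rw [charDeriv, hd.derivWithin (uniqueDiffWithinAt_slab (S.right_mem i)), MovingMesh.shift,
    MovingMesh.shift, h _ (S.zeta_mem i), h _ (S.left_mem i), h2, zeta, right_eq]
  field_simp
  ring

/-- Lagrange interpolation at relative times `0`, `2/3`, `1`, evaluated at `1/3`. It expresses the
mid-step value, which enters the maximum in the energy semi-norm, through the basis values used by
the energy argument. -/
theorem tmid_fe (hz : (S.mesh i).IsFEFunction (S.slab i) z) {x : Sp d}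
    (hx : x ∈ (S.mesh i).body (S.tmid (2 / 3) i)) :
    z (S.tmid (2 / 3) i) x
      = 1 / 3 * (S.mesh i).shift z (S.left i) (S.tmid (2 / 3) i) x
        + (S.mesh i).shift z (S.zeta (2 / 3) i) (S.tmid (2 / 3) i) x
        - 1 / 3 * (S.mesh i).shift z (S.right i) (S.tmid (2 / 3) i) x := by
  obtain ⟨c₀, c₁, c₂, h, -⟩ := hasDerivWithinAt_fe hz (S.tmid_mem i) hx
  have h2 := h _ (S.tmid_mem i)
  rw [(S.tri (S.tmid_mem i)).flow_self hx] at h2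
  rw [h2, MovingMesh.shift, MovingMesh.shift, MovingMesh.shift, h _ (S.zeta_mem i),
    h _ (S.left_mem i), h _ (S.right_mem i), zeta, tmid, right_eq]
  ring

theorem trap_mem (hz : (S.mesh i).IsFEFunction (S.slab i) z) :
    S.trap (2 / 3) i z ∈ (S.mesh i).sliceSpace (S.tmid (2 / 3) i) := by
  have h1 := hz.shift_mem (S.zeta_mem i) (S.tri (S.tmid_mem i))
  have h2 := hz.shift_mem (S.left_mem i) (S.tri (S.tmid_mem i))
  have := MovingMesh.sliceSpace_const_mul (MovingMesh.sliceSpace_add h1 h2) (2⁻¹ : ℝ)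
  refine MovingMesh.sliceSpace_congr this fun x _ => ?_
  rw [trap]
  ring

theorem memLp_charDeriv_fe (hΩ : IsOpen Ω) [IsFiniteMeasure (volume.restrict Ω)]
    (hz : (S.mesh i).IsFEFunction (S.slab i) z) :
    MemLp (S.charDeriv i z (S.tmid (2 / 3) i)) 2 (volume.restrict Ω)
      ∧ MemLp (S.charDeriv i z (S.right i)) 2 (volume.restrict Ω) := by
  have sh : ∀ {s t}, s ∈ S.slab i → t ∈ S.slab i →
      MemLp ((S.mesh i).shift z s t) 2 (volume.restrict Ω) := fun hs ht =>
    ((S.tri ht).memH1 hΩ (hz.shift_mem hs (S.tri ht))).1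
  constructor
  · have h := ((sh (S.zeta_mem i) (S.tmid_mem i)).sub
      (sh (S.left_mem i) (S.tmid_mem i))).const_mul ((2 / 3 * S.dt i)⁻¹)
    refine h.ae_eq ?_
    filter_upwards [(S.tri (S.tmid_mem i)).ae_mem_body] with x hx
    rw [charDeriv_tmid_fe hz hx, Pi.sub_apply]
    ring
  · have h := (((sh (S.right_mem i) (S.right_mem i)).const_mul (2 / 3 * (2 - 2 / 3))).sub
      (sh (S.zeta_mem i) (S.right_mem i))).add
      ((sh (S.left_mem i) (S.right_mem i)).const_mul ((1 - 2 / 3) ^ 2)) |>.const_mul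
      ((2 / 3 * (1 - 2 / 3) * S.dt i)⁻¹)
    refine h.ae_eq ?_
    filter_upwards [(S.tri (S.right_mem i)).ae_mem_body] with x hx
    rw [charDeriv_right_fe hz hx]
    simp only [Pi.add_apply, Pi.sub_apply, (S.tri (S.right_mem i)).shift_self z hx]
    ring

end fe

end SpaceTimeMesh

/-! ### Stability of the scheme on one time partition -/

namespace SpaceTimeMesh

variable {T : ℝ} {S : SpaceTimeMesh d Ω T} {i : Fin (S.N + 1)} {Λ : ℝ≥0}
  {a : Sp d → ℝ → ℝ} {b : Sp d → ℝ → Sp d} {c : Sp d → ℝ → ℝ} {A κ B a₀ c₀ : ℝ}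

/-- The properties of the mesh and the coefficients on one time partition which the energy estimate
uses. -/
structure StepBounds (S : SpaceTimeMesh d Ω T) (i : Fin (S.N + 1)) (Λ : ℝ≥0)
    (a : Sp d → ℝ → ℝ) (b : Sp d → ℝ → Sp d) (c : Sp d → ℝ → ℝ) (A κ B a₀ c₀ : ℝ) : Prop where
  iso : S.HasDistortion i Λ
  one_le : 1 ≤ Λ
  pow_le : (Λ : ℝ) ^ (d + 2) ≤ 2
  pow_sub_le : (Λ : ℝ) ^ d - 1 ≤ c₀ * S.dt i
  coeff : ∀ t ∈ ({S.tmid (2 / 3) i, S.right i} : Set ℝ), CoeffBounds Ω A κ B (fun x => a x t)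
    (fun x => b x t - (S.mesh i).vel t x) (fun x => c x t)
  ge : ∀ x ∈ Ω, a₀ ≤ a x (S.right i)
  osc : ∀ x ∈ Ω, |a x (S.tmid (2 / 3) i)
    - a ((S.mesh i).flow (S.tmid (2 / 3) i) (S.right i) x) (S.right i)|
      ≤ a₀ / 48 - A * ((Λ : ℝ) ^ (d + 2) - 1)
  small : growthConst a₀ κ B c₀ * S.dt i ≤ 1 / 8
  dt_le : S.dt i ≤ 1
  pos : 0 < a₀
  hA : 0 ≤ A
  hκ : 0 ≤ κ
  hB : 0 ≤ B
  hc₀ : 0 ≤ c₀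

namespace StepBounds

theorem coeff_tmid (h : StepBounds S i Λ a b c A κ B a₀ c₀) :
    CoeffBounds Ω A κ B (fun x => a x (S.tmid (2 / 3) i))
      (fun x => b x (S.tmid (2 / 3) i) - (S.mesh i).vel (S.tmid (2 / 3) i) x)
      (fun x => c x (S.tmid (2 / 3) i)) := h.coeff _ (by simp)

theorem coeff_right (h : StepBounds S i Λ a b c A κ B a₀ c₀) :
    CoeffBounds Ω A κ B (fun x => a x (S.right i))
      (fun x => b x (S.right i) - (S.mesh i).vel (S.right i) x)
      (fun x => c x (S.right i)) := h.coeff _ (by simp)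

theorem pow_le' (h : StepBounds S i Λ a b c A κ B a₀ c₀) : (Λ : ℝ) ^ d ≤ 2 :=
  (pow_le_pow_right₀ (by exact_mod_cast h.one_le) (by omega)).trans h.pow_le

theorem norm0Sq_comp_le (h : StepBounds S i Λ a b c A κ B a₀ c₀) {t s : ℝ} (ht : t ∈ S.slab i)
    (hs : s ∈ S.slab i) {X : Sp d → ℝ} (hX : MemH1 Ω X) :
    norm0Sq Ω (fun x => X ((S.mesh i).flow t s x)) ≤ 2 * norm0Sq Ω X :=
  ((h.iso t ht s hs).norm0Sq_comp_le hX.1).trans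
    (mul_le_mul_of_nonneg_right h.pow_le' (norm0Sq_nonneg _ _))

theorem semi1Sq_comp_le (hΩ : IsOpen Ω) [IsFiniteMeasure (volume.restrict Ω)]
    (h : StepBounds S i Λ a b c A κ B a₀ c₀) {t s : ℝ} (ht : t ∈ S.slab i)
    (hs : s ∈ S.slab i) {X : Sp d → ℝ} (hX : MemH1 Ω X) :
    semi1Sq Ω (fun x => X ((S.mesh i).flow t s x)) ≤ 2 * semi1Sq Ω X :=
  ((h.iso t ht s hs).semi1Sq_comp_le hΩ hX).trans
    (mul_le_mul_of_nonneg_right h.pow_le (semi1Sq_nonneg _ _))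

end StepBounds

/-- The contribution of one time partition to the sum in the energy semi-norm. -/
def slabTerm (S : SpaceTimeMesh d Ω T) (i : Fin (S.N + 1)) (w : ℝ → Sp d → ℝ) : ℝ :=
  negNorm Ω ((S.mesh i).sliceSpace (S.tmid (2 / 3) i)) (S.charDeriv i w (S.tmid (2 / 3) i)) ^ 2
    + norm1Sq Ω (S.trap (2 / 3) i w)
    + norm1Sq Ω (w (S.zeta (2 / 3) i))
    + negNorm Ω ((S.mesh i).sliceSpace (S.right i)) (S.charDeriv i w (S.right i)) ^ 2
    + norm1Sq Ω (w (S.right i))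

/-- The constant in the stability estimate of one time partition. -/
def stabConst (a₀ K : ℝ) : ℝ := (1 + 2 * K ^ 2) * (600 + 30000 / a₀)

/-- The time derivative is bounded in the dual norm by the equation itself: it equals the data minus
a form that is continuous on `H¹`. -/
theorem negNorm_sq_le_of_eq {V : Set (Sp d → ℝ)} {v w : Sp d → ℝ} {α γ : Sp d → ℝ}
    {β : Sp d → Sp d} (hΩ : IsOpen Ω) (hC : CoeffBounds Ω A κ B α β γ) (hA : 0 ≤ A) (hκ : 0 ≤ κ)
    (hB : 0 ≤ B) (hw : MemH1 Ω w) (hV : ∀ χ ∈ V, MemH1 Ω χ) {Φ : (Sp d → ℝ) → ℝ} {D : ℝ}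
    (hD : 0 ≤ D) (he : ∀ χ ∈ V, ip Ω v χ + gform Ω α β γ w χ = Φ χ)
    (hΦ : ∀ χ ∈ V, |Φ χ| ≤ D * √(norm1Sq Ω χ)) :
    negNorm Ω V v ^ 2 ≤ 2 * D ^ 2 + 2 * (A + κ + B) ^ 2 * norm1Sq Ω w := by
  have h1 : negNorm Ω V v ≤ D + (A + κ + B) * √(norm1Sq Ω w) := by
    refine negNorm_le (by positivity) fun χ hχ => ?_
    have h2 := hC.abs_gform_le hΩ hA hκ hB hw (hV χ hχ)
    have h3 : ip Ω v χ = Φ χ - gform Ω α β γ w χ := by rw [← he χ hχ]; ring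
    rw [h3]
    refine (abs_sub _ _).trans ?_
    rw [add_mul, mul_assoc]
    exact add_le_add (hΦ χ hχ) h2
  have h4 := Real.sq_sqrt (norm1Sq_nonneg Ω w)
  calc _ ≤ (D + (A + κ + B) * √(norm1Sq Ω w)) ^ 2 :=
        pow_le_pow_left₀ (negNorm_nonneg _ _ _) h1 2
    _ ≤ 2 * D ^ 2 + 2 * ((A + κ + B) * √(norm1Sq Ω w)) ^ 2 := by
        nlinarith [sq_nonneg (D - (A + κ + B) * √(norm1Sq Ω w))]
    _ = _ := by rw [mul_pow, h4]; ring

/-- Bookkeeping with generous constants: `L` and `sL` are the `L²` norm and the semi-norm at the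
start of the step, `Y` bounds the energy at its end, `G` collects the gradients, and `t1` to `t5`
are the five terms of `slabTerm`. The `L²` bound keeps the weight `k` on the data, whereas in the
second bound it is dropped using `k ≤ 1`. -/
theorem stab_arith {a₀ K k L D G sL Y n0 nM n1 n2 sM s1 t1 t2 t3 t4 t5 D₁ D₂ q : ℝ} (ha : 0 < a₀)
    (hk : 0 < k) (hk1 : k ≤ 1) (hL : 0 ≤ L) (hG : 0 ≤ G) (hsL : 0 ≤ sL)
    (hD : D = D₁ ^ 2 + D₂ ^ 2)
    (hY : Y ≤ 2 * L + 100 / a₀ * (k * D)) (h0 : n0 ≤ 2 * L) (hM : nM ≤ 4 * L + 8 * Y)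
    (h1 : n1 ≤ 4 * L + 32 * Y) (h2 : n2 ≤ Y) (hsM : sM ≤ G) (hs1 : s1 ≤ 8 * G + 4 * sL)
    (ht2 : t2 ≤ 2 * (nM + sM)) (ht3 : t3 ≤ 2 * (n1 + s1)) (ht5 : t5 ≤ Y + G)
    (ht1 : t1 ≤ 2 * D₁ ^ 2 + 2 * K ^ 2 * t2) (ht4 : t4 ≤ 2 * D₂ ^ 2 + 2 * K ^ 2 * t5)
    (hq : q ≤ 2 * (n0 + 4 * n1 + n2)) :
    q ≤ stabConst a₀ K * (L + k * D) ∧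
      t1 + t2 + t3 + t4 + t5 ≤ stabConst a₀ K * (L + G + D + sL) := by
  have hD0 : 0 ≤ D := by rw [hD]; positivity
  have hkD : k * D ≤ D := mul_le_of_le_one_left hD0 hk1
  have hkD0 : 0 ≤ k * D := by positivity
  have hX : 100 / a₀ * (k * D) ≤ 100 / a₀ * D := by gcongr
  have e : stabConst a₀ K = 600 + 300 * (100 / a₀) + (2 * K ^ 2) * (600 + 300 * (100 / a₀)) := by
    rw [stabConst]; ring
  set X := 100 / a₀ with hXd
  have hX0 : 0 ≤ X := by positivity
  have p1 : 0 ≤ X * L := by positivity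
  have p2 : 0 ≤ X * G := by positivity
  have p3 : 0 ≤ X * sL := by positivity
  have p4 : 0 ≤ X * D := by positivity
  have p5 : 0 ≤ X * (k * D) := by positivity
  constructor
  · have r0 : 0 ≤ (2 * K ^ 2) * ((600 + 300 * X) * (L + k * D)) := by positivity
    rw [e]
    linarith
  · have r1 : t2 + t5 ≤ 42 * L + 17 * (X * D) + 3 * G := by linarith
    have r2 := mul_le_mul_of_nonneg_left r1 (show 0 ≤ 2 * K ^ 2 by positivity)
    have r3 : (2 * K ^ 2) * (42 * L + 17 * (X * D) + 3 * G)
        ≤ (2 * K ^ 2) * ((600 + 300 * X) * (L + G + D + sL)) := by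
      gcongr
      linarith
    rw [e]
    linarith

/-- The energy estimate rewritten in terms of the energy semi-norm, for arbitrary data functionals.
The witness `G` is the sum of the squared semi-norms of `M` and `Z2`. The semi-norm at the start of
the step occurs only in the last bound, so the telescoping estimate can be summed before anything is
known about gradients at interfaces. -/
theorem step_stability (hΩ : IsOpen Ω) [IsFiniteMeasure (volume.restrict Ω)]
    (h : StepBounds S i Λ a b c A κ B a₀ c₀) {z : ℝ → Sp d → ℝ}
    (hz : (S.mesh i).IsFEFunction (S.slab i) z) {Φ₁ Φ₂ : (Sp d → ℝ) → ℝ} {D₁ D₂ : ℝ}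
    (hD₁ : 0 ≤ D₁) (hD₂ : 0 ≤ D₂)
    (e₁ : ∀ v ∈ (S.mesh i).sliceSpace (S.tmid (2 / 3) i),
      ip Ω (S.charDeriv i z (S.tmid (2 / 3) i)) v
        + S.form a b c i (S.tmid (2 / 3) i) (S.trap (2 / 3) i z) v = Φ₁ v)
    (b₁ : ∀ v ∈ (S.mesh i).sliceSpace (S.tmid (2 / 3) i), |Φ₁ v| ≤ D₁ * √(norm1Sq Ω v))
    (e₂ : ∀ v ∈ (S.mesh i).sliceSpace (S.right i),
      ip Ω (S.charDeriv i z (S.right i)) v + S.form a b c i (S.right i) (z (S.right i)) v = Φ₂ v)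
    (b₂ : ∀ v ∈ (S.mesh i).sliceSpace (S.right i), |Φ₂ v| ≤ D₂ * √(norm1Sq Ω v)) :
    ∃ G : ℝ, 0 ≤ G ∧ semi1Sq Ω (z (S.right i)) ≤ G ∧
      norm0Sq Ω (z (S.right i)) + a₀ / 24 * (S.dt i * G)
        ≤ (1 + 7 * growthConst a₀ κ B c₀ * S.dt i) * norm0Sq Ω (z (S.left i))
          + 100 / a₀ * (S.dt i * (D₁ ^ 2 + D₂ ^ 2)) ∧
      norm0Sq Ω (z (S.tmid (2 / 3) i)) ≤ stabConst a₀ (A + κ + B)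
        * (norm0Sq Ω (z (S.left i)) + S.dt i * (D₁ ^ 2 + D₂ ^ 2)) ∧
      S.slabTerm i z ≤ stabConst a₀ (A + κ + B)
        * (norm0Sq Ω (z (S.left i)) + G + (D₁ ^ 2 + D₂ ^ 2) + semi1Sq Ω (z (S.left i))) := by
  have hl := S.left_mem i
  have hm := S.tmid_mem i
  have hζ := S.zeta_mem i
  have hr := S.right_mem i
  have hk := S.dt_pos i
  have tm := S.tri hm
  have tr := S.tri hr
  set F := (S.mesh i).flow (S.tmid (2 / 3) i) (S.right i) with hF
  have iso := h.iso _ hm _ hr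
  set Z0 := (S.mesh i).shift z (S.left i) (S.right i) with hZ0
  set Z1 := (S.mesh i).shift z (S.zeta (2 / 3) i) (S.right i) with hZ1
  set Z2 := z (S.right i) with hZ2
  have s0 : Z0 ∈ (S.mesh i).sliceSpace (S.right i) := hz.shift_mem hl tr
  have s1 : Z1 ∈ (S.mesh i).sliceSpace (S.right i) := hz.shift_mem hζ tr
  have s2 : Z2 ∈ (S.mesh i).sliceSpace (S.right i) := hz.mem_sliceSpace hr
  have m0 := tr.memH1 hΩ s0
  have m1 := tr.memH1 hΩ s1
  have m2 := tr.memH1 hΩ s2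
  obtain ⟨M, hM⟩ : ∃ M : Sp d → ℝ, M = fun x => (Z0 x + Z1 x) / 2 := ⟨_, rfl⟩
  obtain ⟨W, hW⟩ : ∃ W : Sp d → ℝ, W = fun x => Z1 x - Z0 x := ⟨_, rfl⟩
  obtain ⟨P, hP⟩ : ∃ P : Sp d → ℝ, P = fun x => Z2 x - M x := ⟨_, rfl⟩
  obtain ⟨V, hV⟩ : ∃ V : Sp d → ℝ, V = fun x => 5 / 4 * M x + Z2 x := ⟨_, rfl⟩
  have mM : MemH1 Ω M := by
    rw [hM]; simpa [div_eq_inv_mul] using (m0.add m1).const_mul (2⁻¹ : ℝ)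
  have mW : MemH1 Ω W := by rw [hW]; exact m1.sub m0
  -- the transported functions
  have t0 : ∀ x ∈ (S.mesh i).body (S.tmid (2 / 3) i),
      Z0 (F x) = (S.mesh i).shift z (S.left i) (S.tmid (2 / 3) i) x :=
    fun x hx => tm.shift_flow tr z _ hx
  have t1 : ∀ x ∈ (S.mesh i).body (S.tmid (2 / 3) i),
      Z1 (F x) = (S.mesh i).shift z (S.zeta (2 / 3) i) (S.tmid (2 / 3) i) x :=
    fun x hx => tm.shift_flow tr z _ hx
  have t2 : ∀ x ∈ (S.mesh i).body (S.tmid (2 / 3) i),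
      Z2 (F x) = (S.mesh i).shift z (S.right i) (S.tmid (2 / 3) i) x := fun x hx => rfl
  have tM : ∀ x ∈ (S.mesh i).body (S.tmid (2 / 3) i), M (F x) = S.trap (2 / 3) i z x :=
    fun x hx => by
      rw [hM]
      simp only
      rw [t0 x hx, t1 x hx, trap, add_comm]
  have tMae : (fun x => M (F x)) =ᵐ[volume.restrict Ω] S.trap (2 / 3) i z := by
    filter_upwards [tm.ae_mem_body] with x hx using tM x hx
  -- `V` is built on the mesh of the second stage; its transport is a finite element function on the
  -- mesh of the first stage, hence an admissible test function there.
  have hVs : (fun x => V (F x)) ∈ (S.mesh i).sliceSpace (S.tmid (2 / 3) i) := by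
    refine MovingMesh.sliceSpace_congr (MovingMesh.sliceSpace_add
      (MovingMesh.sliceSpace_const_mul (trap_mem hz) (5 / 4)) (hz.shift_mem hr tm)) fun x hx => ?_
    rw [hV]
    simp only
    rw [tM x hx, t2 x hx]
  have hWae : (fun x => W (F x)) =ᵐ[volume.restrict Ω]
      fun x => 2 * S.dt i / 3 * S.charDeriv i z (S.tmid (2 / 3) i) x := by
    filter_upwards [tm.ae_mem_body] with x hx
    rw [charDeriv_tmid_fe hz hx, hW]
    simp only
    rw [t0 x hx, t1 x hx]
    field_simp
  have hQae : (fun x => 8 * P x - 5 * W x) =ᵐ[volume.restrict Ω]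
      fun x => 2 * S.dt i * S.charDeriv i z (S.right i) x := by
    filter_upwards [tr.ae_mem_body] with x hx
    rw [charDeriv_right_fe hz hx, hP, hW, hM]
    field_simp
    ring
  have q₁ : ip Ω (fun x => W (F x)) (fun x => V (F x))
      + 2 * S.dt i / 3 * gform Ω (fun x => a x (S.tmid (2 / 3) i))
      (fun x => b x (S.tmid (2 / 3) i) - (S.mesh i).vel (S.tmid (2 / 3) i) x)
      (fun x => c x (S.tmid (2 / 3) i)) (fun x => M (F x)) (fun x => V (F x))
      = 2 * S.dt i / 3 * Φ₁ (fun x => V (F x)) := by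
    rw [← e₁ _ hVs, ip_congr hWae, ip_const_mul_left, gform_congr tMae (ae_eq_refl _), mul_add]
    rfl
  have q₂ : ip Ω (fun x => 8 * P x - 5 * W x) Z2
      + 2 * S.dt i * gform Ω (fun x => a x (S.right i))
      (fun x => b x (S.right i) - (S.mesh i).vel (S.right i) x) (fun x => c x (S.right i)) Z2 Z2
      = 2 * S.dt i * Φ₂ Z2 := by
    rw [← e₂ _ s2, ip_congr hQae, ip_const_mul_left, mul_add]
    rfl
  have main := one_step_energy_le hΩ iso h.one_le h.pos h.hκ h.hB h.hc₀ hk h.small h.pow_le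
    h.pow_sub_le (η := a₀ / 48 - A * ((Λ : ℝ) ^ (d + 2) - 1)) (by linarith) h.coeff_tmid
    h.coeff_right h.ge h.osc m0 m1 m2 hM hW hP hV q₁ (b₁ _ hVs) q₂ (b₂ _ s2) hD₁
  -- the initial value of the step
  have mL := (S.tri hl).memH1 hΩ (hz.mem_sliceSpace hl)
  have nL := norm0Sq_nonneg Ω (z (S.left i))
  -- Transport from the start to the end of the step changes the `L²` norm by the factor `1 + c₀Δt`,
  -- which raises the growth rate from `6K` to `7K`.
  have n0L : norm0Sq Ω Z0 ≤ (1 + c₀ * S.dt i) * norm0Sq Ω (z (S.left i)) := by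
    refine ((h.iso _ hr _ hl).norm0Sq_comp_le mL.1).trans ?_
    gcongr
    linarith [h.pow_sub_le]
  have s0L : semi1Sq Ω Z0 ≤ 2 * semi1Sq Ω (z (S.left i)) := h.semi1Sq_comp_le hΩ hr hl mL
  have hKpos := growthConst_pos (κ := κ) h.pos h.hB h.hc₀
  set K := growthConst a₀ κ B c₀ with hK
  set D := D₁ ^ 2 + D₂ ^ 2 with hD
  have hcK : c₀ * S.dt i ≤ K * S.dt i / 2 := by
    have : c₀ ≤ K / 2 := by
      rw [hK, growthConst]
      have := h.pos
      have := h.hB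
      have : 0 ≤ κ ^ 2 / a₀ := by positivity
      linarith
    have := mul_le_mul_of_nonneg_right this hk.le
    linarith
  have hsm := h.small
  have hx : 0 ≤ K * S.dt i := by positivity
  have hn0 : (1 + 6 * K * S.dt i) * norm0Sq Ω Z0
      ≤ (1 + 7 * K * S.dt i) * norm0Sq Ω (z (S.left i)) := by
    calc _ ≤ (1 + 6 * K * S.dt i) * ((1 + c₀ * S.dt i) * norm0Sq Ω (z (S.left i))) := by gcongr
      _ = ((1 + 6 * K * S.dt i) * (1 + c₀ * S.dt i)) * norm0Sq Ω (z (S.left i)) := by ring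
      _ ≤ _ := by
        gcongr
        have : (1 + 6 * K * S.dt i) * (1 + c₀ * S.dt i)
          ≤ (1 + 6 * K * S.dt i) * (1 + K * S.dt i / 2) := by gcongr
        nlinarith
  have nP := norm0Sq_nonneg Ω P
  have nW := norm0Sq_nonneg Ω W
  have n2 := norm0Sq_nonneg Ω Z2
  have sM := semi1Sq_nonneg Ω M
  have s2' := semi1Sq_nonneg Ω Z2
  have hG0 : 0 ≤ semi1Sq Ω M + semi1Sq Ω Z2 := by positivity
  have hkG : 0 ≤ a₀ / 24 * S.dt i * (semi1Sq Ω M + semi1Sq Ω Z2) := by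
    have := h.pos
    positivity
  have hn0' : norm0Sq Ω Z0 ≤ 2 * norm0Sq Ω (z (S.left i)) :=
    n0L.trans (mul_le_mul_of_nonneg_right (by linarith) nL)
  obtain ⟨Y, hY⟩ : ∃ Y : ℝ, Y = (1 + 7 * K * S.dt i) * norm0Sq Ω (z (S.left i))
      + 100 / a₀ * (S.dt i * D) := ⟨_, rfl⟩
  have main' : norm0Sq Ω Z2 + 1 / 4 * norm0Sq Ω P + 1 / 16 * norm0Sq Ω W
      + a₀ / 24 * S.dt i * (semi1Sq Ω M + semi1Sq Ω Z2) ≤ Y := by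
    rw [hY]
    linarith
  have hY2 : Y ≤ 2 * norm0Sq Ω (z (S.left i)) + 100 / a₀ * (S.dt i * D) := by
    rw [hY]
    gcongr
    linarith
  have hVm : ∀ {t}, t ∈ S.slab i → ∀ χ ∈ (S.mesh i).sliceSpace t, MemH1 Ω χ :=
    fun ht χ hχ => (S.tri ht).memH1 hΩ hχ
  have eZ1 : Z1 = fun x => Z0 x + W x := by rw [hW]; ext x; ring
  -- The energy estimate controls the gradient of the mean `M` but not that of `Z1`; solving for
  -- `Z1` brings in the gradient of the starting value.
  have eZ1' : Z1 = fun x => 2 * M x - Z0 x := by rw [hM]; ext x; ring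
  have eM : M = fun x => Z0 x + 1 / 2 * W x := by rw [hM, hW]; ext x; ring
  have bM : norm0Sq Ω M ≤ 4 * norm0Sq Ω (z (S.left i)) + 8 * Y := by
    rw [eM]
    have := norm0Sq_add_le m0.1 (mW.1.const_mul (1 / 2))
    rw [norm0Sq_const_mul] at this
    linarith
  have b1 : norm0Sq Ω Z1 ≤ 4 * norm0Sq Ω (z (S.left i)) + 32 * Y := by
    have := norm0Sq_add_le m0.1 mW.1
    rw [← eZ1] at this
    linarith
  have bs1 : semi1Sq Ω Z1 ≤ 8 * (semi1Sq Ω M + semi1Sq Ω Z2)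
      + 4 * semi1Sq Ω (z (S.left i)) := by
    have := semi1Sq_sub_le hΩ (mM.const_mul 2) m0
    rw [← eZ1', semi1Sq_const_mul hΩ mM] at this
    linarith
  have hζae : z (S.zeta (2 / 3) i) =ᵐ[volume.restrict Ω]
      fun x => Z1 ((S.mesh i).flow (S.zeta (2 / 3) i) (S.right i) x) := by
    filter_upwards [(S.tri hζ).ae_mem_body] with x hx
    rw [hZ1, (S.tri hζ).shift_flow tr z _ hx, (S.tri hζ).shift_self z hx]
  have hmae : z (S.tmid (2 / 3) i) =ᵐ[volume.restrict Ω]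
      fun x => (fun y => 1 / 3 * Z0 y + Z1 y - 1 / 3 * Z2 y) (F x) := by
    filter_upwards [tm.ae_mem_body] with x hx
    rw [tmid_fe hz hx, ← t0 x hx, ← t1 x hx, ← t2 x hx]
  have bq : norm0Sq Ω (z (S.tmid (2 / 3) i))
      ≤ 2 * (norm0Sq Ω Z0 + 4 * norm0Sq Ω Z1 + norm0Sq Ω Z2) := by
    rw [norm0Sq_congr hmae]
    refine (h.norm0Sq_comp_le hm hr
      (((m0.const_mul (1 / 3)).add m1).sub (m2.const_mul (1 / 3)))).trans ?_
    gcongr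
    have c1 := norm0Sq_sub_le (((m0.const_mul (1 / 3)).add m1).1) ((m2.const_mul (1 / 3)).1)
    have c2 := norm0Sq_add_le ((m0.const_mul (1 / 3)).1) m1.1
    rw [norm0Sq_const_mul] at c1 c2
    linarith [norm0Sq_nonneg Ω Z0]
  have bt2 : norm1Sq Ω (S.trap (2 / 3) i z) ≤ 2 * (norm0Sq Ω M + semi1Sq Ω M) := by
    rw [← norm1Sq_congr tMae, norm1Sq]
    linarith [h.norm0Sq_comp_le hm hr mM, h.semi1Sq_comp_le hΩ hm hr mM]
  have bt3 : norm1Sq Ω (z (S.zeta (2 / 3) i)) ≤ 2 * (norm0Sq Ω Z1 + semi1Sq Ω Z1) := by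
    rw [norm1Sq_congr hζae, norm1Sq]
    linarith [h.norm0Sq_comp_le hζ hr m1, h.semi1Sq_comp_le hΩ hζ hr m1]
  have bt5 : norm1Sq Ω Z2 ≤ Y + (semi1Sq Ω M + semi1Sq Ω Z2) := by
    rw [norm1Sq]
    linarith
  have bt1 := negNorm_sq_le_of_eq hΩ h.coeff_tmid h.hA h.hκ h.hB
    (tm.memH1 hΩ (trap_mem hz)) (hVm hm) hD₁ e₁ b₁
  have bt4 := negNorm_sq_le_of_eq hΩ h.coeff_right h.hA h.hκ h.hB m2 (hVm hr) hD₂ e₂ b₂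
  have fin := stab_arith h.pos hk h.dt_le nL hG0 (semi1Sq_nonneg Ω (z (S.left i))) hD hY2 hn0' bM b1
    (by linarith) (by linarith) bs1 bt2 bt3 bt5 bt1 bt4 bq
  refine ⟨semi1Sq Ω M + semi1Sq Ω Z2, hG0, by linarith, ?_, fin.1, fin.2⟩
  rw [← hY, ← mul_assoc]
  linarith

end SpaceTimeMesh

/-! ### The error equations -/

namespace SpaceTimeMesh

variable {T : ℝ} {S : SpaceTimeMesh d Ω T} {i : Fin (S.N + 1)} {Λ : ℝ≥0}
  {a : Sp d → ℝ → ℝ} {b : Sp d → ℝ → Sp d} {c : Sp d → ℝ → ℝ} {A κ B a₀ c₀ : ℝ}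
  {f g : Sp d → ℝ → ℝ} {u₀ : Sp d → ℝ} {u : ℝ → Sp d → ℝ} {uh χ : S.SlabFun}

theorem slab_subset (i : Fin (S.N + 1)) : S.slab i ⊆ Icc 0 T := by
  intro t ht
  constructor
  · rw [← S.time_zero]
    exact (S.strictMono.monotone (Fin.zero_le _)).trans ht.1
  · rw [← S.time_last]
    exact ht.2.trans (S.strictMono.monotone (Fin.le_last _))

theorem left_zero : S.left 0 = 0 := S.time_zero

theorem trap_sub (w w' : ℝ → Sp d → ℝ) (i : Fin (S.N + 1)) :
    S.trap (2 / 3) i (fun t x => w t x - w' t x)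
      = fun x => S.trap (2 / 3) i w x - S.trap (2 / 3) i w' x := by
  ext x
  simp only [trap, MovingMesh.shift]
  ring

theorem memH1_shift (hΩ : IsOpen Ω) [IsFiniteMeasure (volume.restrict Ω)]
    (hiso : S.HasDistortion i Λ) {w : ℝ → Sp d → ℝ} {s t : ℝ} (hs : s ∈ S.slab i)
    (ht : t ∈ S.slab i) (hw : MemH1 Ω (w s)) : MemH1 Ω ((S.mesh i).shift w s t) :=
  (hiso t ht s hs).memH1_comp hΩ hw

theorem memH1_trap (hΩ : IsOpen Ω) [IsFiniteMeasure (volume.restrict Ω)]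
    (hiso : S.HasDistortion i Λ) {w : ℝ → Sp d → ℝ} (hw : ∀ t ∈ S.slab i, MemH1 Ω (w t)) :
    MemH1 Ω (S.trap (2 / 3) i w) := by
  have h1 := memH1_shift hΩ hiso (S.zeta_mem i) (S.tmid_mem i) (hw _ (S.zeta_mem i))
  have h2 := memH1_shift hΩ hiso (S.left_mem i) (S.tmid_mem i) (hw _ (S.left_mem i))
  refine ((h1.add h2).const_mul (2⁻¹)).congr (ae_of_all _ fun x => ?_)
  simp only [trap]
  ring

theorem memH1_fe (hΩ : IsOpen Ω) [IsFiniteMeasure (volume.restrict Ω)] {z : ℝ → Sp d → ℝ}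
    (hz : (S.mesh i).IsFEFunction (S.slab i) z) : ∀ t ∈ S.slab i, MemH1 Ω (z t) :=
  fun _ ht => (S.tri ht).memH1 hΩ (hz.mem_sliceSpace ht)

/-- Finite element functions are in `H¹` and continuous up to the boundary, hence admissible in the
weak formulation. -/
theorem IsWeakSolution.eq_of_mem (hΩ : IsOpen Ω) [IsFiniteMeasure (volume.restrict Ω)]
    (hu : S.IsWeakSolution a b c f g u₀ u) {t : ℝ} (ht : t ∈ Ioc (S.left i) (S.right i))
    {v : Sp d → ℝ} (hv : v ∈ (S.mesh i).sliceSpace t) :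
    ip Ω (S.charDeriv i u t) v + S.form a b c i t (u t) v
      = ip Ω (fun x => f x t) v + bip Ω (fun x => g x t) v := by
  have tt := S.tri (Ioc_subset_Icc_self ht)
  exact (hu.2.1 i t ht).2 v (tt.memH1 hΩ hv)
    ((tt.continuousOn_body hv).mono tt.closure_subset_body)

theorem tmid_mem_Ioc (i : Fin (S.N + 1)) : S.tmid (2 / 3) i ∈ Ioc (S.left i) (S.right i) := by
  constructor <;> rw [tmid] <;> linarith [S.dt_pos i, S.right_eq i]

theorem right_mem_Ioc (i : Fin (S.N + 1)) : S.right i ∈ Ioc (S.left i) (S.right i) :=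
  ⟨by linarith [S.dt_pos i, S.right_eq i], le_rfl⟩

theorem ip_charDeriv_sub {w w' : ℝ → Sp d → ℝ} {t : ℝ} (hw : S.DiffAlong i w t)
    (hw' : S.DiffAlong i w' t) (mw : MemLp (S.charDeriv i w t) 2 (volume.restrict Ω))
    (mw' : MemLp (S.charDeriv i w' t) 2 (volume.restrict Ω)) {v : Sp d → ℝ}
    (hv : MemLp v 2 (volume.restrict Ω)) :
    ip Ω (S.charDeriv i (fun s x => w s x - w' s x) t) v
      = ip Ω (S.charDeriv i w t) v - ip Ω (S.charDeriv i w' t) v := by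
  rw [ip_congr (charDeriv_sub hw hw'), ip_sub_left mw mw' hv]

/-- The scheme applies the form to the trapezoid average, the weak formulation to the value at the
node; the last term is the resulting consistency error. The data cancel, so the boundary pairing
needs no estimate. -/
theorem error_eq_tmid (hΩ : IsOpen Ω) [IsFiniteMeasure (volume.restrict Ω)]
    (h : StepBounds S i Λ a b c A κ B a₀ c₀) (hu : S.IsWeakSolution a b c f g u₀ u)
    (hu2 : S.HasSecondCharDeriv u) (huh : S.IsDiscreteSolution (2 / 3) a b c f g u₀ uh)
    (hχ : χ ∈ S.feSpace) {v : Sp d → ℝ} (hv : v ∈ (S.mesh i).sliceSpace (S.tmid (2 / 3) i)) :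
    ip Ω (S.charDeriv i (fun t x => uh i t x - χ i t x) (S.tmid (2 / 3) i)) v
      + S.form a b c i (S.tmid (2 / 3) i) (S.trap (2 / 3) i (fun t x => uh i t x - χ i t x)) v
    = ip Ω (S.charDeriv i (fun t x => u t x - χ i t x) (S.tmid (2 / 3) i)) v
      + (S.form a b c i (S.tmid (2 / 3) i) (S.trap (2 / 3) i (fun t x => u t x - χ i t x)) v
        + S.form a b c i (S.tmid (2 / 3) i)
          (fun x => u (S.tmid (2 / 3) i) x - S.trap (2 / 3) i u x) v) := by
  have ht := S.tmid_mem i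
  have hC := h.coeff_tmid
  have mv := (S.tri ht).memH1 hΩ hv
  have fχ := hχ.1 i
  have fuh := huh.1.1 i
  have H1u : ∀ t ∈ S.slab i, MemH1 Ω (u t) := fun t ht => hu.1 t (S.slab_subset i ht)
  have e1 := hu.eq_of_mem hΩ (S.tmid_mem_Ioc i) hv
  have e2 := huh.2.2.1 i v hv
  have hae : (fun x => ((S.mesh i).shift (uh i) (S.zeta (2 / 3) i) (S.tmid (2 / 3) i) x
        - (S.mesh i).shift (uh i) (S.left i) (S.tmid (2 / 3) i) x) / (2 / 3 * S.dt i))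
      =ᵐ[volume.restrict Ω] S.charDeriv i (uh i) (S.tmid (2 / 3) i) := by
    filter_upwards [(S.tri ht).ae_mem_body] with x hx
    rw [charDeriv_tmid_fe fuh hx]
  rw [ip_congr hae, ← e1] at e2
  have mχ := (memLp_charDeriv_fe hΩ fχ).1
  have muh := (memLp_charDeriv_fe hΩ fuh).1
  have mu := (hu.2.1 i _ (S.tmid_mem_Ioc i)).1
  rw [ip_charDeriv_sub (diffAlong_fe fuh ht) (diffAlong_fe fχ ht) muh mχ mv.1,
    ip_charDeriv_sub (hu2.diffAlong h.iso ht) (diffAlong_fe fχ ht) mu mχ mv.1, trap_sub, trap_sub]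
  have k1 := hC.gform_sub_left hΩ (memH1_trap hΩ h.iso (memH1_fe hΩ fuh))
    (memH1_trap hΩ h.iso (memH1_fe hΩ fχ)) mv
  have k2 := hC.gform_sub_left hΩ (memH1_trap hΩ h.iso H1u)
    (memH1_trap hΩ h.iso (memH1_fe hΩ fχ)) mv
  have k3 := hC.gform_sub_left hΩ (H1u _ ht) (memH1_trap hΩ h.iso H1u) mv
  change S.form a b c i _ _ v = S.form a b c i _ _ v - S.form a b c i _ _ v at k1 k2 k3
  rw [k1, k2, k3]
  linarith

/-- At the end of the step the scheme uses the nodal value itself, so no consistency error appears.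
-/
theorem error_eq_right (hΩ : IsOpen Ω) [IsFiniteMeasure (volume.restrict Ω)]
    (h : StepBounds S i Λ a b c A κ B a₀ c₀) (hu : S.IsWeakSolution a b c f g u₀ u)
    (hu2 : S.HasSecondCharDeriv u) (huh : S.IsDiscreteSolution (2 / 3) a b c f g u₀ uh)
    (hχ : χ ∈ S.feSpace) {v : Sp d → ℝ} (hv : v ∈ (S.mesh i).sliceSpace (S.right i)) :
    ip Ω (S.charDeriv i (fun t x => uh i t x - χ i t x) (S.right i)) v
      + S.form a b c i (S.right i) (fun x => uh i (S.right i) x - χ i (S.right i) x) v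
    = ip Ω (S.charDeriv i (fun t x => u t x - χ i t x) (S.right i)) v
      + S.form a b c i (S.right i) (fun x => u (S.right i) x - χ i (S.right i) x) v := by
  have ht := S.right_mem i
  have hC := h.coeff_right
  have mv := (S.tri ht).memH1 hΩ hv
  have fχ := hχ.1 i
  have fuh := huh.1.1 i
  have H1u : ∀ t ∈ S.slab i, MemH1 Ω (u t) := fun t ht => hu.1 t (S.slab_subset i ht)
  have e1 := hu.eq_of_mem hΩ (S.right_mem_Ioc i) hv
  have e2 := huh.2.2.2 i v hv
  have hae : (fun x => (2 / 3 * (2 - 2 / 3) * uh i (S.right i) x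
        - (S.mesh i).shift (uh i) (S.zeta (2 / 3) i) (S.right i) x
        + (1 - 2 / 3) ^ 2 * (S.mesh i).shift (uh i) (S.left i) (S.right i) x)
          / (2 / 3 * (1 - 2 / 3) * S.dt i))
      =ᵐ[volume.restrict Ω] S.charDeriv i (uh i) (S.right i) := by
    filter_upwards [(S.tri ht).ae_mem_body] with x hx
    rw [charDeriv_right_fe fuh hx]
  rw [ip_congr hae, ← e1] at e2
  have mχ := (memLp_charDeriv_fe hΩ fχ).2
  have muh := (memLp_charDeriv_fe hΩ fuh).2
  have mu := (hu.2.1 i _ (S.right_mem_Ioc i)).1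
  rw [ip_charDeriv_sub (diffAlong_fe fuh ht) (diffAlong_fe fχ ht) muh mχ mv.1,
    ip_charDeriv_sub (hu2.diffAlong h.iso ht) (diffAlong_fe fχ ht) mu mχ mv.1]
  have k1 := hC.gform_sub_left hΩ (memH1_fe hΩ fuh _ ht) (memH1_fe hΩ fχ _ ht) mv
  have k2 := hC.gform_sub_left hΩ (H1u _ ht) (memH1_fe hΩ fχ _ ht) mv
  change S.form a b c i _ _ v = S.form a b c i _ _ v - S.form a b c i _ _ v at k1 k2
  rw [k1, k2]
  linarith

theorem memLp_charDeriv_sub {w w' : ℝ → Sp d → ℝ} {t : ℝ} (hw : S.DiffAlong i w t)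
    (hw' : S.DiffAlong i w' t) (mw : MemLp (S.charDeriv i w t) 2 (volume.restrict Ω))
    (mw' : MemLp (S.charDeriv i w' t) 2 (volume.restrict Ω)) :
    MemLp (S.charDeriv i (fun s x => w s x - w' s x) t) 2 (volume.restrict Ω) :=
  (mw.sub mw').ae_eq (charDeriv_sub hw hw').symm

theorem sq_sum_le {p q r : ℝ} : (p + (q + r)) ^ 2 ≤ 2 * p ^ 2 + 4 * q ^ 2 + 4 * r ^ 2 := by
  nlinarith [sq_nonneg (p - (q + r)), sq_nonneg (q - r)]

/-- The discrete error is controlled, on one time partition, by the approximation error, the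
consistency error and its own initial value. -/
theorem discrete_error_step (hΩ : IsOpen Ω) [IsFiniteMeasure (volume.restrict Ω)]
    (h : StepBounds S i Λ a b c A κ B a₀ c₀) (hu : S.IsWeakSolution a b c f g u₀ u)
    (hu2 : S.HasSecondCharDeriv u) (huh : S.IsDiscreteSolution (2 / 3) a b c f g u₀ uh)
    (hχ : χ ∈ S.feSpace) {z : ℝ → Sp d → ℝ} (hz : z = fun t x => uh i t x - χ i t x) :
    ∃ G D : ℝ, 0 ≤ G ∧ 0 ≤ D ∧
      S.dt i * D ≤ 4 * (1 + (A + κ + B) ^ 2) * (S.dt i * S.slabTerm i (fun t x => u t x - χ i t x)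
        + ∫ t in (S.left i)..(S.right i),
          norm1Sq Ω (fun x => S.dt i ^ 2 * S.charDeriv i (S.charDeriv i u) t x)) ∧
      semi1Sq Ω (z (S.right i)) ≤ G ∧
      norm0Sq Ω (z (S.right i)) + a₀ / 24 * (S.dt i * G)
        ≤ (1 + 7 * growthConst a₀ κ B c₀ * S.dt i) * norm0Sq Ω (z (S.left i))
          + 100 / a₀ * (S.dt i * D) ∧
      norm0Sq Ω (z (S.tmid (2 / 3) i)) ≤ stabConst a₀ (A + κ + B)
        * (norm0Sq Ω (z (S.left i)) + S.dt i * D) ∧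
      S.slabTerm i z ≤ stabConst a₀ (A + κ + B)
        * (norm0Sq Ω (z (S.left i)) + G + D + semi1Sq Ω (z (S.left i))) := by
  have fχ := hχ.1 i
  have fuh := huh.1.1 i
  have fz : (S.mesh i).IsFEFunction (S.slab i) z := by rw [hz]; exact fuh.sub fχ
  have H1E : ∀ t ∈ S.slab i, MemH1 Ω (fun x => u t x - χ i t x) := fun t ht =>
    (hu.1 t (S.slab_subset i ht)).sub (memH1_fe hΩ fχ t ht)
  obtain ⟨hρ, hρle⟩ := norm1Sq_sub_trap_le hΩ h.iso h.one_le h.pow_le hu2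
  have hm := S.tmid_mem i
  have hr := S.right_mem i
  have mE₁ := memLp_charDeriv_sub (hu2.diffAlong h.iso hm) (diffAlong_fe fχ hm)
    (hu.2.1 i _ (S.tmid_mem_Ioc i)).1 (memLp_charDeriv_fe hΩ fχ).1
  have mE₂ := memLp_charDeriv_sub (hu2.diffAlong h.iso hr) (diffAlong_fe fχ hr)
    (hu.2.1 i _ (S.right_mem_Ioc i)).1 (memLp_charDeriv_fe hΩ fχ).2
  have hVm : ∀ {t}, t ∈ S.slab i → ∀ χ ∈ (S.mesh i).sliceSpace t, MemH1 Ω χ :=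
    fun ht χ hχ => (S.tri ht).memH1 hΩ hχ
  set E : ℝ → Sp d → ℝ := fun t x => u t x - χ i t x with hE
  set ρ : Sp d → ℝ := fun x => u (S.tmid (2 / 3) i) x - S.trap (2 / 3) i u x with hρd
  set K := A + κ + B with hK
  have hK0 : 0 ≤ K := by have := h.hA; have := h.hκ; have := h.hB; positivity
  set N₁ := negNorm Ω ((S.mesh i).sliceSpace (S.tmid (2 / 3) i))
    (S.charDeriv i E (S.tmid (2 / 3) i)) with hN₁
  set N₂ := negNorm Ω ((S.mesh i).sliceSpace (S.right i)) (S.charDeriv i E (S.right i)) with hN₂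
  have hN₁0 : 0 ≤ N₁ := negNorm_nonneg _ _ _
  have hN₂0 : 0 ≤ N₂ := negNorm_nonneg _ _ _
  -- The data functionals are bounded by the dual norm of `E_τ` and by the continuity constant `A +
  -- κ + B` of the form. The dual norm applies because the test functions range over the finite
  -- element space of the node.
  obtain ⟨G, hG, h1, h2, h3, h4⟩ := step_stability hΩ h fz
    (Φ₁ := fun v => ip Ω (S.charDeriv i E (S.tmid (2 / 3) i)) v
      + (S.form a b c i (S.tmid (2 / 3) i) (S.trap (2 / 3) i E) v
        + S.form a b c i (S.tmid (2 / 3) i) ρ v))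
    (Φ₂ := fun v => ip Ω (S.charDeriv i E (S.right i)) v
      + S.form a b c i (S.right i) (E (S.right i)) v)
    (D₁ := N₁ + (K * √(norm1Sq Ω (S.trap (2 / 3) i E)) + K * √(norm1Sq Ω ρ)))
    (D₂ := N₂ + K * √(norm1Sq Ω (E (S.right i)))) (by positivity) (by positivity)
    (fun v hv => by rw [hz]; exact error_eq_tmid hΩ h hu hu2 huh hχ hv)
    (fun v hv => by
      have mv := hVm hm v hv
      have k1 := abs_ip_le_negNorm mE₁ (fun χ hχ => (hVm hm χ hχ).1) hv
      have k2 := h.coeff_tmid.abs_gform_le hΩ h.hA h.hκ h.hB (memH1_trap hΩ h.iso H1E) mv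
      have k3 := h.coeff_tmid.abs_gform_le hΩ h.hA h.hκ h.hB hρ mv
      refine (abs_add_le _ _).trans ?_
      refine (add_le_add k1 ((abs_add_le _ _).trans (add_le_add k2 k3))).trans (le_of_eq ?_)
      ring)
    (fun v hv => by rw [hz]; exact error_eq_right hΩ h hu hu2 huh hχ hv)
    (fun v hv => by
      have mv := hVm hr v hv
      have k1 := abs_ip_le_negNorm mE₂ (fun χ hχ => (hVm hr χ hχ).1) hv
      have k2 := h.coeff_right.abs_gform_le hΩ h.hA h.hκ h.hB (H1E _ hr) mv
      refine (abs_add_le _ _).trans ((add_le_add k1 k2).trans (le_of_eq ?_))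
      ring)
  refine ⟨G, _, hG, add_nonneg (sq_nonneg _) (sq_nonneg _), ?_, h1, h2, h3, h4⟩
  have q1 := Real.sq_sqrt (norm1Sq_nonneg Ω (S.trap (2 / 3) i E))
  have q2 := Real.sq_sqrt (norm1Sq_nonneg Ω ρ)
  have q3 := Real.sq_sqrt (norm1Sq_nonneg Ω (E (S.right i)))
  have d1 : (N₁ + (K * √(norm1Sq Ω (S.trap (2 / 3) i E)) + K * √(norm1Sq Ω ρ))) ^ 2
      ≤ 2 * N₁ ^ 2 + 4 * (K ^ 2 * norm1Sq Ω (S.trap (2 / 3) i E)) + 4 * (K ^ 2 * norm1Sq Ω ρ) := by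
    refine sq_sum_le.trans (le_of_eq ?_)
    rw [mul_pow, mul_pow, q1, q2]
  have d2 : (N₂ + K * √(norm1Sq Ω (E (S.right i)))) ^ 2
      ≤ 2 * N₂ ^ 2 + 4 * (K ^ 2 * norm1Sq Ω (E (S.right i))) := by
    have := sq_sum_le (p := N₂) (q := K * √(norm1Sq Ω (E (S.right i)))) (r := 0)
    rw [mul_pow, q3] at this
    simpa using this
  have hst : S.slabTerm i E = N₁ ^ 2 + norm1Sq Ω (S.trap (2 / 3) i E)
    + norm1Sq Ω (E (S.zeta (2 / 3) i)) + N₂ ^ 2 + norm1Sq Ω (E (S.right i)) := rfl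
  have p1 := norm1Sq_nonneg Ω (S.trap (2 / 3) i E)
  have p2 := norm1Sq_nonneg Ω ρ
  have p3 := norm1Sq_nonneg Ω (E (S.right i))
  have p4 := norm1Sq_nonneg Ω (E (S.zeta (2 / 3) i))
  have tot : (N₁ + (K * √(norm1Sq Ω (S.trap (2 / 3) i E)) + K * √(norm1Sq Ω ρ))) ^ 2
      + (N₂ + K * √(norm1Sq Ω (E (S.right i)))) ^ 2
      ≤ 4 * (1 + K ^ 2) * (S.slabTerm i E + norm1Sq Ω ρ) := by
    rw [hst]
    have r1 : 0 ≤ K ^ 2 * N₁ ^ 2 := by positivity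
    have r2 : 0 ≤ K ^ 2 * N₂ ^ 2 := by positivity
    have r3 : 0 ≤ K ^ 2 * norm1Sq Ω (E (S.zeta (2 / 3) i)) := by positivity
    linarith [sq_nonneg N₁, sq_nonneg N₂]
  calc _ ≤ S.dt i * (4 * (1 + K ^ 2) * (S.slabTerm i E + norm1Sq Ω ρ)) :=
        mul_le_mul_of_nonneg_left tot (S.dt_pos i).le
    _ = 4 * (1 + K ^ 2) * (S.dt i * S.slabTerm i E + S.dt i * norm1Sq Ω ρ) := by ring
    _ ≤ _ := by gcongr

end SpaceTimeMesh

/-! ### The bounds on one time partition for small time steps -/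

theorem one_add_pow_le {x : ℝ} (h0 : 0 ≤ x) (h1 : x ≤ 1) (n : ℕ) :
    (1 + x) ^ n ≤ 1 + (2 ^ n - 1) * x := by
  induction n with
  | zero => simp
  | succ n ih =>
    have h2 : (1 : ℝ) ≤ 2 ^ n := one_le_pow₀ one_le_two
    have h3 : (2 ^ n - 1) * x * x ≤ (2 ^ n - 1) * x * 1 :=
      mul_le_mul_of_nonneg_left h1 (mul_nonneg (by linarith) h0)
    calc (1 + x) ^ (n + 1) = (1 + x) ^ n * (1 + x) := pow_succ _ _
      _ ≤ (1 + (2 ^ n - 1) * x) * (1 + x) := by gcongr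
      _ ≤ _ := by rw [pow_succ]; linarith

namespace SpaceTimeMesh

variable {T : ℝ}

theorem hasDistortion (hΩ : IsOpen Ω) (S : SpaceTimeMesh d Ω T) (i : Fin (S.N + 1)) {μ : ℝ}
    (hμ : S.dt i * μ ≤ 1 / 2)
    (hreg : ∀ t ∈ S.slab i, (S.mesh i).ShapeRegularAt (S.left i) (S.dt i) μ t) {Λ : ℝ≥0}
    (hΛ : (Λ : ℝ) = 1 + 4 * (S.dt i * μ)) : S.HasDistortion i Λ := by
  intro t ht s hs
  refine MovingMesh.isMeshIso_flow hΩ (I := S.slab i) isPreconnected_Icc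
    (fun t ht => S.tri ht) (fun e he t ht s hs => ?_) ht hs
  rw [hΛ]
  exact MovingMesh.norm_trans_le (S.dt_pos i).le hμ he ((S.tri ht).det_pos he) (hreg t ht)
    (hreg s hs)

/-- All constants come from bounds on the coefficients over the compact closed cylinder, from its
uniform continuity modulus for `a`, and from `μ`, `κ` and `d`; none depends on the mesh. -/
theorem exists_stepBounds (hΩ : IsOpen Ω) (hΩb : Bornology.IsBounded Ω)
    {a : Sp d → ℝ → ℝ} {b : Sp d → ℝ → Sp d} {c : Sp d → ℝ → ℝ}
    (ha : ContinuousOn (Function.uncurry a) (closure Ω ×ˢ Icc 0 T))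
    (hb : ContinuousOn (Function.uncurry b) (closure Ω ×ˢ Icc 0 T))
    (hc : ContinuousOn (Function.uncurry c) (closure Ω ×ˢ Icc 0 T))
    {a₀ : ℝ} (ha₀ : 0 < a₀) (hge : ∀ x ∈ closure Ω, ∀ t ∈ Icc 0 T, a₀ ≤ a x t)
    {μ κ : ℝ} (hμ : 0 < μ) (hκ : 0 < κ) :
    ∃ A B c₀ δ : ℝ, 0 < A ∧ 0 ≤ B ∧ 0 ≤ c₀ ∧ 0 < δ ∧
      (∀ x ∈ closure Ω, ∀ t ∈ Icc 0 T, |a x t| ≤ A) ∧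
      ∀ S : SpaceTimeMesh d Ω T, (∀ i, S.dt i ≤ δ) →
        (∀ i, ∀ t ∈ ({S.tmid (2 / 3) i, S.right i} : Set ℝ), ∀ x ∈ Ω,
          ‖b x t - (S.mesh i).vel t x‖ ≤ κ) →
        (∀ i, ∀ t ∈ S.slab i, (S.mesh i).ShapeRegularAt (S.left i) (S.dt i) μ t) →
        ∀ i, ∃ Λ, StepBounds S i Λ a b c A κ B a₀ c₀ := by
  have hcomp : IsCompact (closure Ω ×ˢ Icc (0 : ℝ) T) := hΩb.isCompact_closure.prod isCompact_Icc
  obtain ⟨A', hA'⟩ := hcomp.exists_bound_of_continuousOn ha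
  obtain ⟨Bb', hBb'⟩ := hcomp.exists_bound_of_continuousOn hb
  obtain ⟨B', hB'⟩ := hcomp.exists_bound_of_continuousOn hc
  set A := max A' 1 with hA
  set Bb := max Bb' 0 with hBb
  set B := max B' 0 with hB
  have A0 : 0 < A := lt_max_of_lt_right one_pos
  have Bb0 : 0 ≤ Bb := le_max_right _ _
  have B0 : 0 ≤ B := le_max_right _ _
  have bA : ∀ x ∈ closure Ω, ∀ t ∈ Icc 0 T, |a x t| ≤ A := fun x hx t ht =>
    (hA' (x, t) ⟨hx, ht⟩).trans (le_max_left _ _)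
  have bBb : ∀ x ∈ closure Ω, ∀ t ∈ Icc 0 T, ‖b x t‖ ≤ Bb := fun x hx t ht =>
    (hBb' (x, t) ⟨hx, ht⟩).trans (le_max_left _ _)
  have bB : ∀ x ∈ closure Ω, ∀ t ∈ Icc 0 T, |c x t| ≤ B := fun x hx t ht =>
    (hB' (x, t) ⟨hx, ht⟩).trans (le_max_left _ _)
  have huc := hcomp.uniformContinuousOn_of_continuous ha
  rw [Metric.uniformContinuousOn_iff] at huc
  obtain ⟨δ₁, hδ₁, huc⟩ := huc (a₀ / 96) (by positivity)
  set c₀ : ℝ := 2 ^ (d + 2) * (4 * μ) with hc₀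
  have c₀0 : 0 ≤ c₀ := by positivity
  set g := growthConst a₀ κ B c₀ with hg
  have g0 : 0 < g := growthConst_pos ha₀ B0 c₀0
  -- The summands are the reciprocals of the thresholds that `Δt` has to respect. With `Δt ≤ 1/Q`
  -- each of them times `Δt` is at most `1`.
  set Q : ℝ := 1 + 4 * μ + c₀ + 96 * A * c₀ / a₀ + 8 * g + (1 + κ + Bb) * 2 / δ₁ with hQ
  have q1 : 0 ≤ 96 * A * c₀ / a₀ := by positivity
  have q2 : 0 ≤ (1 + κ + Bb) * 2 / δ₁ := by positivity
  have Q0 : 0 < Q := by positivity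
  refine ⟨A, B, c₀, 1 / Q, A0, B0, c₀0, by positivity, bA, fun S hdt hvel hreg i => ?_⟩
  have hk := S.dt_pos i
  have hkQ : Q * S.dt i ≤ 1 := by
    have := mul_le_mul_of_nonneg_left (hdt i) Q0.le
    rwa [mul_one_div_cancel Q0.ne'] at this
  have small : ∀ p, p ≤ Q → p * S.dt i ≤ 1 := fun p hp =>
    (mul_le_mul_of_nonneg_right hp hk.le).trans hkQ
  have k1 : 1 * S.dt i ≤ 1 := small _ (by rw [hQ]; linarith)
  have k2 : 4 * μ * S.dt i ≤ 1 := small _ (by rw [hQ]; linarith)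
  have k3 : c₀ * S.dt i ≤ 1 := small _ (by rw [hQ]; linarith)
  have k4 : 96 * A * c₀ / a₀ * S.dt i ≤ 1 := small _ (by rw [hQ]; linarith)
  have k5 : 8 * g * S.dt i ≤ 1 := small _ (by rw [hQ]; linarith)
  have k6 : (1 + κ + Bb) * 2 / δ₁ * S.dt i ≤ 1 := small _ (by rw [hQ]; linarith)
  have k4' : A * (c₀ * S.dt i) ≤ a₀ / 96 := by
    rw [div_mul_eq_mul_div, div_le_one ha₀] at k4
    linarith
  have k6' : (1 + κ + Bb) * S.dt i ≤ δ₁ / 2 := by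
    rw [div_mul_eq_mul_div, div_le_one hδ₁] at k6
    linarith
  set x₀ := 4 * (S.dt i * μ) with hx₀
  have x₀0 : 0 ≤ x₀ := by positivity
  have x₀1 : x₀ ≤ 1 := by linarith
  have hpow : (1 + x₀) ^ (d + 2) - 1 ≤ c₀ * S.dt i := by
    have := one_add_pow_le x₀0 x₀1 (d + 2)
    have e : c₀ * S.dt i = 2 ^ (d + 2) * x₀ := by rw [hc₀, hx₀]; ring
    linarith
  have hpow' : (1 + x₀) ^ d ≤ (1 + x₀) ^ (d + 2) :=
    pow_le_pow_right₀ (by linarith) (by omega)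
  have iso := S.hasDistortion hΩ i (by linarith) (hreg i) (Λ := ⟨1 + x₀, by linarith⟩) rfl
  have hr := S.right_mem i
  have hm := S.tmid_mem i
  have slab0 := S.slab_subset i
  have nodes : ∀ t ∈ ({S.tmid (2 / 3) i, S.right i} : Set ℝ), t ∈ S.slab i := by
    rintro t (rfl | rfl)
    exacts [hm, hr]
  have slice : ∀ {E : Type} [TopologicalSpace E] {f : Sp d → ℝ → E},
      ContinuousOn (Function.uncurry f) (closure Ω ×ˢ Icc 0 T) → ∀ t ∈ Icc 0 T,
      ContinuousOn (fun x => f x t) Ω := fun hf t ht =>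
    hf.comp (continuousOn_id.prodMk continuousOn_const) fun x hx => ⟨subset_closure hx, ht⟩
  refine ⟨⟨1 + x₀, by linarith⟩, ?_⟩
  refine
    { iso := iso
      one_le := NNReal.coe_le_coe.1 (by change (1 : ℝ) ≤ 1 + x₀; linarith)
      pow_le := by
        change (1 + x₀) ^ (d + 2) ≤ 2
        linarith
      pow_sub_le := by
        change (1 + x₀) ^ d - 1 ≤ _
        linarith
      coeff := fun t ht => ?_
      ge := fun x hx => hge x (subset_closure hx) _ (slab0 hr)
      osc := fun x hx => ?_
      small := by linarith
      dt_le := by linarith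
      pos := ha₀
      hA := A0.le
      hκ := hκ.le
      hB := B0
      hc₀ := c₀0 }
  · have htI := slab0 (nodes t ht)
    refine ⟨(slice ha t htI).aestronglyMeasurable hΩ.measurableSet, ?_,
      (slice hc t htI).aestronglyMeasurable hΩ.measurableSet,
      fun x hx => bA x (subset_closure hx) t htI, fun x hx => hvel i t ht x hx,
      fun x hx => bB x (subset_closure hx) t htI⟩
    exact AEStronglyMeasurable.sub ((slice hb t htI).aestronglyMeasurable hΩ.measurableSet)
      (S.tri (nodes t ht)).aestronglyMeasurable_vel
  · change _ ≤ a₀ / 48 - A * ((1 + x₀) ^ (d + 2) - 1)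
    have hFx : (S.mesh i).flow (S.tmid (2 / 3) i) (S.right i) x ∈ Ω :=
      (iso _ hm _ hr).fwd.mapsTo hx
    set y := (S.mesh i).flow (S.tmid (2 / 3) i) (S.right i) x with hy
    have hv : ∀ t ∈ ({S.tmid (2 / 3) i, S.right i} : Set ℝ), ∀ x ∈ Ω,
        ‖(S.mesh i).vel t x‖ ≤ κ + Bb := fun t ht x hx => by
      have e1 := hvel i t ht x hx
      have e2 := bBb x (subset_closure hx) t (slab0 (nodes t ht))
      have e3 : (S.mesh i).vel t x = b x t - (b x t - (S.mesh i).vel t x) := by abel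
      rw [e3]
      exact (norm_sub_le _ _).trans (by linarith)
    have hdiff : S.right i - S.tmid (2 / 3) i = 2 / 3 * S.dt i := by
      rw [right_eq, tmid]; ring
    -- The velocity is bounded at the collocation nodes only. Along a quadratic curve it is affine
    -- in time, so the trapezoid rule gives the displacement between the two nodes exactly from
    -- their two velocities.
    have hyx : ‖y - x‖ ≤ S.dt i * (κ + Bb) := by
      rw [hy, (S.tri hm).flow_sub_eq (S.tri hr) ((S.tri hm).subset_body hx), norm_smul, hdiff,
        Real.norm_of_nonneg (by positivity)]
      have e1 := hv (S.tmid (2 / 3) i) (by simp) x hx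
      have e2 := hv (S.right i) (by simp) y hFx
      calc _ ≤ 2 / 3 * S.dt i / 2 * ((κ + Bb) + (κ + Bb)) := by
            gcongr
            exact (norm_add_le _ _).trans (add_le_add e1 e2)
        _ = S.dt i * (κ + Bb) * (2 / 3) := by ring
        _ ≤ S.dt i * (κ + Bb) * 1 := by gcongr; norm_num
        _ = _ := mul_one _
    have hdist : dist ((x, S.tmid (2 / 3) i) : Sp d × ℝ) (y, S.right i) < δ₁ := by
      rw [Prod.dist_eq, max_lt_iff]
      constructor
      · rw [dist_comm, dist_eq_norm]
        have : 0 < S.dt i := hk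
        linarith
      · rw [dist_comm, Real.dist_eq, hdiff, abs_of_nonneg (by positivity)]
        have : 0 ≤ (κ + Bb) * S.dt i := by positivity
        linarith
    -- Uniform continuity of `a` spends `a₀/96` of the budget `a₀/48`; the other half covers `A * (Λ
    -- ^ (d + 2) - 1)`.
    have h1 := huc _ ⟨subset_closure hx, slab0 hm⟩ _ ⟨subset_closure hFx, slab0 hr⟩ hdist
    rw [Real.dist_eq] at h1
    simp only [Function.uncurry] at h1
    have h2 : A * ((1 + x₀) ^ (d + 2) - 1) ≤ A * (c₀ * S.dt i) := by gcongr
    linarith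

end SpaceTimeMesh

/-! ### Summation over the time partitions -/

/-- `L` and `R` are the energies at the start and the end of a step, with no growth across an
interface. The second conclusion also keeps the accumulated dissipation, from which the sum of
gradients is bounded. -/
theorem discrete_gronwall {α β γ : ℝ} (hα : 0 ≤ α) (hβ : 0 ≤ β) (hγ : 0 ≤ γ) :
    ∀ (n : ℕ) {k L R G D : Fin (n + 1) → ℝ}, (∀ i, 0 ≤ k i) → (∀ i, 0 ≤ L i) →
      (∀ i, 0 ≤ G i) → (∀ i, 0 ≤ D i) → (∀ i, 0 ≤ R i) →
      (∀ i, R i + α * (k i * G i) ≤ (1 + β * k i) * L i + γ * (k i * D i)) →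
      (∀ i : Fin n, L i.succ ≤ R i.castSucc) →
      (∀ i, R i ≤ Real.exp (β * ∑ i, k i) * (L 0 + γ * ∑ i, k i * D i)) ∧
      R (Fin.last n) + α * ∑ i, k i * G i
        ≤ Real.exp (β * ∑ i, k i) * (L 0 + γ * ∑ i, k i * D i) := by
  intro n
  induction n with
  | zero =>
    intro k L R G D hk hL hG hD hR h1 _
    have h2 := h1 0
    have e1 : 1 + β * k 0 ≤ Real.exp (β * k 0) := by linarith [Real.add_one_le_exp (β * k 0)]
    have e2 : 1 ≤ Real.exp (β * k 0) := by linarith [mul_nonneg hβ (hk 0)]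
    have p1 := mul_le_mul_of_nonneg_right e1 (hL 0)
    have p2 := mul_le_mul_of_nonneg_right e2 (mul_nonneg hγ (mul_nonneg (hk 0) (hD 0)))
    have p3 := mul_nonneg hα (mul_nonneg (hk 0) (hG 0))
    have key : R 0 + α * (k 0 * G 0) ≤ Real.exp (β * k 0) * (L 0 + γ * (k 0 * D 0)) := by linarith
    constructor
    · intro i
      have : R 0 ≤ Real.exp (β * k 0) * (L 0 + γ * (k 0 * D 0)) := by linarith
      rw [Fin.fin_one_eq_zero i]
      simpa using this
    · simpa using key
  | succ n ih =>
    intro k L R G D hk hL hG hD hR h1 h2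
    obtain ⟨i1, i2⟩ := ih (k := fun i => k i.castSucc) (L := fun i => L i.castSucc)
      (R := fun i => R i.castSucc) (G := fun i => G i.castSucc) (D := fun i => D i.castSucc)
      (fun i => hk _) (fun i => hL _) (fun i => hG _) (fun i => hD _) (fun i => hR _)
      (fun i => h1 _) (fun i => by
        have := h2 i.castSucc
        rwa [Fin.succ_castSucc] at this)
    simp only [Fin.castSucc_zero] at i1 i2
    rw [Fin.sum_univ_castSucc, Fin.sum_univ_castSucc (f := fun i => k i * D i),
      Fin.sum_univ_castSucc (f := fun i => k i * G i)]
    set σ := ∑ i : Fin (n + 1), k i.castSucc with hσ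
    set Δ := ∑ i : Fin (n + 1), k i.castSucc * D i.castSucc with hΔ
    set Γ := ∑ i : Fin (n + 1), k i.castSucc * G i.castSucc with hΓ
    set l := Fin.last (n + 1) with hl
    have hσ0 : 0 ≤ σ := Finset.sum_nonneg fun i _ => hk _
    have hΔ0 : 0 ≤ Δ := Finset.sum_nonneg fun i _ => mul_nonneg (hk _) (hD _)
    have hΓ0 : 0 ≤ Γ := Finset.sum_nonneg fun i _ => mul_nonneg (hk _) (hG _)
    have hkD := mul_nonneg (hk l) (hD l)
    have hkG := mul_nonneg (hk l) (hG l)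
    have hX : Real.exp (β * (σ + k l)) = Real.exp (β * k l) * Real.exp (β * σ) := by
      rw [← Real.exp_add]; ring_nf
    have e1 : 1 + β * k l ≤ Real.exp (β * k l) := by linarith [Real.add_one_le_exp (β * k l)]
    have hβk := mul_nonneg hβ (hk l)
    have e2 : 1 ≤ Real.exp (β * k l) := by linarith
    have e3 : 1 ≤ Real.exp (β * (σ + k l)) := by
      rw [Real.one_le_exp_iff]; exact mul_nonneg hβ (add_nonneg hσ0 (hk l))
    set Y := Real.exp (β * σ) * (L 0 + γ * Δ) with hY
    have hY0 : 0 ≤ Y := mul_nonneg (Real.exp_pos _).le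
      (add_nonneg (hL 0) (mul_nonneg hγ hΔ0))
    have hYX : Real.exp (β * k l) * Y + γ * (k l * D l)
        ≤ Real.exp (β * (σ + k l)) * (L 0 + γ * (Δ + k l * D l)) := by
      have q := mul_le_mul_of_nonneg_right e3 (mul_nonneg hγ hkD)
      rw [hX] at q ⊢
      rw [hY]
      linarith
    have h3 := h1 l
    have h4 : L l ≤ R (Fin.last n).castSucc := by
      have := h2 (Fin.last n)
      rwa [Fin.succ_last] at this
    have h5 : (1 + β * k l) * L l ≤ (1 + β * k l) * R (Fin.last n).castSucc :=
      mul_le_mul_of_nonneg_left h4 (by linarith)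
    -- The dissipation accumulated so far is multiplied along with the energy; the surplus factor on
    -- it is nonnegative and is discarded.
    have h6 : (1 + β * k l) * (R (Fin.last n).castSucc + α * Γ) ≤ Real.exp (β * k l) * Y :=
      mul_le_mul e1 i2 (add_nonneg (hR _) (mul_nonneg hα hΓ0)) (Real.exp_pos _).le
    have h7 : 0 ≤ β * k l * (α * Γ) := mul_nonneg hβk (mul_nonneg hα hΓ0)
    have key : R l + α * (Γ + k l * G l)
        ≤ Real.exp (β * (σ + k l)) * (L 0 + γ * (Δ + k l * D l)) := by linarith
    refine ⟨fun i => ?_, key⟩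
    refine Fin.lastCases ?_ (fun j => ?_) i
    · have := mul_nonneg hα (add_nonneg hΓ0 hkG)
      linarith
    · have q := mul_le_mul_of_nonneg_right e2 hY0
      have := mul_nonneg hγ hkD
      linarith [i1 j]

/-- Testing with `P` itself gives `‖P‖² = (Q, P)`, and Cauchy-Schwarz finishes. It serves both at
the interfaces and for the initial value. -/
theorem norm0Sq_le_of_projection {V : Set (Sp d → ℝ)} {P Q : Sp d → ℝ} (hP : P ∈ V)
    (mP : MemLp P 2 (volume.restrict Ω)) (mQ : MemLp Q 2 (volume.restrict Ω))
    (h : ∀ χ ∈ V, ip Ω P χ = ip Ω Q χ) : norm0Sq Ω P ≤ norm0Sq Ω Q := by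
  have h1 : norm0Sq Ω P ≤ √(norm0Sq Ω Q) * √(norm0Sq Ω P) := by
    have := (le_abs_self _).trans (abs_ip_le mQ mP)
    rwa [← h P hP, ip_self] at this
  have h2 := sqrt_mul_sqrt_le (norm0Sq_nonneg Ω Q) (norm0Sq_nonneg Ω P) (ε := 1 / 2) (by norm_num)
  linarith

theorem weightedSemiSq_bounds (hΩ : IsOpen Ω) {α : Sp d → ℝ} {lo hi : ℝ}
    (hm : AEStronglyMeasurable α (volume.restrict Ω)) (hlo : ∀ x ∈ Ω, lo ≤ α x)
    (hhi : ∀ x ∈ Ω, |α x| ≤ hi) {v : Sp d → ℝ} (hv : MemH1 Ω v) :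
    lo * semi1Sq Ω v ≤ weightedSemiSq Ω α v ∧ weightedSemiSq Ω α v ≤ hi * semi1Sq Ω v := by
  have hi1 := integrable_norm_sq_of_memLp hv.isWeakGrad.1
  have hae : ∀ᵐ x ∂(volume.restrict Ω), x ∈ Ω := ae_restrict_mem hΩ.measurableSet
  have hi2 : Integrable (fun x => α x * ‖wgrad Ω v x‖ ^ 2) (volume.restrict Ω) :=
    hi1.bdd_mul (c := hi) hm (by filter_upwards [hae] with x hx using hhi x hx)
  rw [semi1Sq, ← integral_const_mul, ← integral_const_mul, weightedSemiSq]
  constructor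
  · refine integral_mono_ae (hi1.const_mul _) hi2 ?_
    filter_upwards [hae] with x hx
    exact mul_le_mul_of_nonneg_right (hlo x hx) (sq_nonneg _)
  · refine integral_mono_ae hi2 (hi1.const_mul _) ?_
    filter_upwards [hae] with x hx
    exact mul_le_mul_of_nonneg_right ((le_abs_self _).trans (hhi x hx)) (sq_nonneg _)

namespace SpaceTimeMesh

variable {T : ℝ} {S : SpaceTimeMesh d Ω T} {i : Fin (S.N + 1)} {Λ : ℝ≥0}
  {a : Sp d → ℝ → ℝ} {b : Sp d → ℝ → Sp d} {c : Sp d → ℝ → ℝ} {A κ B a₀ c₀ : ℝ}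
  {f g : Sp d → ℝ → ℝ} {u₀ : Sp d → ℝ} {u : ℝ → Sp d → ℝ} {uh χ : S.SlabFun}

theorem left_succ (i : Fin S.N) : S.left i.succ = S.right i.castSucc := by
  rw [left, right, Fin.succ_castSucc]

theorem sum_dt : ∑ i, S.dt i = T := by
  have := Fin.sum_univ_castSucc (fun i : Fin (S.N + 2) => S.time i)
  have h2 := Fin.sum_univ_succ (fun i : Fin (S.N + 2) => S.time i)
  simp only [dt, right, left, Finset.sum_sub_distrib]
  rw [S.time_zero] at h2
  rw [S.time_last] at this
  linarith

theorem slabTerm_nonneg (w : ℝ → Sp d → ℝ) : 0 ≤ S.slabTerm i w := by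
  have h1 := norm1Sq_nonneg Ω (S.trap (2 / 3) i w)
  have h2 := norm1Sq_nonneg Ω (w (S.zeta (2 / 3) i))
  have h3 := norm1Sq_nonneg Ω (w (S.right i))
  rw [slabTerm]
  positivity

theorem energySq_eq (v : S.SlabFun) : S.energySq (2 / 3) v = max (norm0Sq Ω (v 0 0))
    (⨆ i, max (norm0Sq Ω (v i (S.tmid (2 / 3) i))) (norm0Sq Ω (v i (S.right i))))
    + ∑ i, S.dt i * S.slabTerm i (v i) := rfl

theorem le_energySq (v : S.SlabFun) :
    norm0Sq Ω (v 0 0) + ∑ i, S.dt i * S.slabTerm i (v i) ≤ S.energySq (2 / 3) v := by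
  rw [energySq_eq]
  gcongr
  exact le_max_left _ _

theorem sum_slabTerm_nonneg (v : S.SlabFun) : 0 ≤ ∑ i, S.dt i * S.slabTerm i (v i) :=
  Finset.sum_nonneg fun i _ => mul_nonneg (S.dt_pos i).le (slabTerm_nonneg _)

theorem energySq_le {v : S.SlabFun} {X Y : ℝ} (h0 : norm0Sq Ω (v 0 0) ≤ X)
    (h1 : ∀ i, norm0Sq Ω (v i (S.tmid (2 / 3) i)) ≤ X) (h2 : ∀ i, norm0Sq Ω (v i (S.right i)) ≤ X)
    (hY : ∑ i, S.dt i * S.slabTerm i (v i) ≤ Y) : S.energySq (2 / 3) v ≤ X + Y := by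
  rw [energySq_eq]
  exact add_le_add (max_le h0 (ciSup_le fun i => max_le (h1 i) (h2 i))) hY

/-! ### The triangle inequality for the energy semi-norm. -/

/-- Functions with enough regularity on every time partition for the energy semi-norm. -/
structure Regular (S : SpaceTimeMesh d Ω T) (v : S.SlabFun) : Prop where
  memH1 : ∀ i, ∀ t ∈ S.slab i, MemH1 Ω (v i t)
  trap : ∀ i, MemH1 Ω (S.trap (2 / 3) i (v i))
  diff : ∀ i, ∀ t ∈ S.slab i, S.DiffAlong i (v i) t
  memLp : ∀ i, ∀ t ∈ ({S.tmid (2 / 3) i, S.right i} : Set ℝ),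
    MemLp (S.charDeriv i (v i) t) 2 (volume.restrict Ω)

theorem DiffAlong.sub {w w' : ℝ → Sp d → ℝ} {t : ℝ} (hw : S.DiffAlong i w t)
    (hw' : S.DiffAlong i w' t) : S.DiffAlong i (fun s x => w s x - w' s x) t := by
  filter_upwards [hw, hw'] with x h1 h2
  exact h1.sub h2

theorem Regular.sub {v w : S.SlabFun} (hv : S.Regular v) (hw : S.Regular w) :
    S.Regular (fun i t x => v i t x - w i t x) where
  memH1 i t ht := (hv.memH1 i t ht).sub (hw.memH1 i t ht)
  trap i := by rw [trap_sub]; exact (hv.trap i).sub (hw.trap i)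
  diff i t ht := (hv.diff i t ht).sub (hw.diff i t ht)
  memLp i t ht := by
    have hts : t ∈ S.slab i := by
      rcases ht with rfl | rfl
      exacts [S.tmid_mem i, S.right_mem i]
    exact memLp_charDeriv_sub (hv.diff i t hts) (hw.diff i t hts) (hv.memLp i t ht) (hw.memLp i t ht)

theorem regular_of_fe (hΩ : IsOpen Ω) [IsFiniteMeasure (volume.restrict Ω)] {z : S.SlabFun}
    (hz : ∀ i, (S.mesh i).IsFEFunction (S.slab i) (z i)) : S.Regular z where
  memH1 i := memH1_fe hΩ (hz i)
  trap i := (S.tri (S.tmid_mem i)).memH1 hΩ (trap_mem (hz i))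
  diff i _ ht := diffAlong_fe (hz i) ht
  memLp i t ht := by
    rcases ht with rfl | rfl
    exacts [(memLp_charDeriv_fe hΩ (hz i)).1, (memLp_charDeriv_fe hΩ (hz i)).2]

theorem IsWeakSolution.regular (hΩ : IsOpen Ω) [IsFiniteMeasure (volume.restrict Ω)]
    (hiso : ∀ i, ∃ Λ, S.HasDistortion i Λ)
    (hu : S.IsWeakSolution a b c f g u₀ u) (hu2 : S.HasSecondCharDeriv u) :
    S.Regular (fun _ => u) where
  memH1 i t ht := hu.1 t (S.slab_subset i ht)
  trap i := by
    obtain ⟨Λ, h⟩ := hiso i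
    exact memH1_trap hΩ h fun t ht => hu.1 t (S.slab_subset i ht)
  diff i _ ht := by
    obtain ⟨Λ, h⟩ := hiso i
    exact hu2.diffAlong h ht
  memLp i t ht := by
    rcases ht with rfl | rfl
    exacts [(hu.2.1 i _ (S.tmid_mem_Ioc i)).1, (hu.2.1 i _ (S.right_mem_Ioc i)).1]

theorem slabTerm_sub_le (hΩ : IsOpen Ω) [IsFiniteMeasure (volume.restrict Ω)] {v w : S.SlabFun}
    (hv : S.Regular v) (hw : S.Regular w) (i : Fin (S.N + 1)) :
    S.slabTerm i (fun t x => v i t x - w i t x)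
      ≤ 2 * S.slabTerm i (v i) + 2 * S.slabTerm i (w i) := by
  have hV : ∀ {t}, t ∈ S.slab i → ∀ χ ∈ (S.mesh i).sliceSpace t, MemLp χ 2 (volume.restrict Ω) :=
    fun ht χ hχ => ((S.tri ht).memH1 hΩ hχ).1
  have hm := S.tmid_mem i
  have hr := S.right_mem i
  have hζ := S.zeta_mem i
  have n1 := negNorm_sub_sq_le (hv.memLp i (S.tmid (2 / 3) i) (by simp))
    (hw.memLp i (S.tmid (2 / 3) i) (by simp)) (hV hm)
  have n2 := negNorm_sub_sq_le (hv.memLp i (S.right i) (by simp))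
    (hw.memLp i (S.right i) (by simp)) (hV hr)
  rw [← negNorm_congr (charDeriv_sub (hv.diff i _ hm) (hw.diff i _ hm))] at n1
  rw [← negNorm_congr (charDeriv_sub (hv.diff i _ hr) (hw.diff i _ hr))] at n2
  have n3 := norm1Sq_sub_le hΩ (hv.trap i) (hw.trap i)
  have n4 := norm1Sq_sub_le hΩ (hv.memH1 i _ hζ) (hw.memH1 i _ hζ)
  have n5 := norm1Sq_sub_le hΩ (hv.memH1 i _ hr) (hw.memH1 i _ hr)
  simp only [slabTerm]
  rw [trap_sub]
  linarith

theorem energySq_sub_le (hΩ : IsOpen Ω) [IsFiniteMeasure (volume.restrict Ω)] {v w : S.SlabFun}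
    (hv : S.Regular v) (hw : S.Regular w) {X Y : ℝ} (h0 : norm0Sq Ω (w 0 0) ≤ X)
    (h1 : ∀ i, norm0Sq Ω (w i (S.tmid (2 / 3) i)) ≤ X) (h2 : ∀ i, norm0Sq Ω (w i (S.right i)) ≤ X)
    (hY : ∑ i, S.dt i * S.slabTerm i (w i) ≤ Y) :
    S.energySq (2 / 3) (fun i t x => v i t x - w i t x)
      ≤ 2 * S.energySq (2 / 3) v + 2 * (X + Y) := by
  set M := max (norm0Sq Ω (v 0 0))
    (⨆ i, max (norm0Sq Ω (v i (S.tmid (2 / 3) i))) (norm0Sq Ω (v i (S.right i)))) with hM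
  have hn : ∀ i, max (norm0Sq Ω (v i (S.tmid (2 / 3) i))) (norm0Sq Ω (v i (S.right i))) ≤ M :=
    fun i => (le_ciSup (f := fun i => max (norm0Sq Ω (v i (S.tmid (2 / 3) i)))
      (norm0Sq Ω (v i (S.right i)))) (finite_range _).bddAbove i).trans (le_max_right _ _)
  have hz : (0 : ℝ) ∈ S.slab 0 := by rw [← S.left_zero]; exact S.left_mem 0
  have hle := energySq_le (v := fun i t x => v i t x - w i t x) (X := 2 * M + 2 * X)
    (Y := 2 * (∑ i, S.dt i * S.slabTerm i (v i)) + 2 * Y) ?_ ?_ ?_ ?_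
  · rw [energySq_eq v]
    linarith
  · refine (norm0Sq_sub_le (hv.memH1 0 _ hz).1 (hw.memH1 0 _ hz).1).trans ?_
    have := le_max_left (norm0Sq Ω (v 0 0))
      (⨆ i, max (norm0Sq Ω (v i (S.tmid (2 / 3) i))) (norm0Sq Ω (v i (S.right i))))
    linarith
  · intro i
    refine (norm0Sq_sub_le (hv.memH1 i _ (S.tmid_mem i)).1 (hw.memH1 i _ (S.tmid_mem i)).1).trans ?_
    linarith [(le_max_left _ _).trans (hn i), h1 i]
  · intro i
    refine (norm0Sq_sub_le (hv.memH1 i _ (S.right_mem i)).1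
      (hw.memH1 i _ (S.right_mem i)).1).trans ?_
    linarith [(le_max_right _ _).trans (hn i), h2 i]
  · calc _ ≤ ∑ i, S.dt i * (2 * S.slabTerm i (v i) + 2 * S.slabTerm i (w i)) :=
          Finset.sum_le_sum fun i _ =>
            mul_le_mul_of_nonneg_left (slabTerm_sub_le hΩ hv hw i) (S.dt_pos i).le
      _ = 2 * (∑ i, S.dt i * S.slabTerm i (v i)) + 2 * ∑ i, S.dt i * S.slabTerm i (w i) := by
          rw [Finset.mul_sum, Finset.mul_sum, ← Finset.sum_add_distrib]
          exact Finset.sum_congr rfl fun i _ => by ring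
      _ ≤ _ := by linarith

/-! ### The interfaces between time partitions and the initial values -/

theorem feSpace_sub (hΩ : IsOpen Ω) [IsFiniteMeasure (volume.restrict Ω)] {φ ψ : S.SlabFun}
    (hφ : φ ∈ S.feSpace) (hψ : ψ ∈ S.feSpace) :
    (fun i t x => φ i t x - ψ i t x) ∈ S.feSpace := by
  refine ⟨fun i => (hφ.1 i).sub (hψ.1 i), fun i χ hχ => ?_⟩
  have mχ := ((S.tri (S.left_mem i.succ)).memH1 hΩ hχ).1
  have m : ∀ {φ : S.SlabFun}, φ ∈ S.feSpace → ∀ i, ∀ t ∈ S.slab i,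
      MemLp (φ i t) 2 (volume.restrict Ω) := fun hφ i t ht => (memH1_fe hΩ (hφ.1 i) t ht).1
  rw [ip_sub_left (m hφ _ _ (S.left_mem _)) (m hψ _ _ (S.left_mem _)) mχ,
    ip_sub_left (m hφ _ _ (S.right_mem _)) (m hψ _ _ (S.right_mem _)) mχ, hφ.2 i χ hχ, hψ.2 i χ hχ]

theorem norm0Sq_left_succ_le (hΩ : IsOpen Ω) [IsFiniteMeasure (volume.restrict Ω)]
    {φ : S.SlabFun} (hφ : φ ∈ S.feSpace) (i : Fin S.N) :
    norm0Sq Ω (φ i.succ (S.left i.succ)) ≤ norm0Sq Ω (φ i.castSucc (S.right i.castSucc)) :=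
  norm0Sq_le_of_projection ((hφ.1 _).mem_sliceSpace (S.left_mem _))
    (memH1_fe hΩ (hφ.1 _) _ (S.left_mem _)).1 (memH1_fe hΩ (hφ.1 _) _ (S.right_mem _)).1 (hφ.2 i)

/-- The stability assumption uses the same weight `a(t_i)` on both sides of the interface; replacing
it by its bounds `a₀` and `A` costs the ratio `A / a₀`. -/
theorem semi1Sq_left_succ_le (hΩ : IsOpen Ω) [IsFiniteMeasure (volume.restrict Ω)]
    {φ : S.SlabFun} (hφ : φ ∈ S.feSpace) (i : Fin S.N)
    (h : StepBounds S i.castSucc Λ a b c A κ B a₀ c₀) {K : ℝ} (hK : K ≤ 7 / 2)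
    (hst : S.IsStabilityConstant a K) :
    semi1Sq Ω (φ i.succ (S.left i.succ))
      ≤ 7 / 2 * (A / a₀) * semi1Sq Ω (φ i.castSucc (S.right i.castSucc)) := by
  have h1 := hst φ hφ i
  rw [S.left_succ i] at h1 ⊢
  have mL : MemH1 Ω (φ i.succ (S.right i.castSucc)) := by
    rw [← S.left_succ]; exact memH1_fe hΩ (hφ.1 _) _ (S.left_mem _)
  have mR := memH1_fe hΩ (hφ.1 i.castSucc) _ (S.right_mem _)
  have b1 := (weightedSemiSq_bounds hΩ h.coeff_right.mα h.ge h.coeff_right.bα mL).1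
  have b2 := weightedSemiSq_bounds hΩ h.coeff_right.mα h.ge h.coeff_right.bα mR
  have p := semi1Sq_nonneg Ω (φ i.castSucc (S.right i.castSucc))
  have h3 := mul_le_mul_of_nonneg_right hK ((mul_nonneg h.pos.le p).trans b2.1)
  have h4 : a₀ * semi1Sq Ω (φ i.succ (S.right i.castSucc))
    ≤ 7 / 2 * (A * semi1Sq Ω (φ i.castSucc (S.right i.castSucc))) := by linarith
  have h5 : 7 / 2 * (A / a₀) * semi1Sq Ω (φ i.castSucc (S.right i.castSucc))
    = (7 / 2 * (A * semi1Sq Ω (φ i.castSucc (S.right i.castSucc)))) / a₀ := by ring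
  rw [h5, le_div_iff₀ h.pos]
  linarith

/-- The energy semi-norm contains no gradient at the start of a step, but the value there is twice
the trapezoid average minus the value at the middle basis node. The constant `16` is `2 * 2²` from
the difference times `2` from transport. -/
theorem semi1Sq_left_le (hΩ : IsOpen Ω) [IsFiniteMeasure (volume.restrict Ω)]
    (h : StepBounds S i Λ a b c A κ B a₀ c₀) {w : ℝ → Sp d → ℝ}
    (hw : ∀ t ∈ S.slab i, MemH1 Ω (w t)) :
    semi1Sq Ω (w (S.left i)) ≤ 16 * S.slabTerm i w := by
  have hl := S.left_mem i
  have hm := S.tmid_mem i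
  have hζ := S.zeta_mem i
  have mt := memH1_trap hΩ h.iso hw
  have hae : w (S.left i) =ᵐ[volume.restrict Ω] fun x =>
      2 * S.trap (2 / 3) i w ((S.mesh i).flow (S.left i) (S.tmid (2 / 3) i) x)
        - w (S.zeta (2 / 3) i) ((S.mesh i).flow (S.left i) (S.zeta (2 / 3) i) x) := by
    filter_upwards [(S.tri hl).ae_mem_body] with x hx
    rw [trap, (S.tri hl).shift_flow (S.tri hm) w _ hx, (S.tri hl).shift_flow (S.tri hm) w _ hx,
      (S.tri hl).shift_self w hx, MovingMesh.shift]
    ring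
  have m1 := (h.iso _ hl _ hm).memH1_comp hΩ mt
  have m2 := (h.iso _ hl _ hζ).memH1_comp hΩ (hw _ hζ)
  have h1 := semi1Sq_sub_le hΩ (m1.const_mul 2) m2
  rw [semi1Sq_const_mul hΩ m1] at h1
  have h2 := h.semi1Sq_comp_le hΩ hl hm mt
  have h3 := h.semi1Sq_comp_le hΩ hl hζ (hw _ hζ)
  rw [semi1Sq_congr hae]
  have h4 := semi1Sq_le_norm1Sq Ω (S.trap (2 / 3) i w)
  have h5 := semi1Sq_le_norm1Sq Ω (w (S.zeta (2 / 3) i))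
  have h6 := norm1Sq_nonneg Ω (w (S.zeta (2 / 3) i))
  have h7 := norm1Sq_nonneg Ω (w (S.right i))
  rw [slabTerm]
  linarith [sq_nonneg (negNorm Ω ((S.mesh i).sliceSpace (S.tmid (2 / 3) i))
    (S.charDeriv i w (S.tmid (2 / 3) i))),
    sq_nonneg (negNorm Ω ((S.mesh i).sliceSpace (S.right i)) (S.charDeriv i w (S.right i)))]

/-- Both `u(0)` and `u_h(0)` represent `u₀` against finite element functions, so the initial
discrete error is the `L²`-projection of the initial approximation error. -/
theorem ip_initial (hΩ : IsOpen Ω) [IsFiniteMeasure (volume.restrict Ω)] (hT : 0 < T)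
    (hu : S.IsWeakSolution a b c f g u₀ u) (huh : S.IsDiscreteSolution (2 / 3) a b c f g u₀ uh)
    (hχ : χ ∈ S.feSpace) :
    ∀ v ∈ (S.mesh 0).sliceSpace 0,
      ip Ω (fun x => uh 0 0 x - χ 0 0 x) v = ip Ω (fun x => u 0 x - χ 0 0 x) v := by
  intro v hv
  have hz : (0 : ℝ) ∈ S.slab 0 := by rw [← S.left_zero]; exact S.left_mem 0
  have mv := (S.tri hz).memH1 hΩ hv
  rw [ip_sub_left (memH1_fe hΩ (huh.1.1 0) _ hz).1 (memH1_fe hΩ (hχ.1 0) _ hz).1 mv.1,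
    ip_sub_left (hu.1 0 ⟨le_rfl, hT.le⟩).1 (memH1_fe hΩ (hχ.1 0) _ hz).1 mv.1, huh.2.1 v hv,
    hu.2.2 v mv]

end SpaceTimeMesh

/-! ### The error estimate -/

namespace SpaceTimeMesh

variable {T : ℝ} {S : SpaceTimeMesh d Ω T}
  {a : Sp d → ℝ → ℝ} {b : Sp d → ℝ → Sp d} {c : Sp d → ℝ → ℝ} {A κ B a₀ c₀ : ℝ}
  {f g : Sp d → ℝ → ℝ} {u₀ : Sp d → ℝ} {u : ℝ → Sp d → ℝ} {uh χ : S.SlabFun}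

/-- The constant in the bound for the `L²` norms of the discrete error. -/
def gronwallConst (A κ B a₀ c₀ T : ℝ) : ℝ :=
  Real.exp (7 * growthConst a₀ κ B c₀ * T)
    * (1 + 100 / a₀ * (4 * (1 + (A + κ + B) ^ 2)))

/-- The constant of the error estimate. -/
def errorConst (A κ B a₀ c₀ T C_H : ℝ) : ℝ :=
  2 + 2 * (gronwallConst A κ B a₀ c₀ T
    + stabConst a₀ (A + κ + B) * (gronwallConst A κ B a₀ c₀ T + 4 * (1 + (A + κ + B) ^ 2))
    + stabConst a₀ (A + κ + B) * (T * gronwallConst A κ B a₀ c₀ T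
      + gronwallConst A κ B a₀ c₀ T / (a₀ / 24) + 4 * (1 + (A + κ + B) ^ 2)
      + (16 * C_H ^ 2 + 2 * (7 / 2 * (A / a₀)) * (gronwallConst A κ B a₀ c₀ T / (a₀ / 24)))))

theorem gronwallConst_pos (ha : 0 < a₀) : 0 < gronwallConst A κ B a₀ c₀ T := by
  rw [gronwallConst]
  positivity

theorem stabConst_pos (ha : 0 < a₀) (K : ℝ) : 0 < stabConst a₀ K := by
  rw [stabConst]
  positivity

theorem errorConst_pos (ha : 0 < a₀) (hA : 0 ≤ A) (hT : 0 ≤ T) (C_H : ℝ) :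
    0 < errorConst A κ B a₀ c₀ T C_H := by
  have h1 := gronwallConst_pos (A := A) (κ := κ) (B := B) (c₀ := c₀) (T := T) ha
  have h2 := stabConst_pos ha (A + κ + B)
  rw [errorConst]
  positivity

/-- The discrete error against any comparison function in the finite element space. -/
theorem energySq_error_le (hΩ : IsOpen Ω) [IsFiniteMeasure (volume.restrict Ω)] (hT : 0 < T)
    (ha : 0 < a₀) (hA : 0 ≤ A) (hB : 0 ≤ B) (hc₀ : 0 ≤ c₀)
    (hsb : ∀ i, ∃ Λ, StepBounds S i Λ a b c A κ B a₀ c₀) {K C_H : ℝ} (hK : K ≤ 7 / 2)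
    (hst : S.IsStabilityConstant a K) (hproj : S.InitialProjectionStable C_H)
    (hgr : ∀ i : Fin S.N, S.dt i.succ ≤ 2 * S.dt i.castSucc)
    (hu : S.IsWeakSolution a b c f g u₀ u) (hu2 : S.HasSecondCharDeriv u)
    (huh : S.IsDiscreteSolution (2 / 3) a b c f g u₀ uh) (hχ : χ ∈ S.feSpace) :
    S.energySq (2 / 3) (fun i t x => u t x - uh i t x) ≤ errorConst A κ B a₀ c₀ T C_H *
      (S.energySq (2 / 3) (fun i t x => u t x - χ i t x)
        + ∑ i, ∫ t in (S.left i)..(S.right i),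
            norm1Sq Ω (fun x => S.dt i ^ 2 * S.charDeriv i (S.charDeriv i u) t x)) := by
  have hzfe : (fun i t x => uh i t x - χ i t x) ∈ S.feSpace := feSpace_sub hΩ huh.1 hχ
  have hreg : S.Regular (fun i t x => u t x - χ i t x) :=
    (hu.regular hΩ (fun i => (hsb i).imp fun _ h => h.iso) hu2).sub (regular_of_fe hΩ hχ.1)
  have hregz := regular_of_fe hΩ hzfe.1
  have h_start := ip_initial hΩ hT hu huh hχ
  choose Λ hΛ using hsb
  set E : S.SlabFun := fun i t x => u t x - χ i t x with hE
  obtain ⟨z, hz⟩ : ∃ z : S.SlabFun, z = fun i t x => uh i t x - χ i t x := ⟨_, rfl⟩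
  have hsplit : (fun (i : Fin (S.N + 1)) t x => u t x - uh i t x)
      = fun i t x => E i t x - z i t x := by
    rw [hz]
    ext i t x
    simp only [hE]
    ring
  rw [← hz] at hzfe hregz
  have hstep := fun i => discrete_error_step hΩ (hΛ i) hu hu2 huh hχ (z := z i) (by rw [hz])
  choose G D hG hD hDE hsG hen hmid hslab using hstep
  set ρ : Fin (S.N + 1) → ℝ := fun i => ∫ t in (S.left i)..(S.right i),
    norm1Sq Ω (fun x => S.dt i ^ 2 * S.charDeriv i (S.charDeriv i u) t x) with hρ
  have hρ0 : ∀ i, 0 ≤ ρ i := fun i =>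
    intervalIntegral.integral_nonneg (S.right_mem i).1 fun t _ => norm1Sq_nonneg _ _
  set e₀ := S.energySq (2 / 3) E with he₀
  set Q := e₀ + ∑ i, ρ i with hQ
  have hρs : 0 ≤ ∑ i, ρ i := Finset.sum_nonneg fun i _ => hρ0 i
  have hle := le_energySq E
  have hs0 := sum_slabTerm_nonneg E
  have hn0 := norm0Sq_nonneg Ω (E 0 0)
  have hQ0 : 0 ≤ Q := by linarith
  set C₃ := 4 * (1 + (A + κ + B) ^ 2) with hC₃
  set C₁ := stabConst a₀ (A + κ + B) with hC₁
  set X := gronwallConst A κ B a₀ c₀ T with hX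
  have hC₃0 : 0 ≤ C₃ := by positivity
  have hC₁0 : 0 ≤ C₁ := (stabConst_pos ha _).le
  have hX0 : 0 ≤ X := (gronwallConst_pos ha).le
  -- the data
  have hsumD : ∑ i, S.dt i * D i ≤ C₃ * Q := by
    calc _ ≤ ∑ i, C₃ * (S.dt i * S.slabTerm i (E i) + ρ i) := Finset.sum_le_sum fun i _ => hDE i
      _ = C₃ * (∑ i, S.dt i * S.slabTerm i (E i) + ∑ i, ρ i) := by
        rw [← Finset.mul_sum, Finset.sum_add_distrib]
      _ ≤ C₃ * Q := by gcongr; linarith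
  have hkD0 : ∀ i, 0 ≤ S.dt i * D i := fun i => mul_nonneg (S.dt_pos i).le (hD i)
  have hkD : ∀ i, S.dt i * D i ≤ C₃ * Q := fun i =>
    (Finset.single_le_sum (fun i _ => hkD0 i) (Finset.mem_univ i)).trans hsumD
  -- the initial values
  have hmem0 : (0 : ℝ) ∈ S.slab 0 := by rw [← S.left_zero]; exact S.left_mem 0
  have hz0s : z 0 0 ∈ (S.mesh 0).sliceSpace 0 := (hzfe.1 0).mem_sliceSpace hmem0
  have h_start' : ∀ v ∈ (S.mesh 0).sliceSpace 0, ip Ω (z 0 0) v = ip Ω (E 0 0) v := by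
    rw [hz]; exact h_start
  have hL0 : norm0Sq Ω (z 0 (S.left 0)) ≤ Q := by
    rw [S.left_zero]
    have := norm0Sq_le_of_projection hz0s (hregz.memH1 0 _ hmem0).1 (hreg.memH1 0 _ hmem0).1 h_start'
    linarith
  -- The `H¹`-stability of the initial projection reduces this to the gradient of `E` at time `0`,
  -- which the first step's part of the energy semi-norm controls with weight `Δt`.
  have hsL0 : S.dt 0 * semi1Sq Ω (z 0 (S.left 0)) ≤ 16 * C_H ^ 2 * Q := by
    rw [S.left_zero]
    have h1 := hproj _ (hreg.memH1 0 _ hmem0) _ hz0s h_start'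
    have h2 : semi1Sq Ω (z 0 0) ≤ C_H ^ 2 * semi1Sq Ω (E 0 0) := by
      have := pow_le_pow_left₀ (Real.sqrt_nonneg _) h1 2
      rwa [mul_pow, Real.sq_sqrt (semi1Sq_nonneg _ _), Real.sq_sqrt (semi1Sq_nonneg _ _)] at this
    have h3 := semi1Sq_left_le hΩ (hΛ 0) (hreg.memH1 0)
    rw [S.left_zero] at h3
    have h4 : S.dt 0 * S.slabTerm 0 (E 0) ≤ Q := by
      have := Finset.single_le_sum (f := fun i => S.dt i * S.slabTerm i (E i))
        (fun i _ => mul_nonneg (S.dt_pos i).le (slabTerm_nonneg _)) (Finset.mem_univ 0)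
      linarith
    calc _ ≤ S.dt 0 * (C_H ^ 2 * (16 * S.slabTerm 0 (E 0))) := by
          have := (S.dt_pos 0).le
          gcongr
          exact h2.trans (by gcongr)
      _ = 16 * C_H ^ 2 * (S.dt 0 * S.slabTerm 0 (E 0)) := by ring
      _ ≤ _ := by gcongr
  -- summation
  obtain ⟨hR, hlast⟩ := discrete_gronwall (α := a₀ / 24) (β := 7 * growthConst a₀ κ B c₀)
    (γ := 100 / a₀) (by positivity)
    (mul_nonneg (by norm_num) (growthConst_pos ha hB hc₀).le) (by positivity) S.N
    (k := S.dt) (L := fun i => norm0Sq Ω (z i (S.left i)))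
    (R := fun i => norm0Sq Ω (z i (S.right i))) (G := G) (D := D)
    (fun i => (S.dt_pos i).le) (fun i => norm0Sq_nonneg _ _) hG hD (fun i => norm0Sq_nonneg _ _)
    hen (norm0Sq_left_succ_le hΩ hzfe)
  have hXQ : Real.exp (7 * growthConst a₀ κ B c₀ * ∑ i, S.dt i)
      * (norm0Sq Ω (z 0 (S.left 0)) + 100 / a₀ * ∑ i, S.dt i * D i) ≤ X * Q := by
    rw [sum_dt]
    calc _ ≤ Real.exp (7 * growthConst a₀ κ B c₀ * T) * (Q + 100 / a₀ * (C₃ * Q)) := by gcongr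
      _ = X * Q := by rw [hX, gronwallConst]; ring
  have hR' : ∀ i, norm0Sq Ω (z i (S.right i)) ≤ X * Q := fun i => (hR i).trans hXQ
  have hexp : 1 ≤ X := by
    have h1 : 1 ≤ Real.exp (7 * growthConst a₀ κ B c₀ * T) :=
      Real.one_le_exp (mul_nonneg (mul_nonneg (by norm_num)
        (growthConst_pos ha hB hc₀).le) hT.le)
    have h2 : 0 ≤ 100 / a₀ * (4 * (1 + (A + κ + B) ^ 2)) := by positivity
    rw [hX, gronwallConst]
    nlinarith
  have hL : ∀ i, norm0Sq Ω (z i (S.left i)) ≤ X * Q := fun i => by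
    refine Fin.cases ?_ (fun j => ?_) i
    · exact hL0.trans (le_mul_of_one_le_left hQ0 hexp)
    · exact (norm0Sq_left_succ_le hΩ hzfe j).trans (hR' _)
  have hkG0 : ∀ i, 0 ≤ S.dt i * G i := fun i => mul_nonneg (S.dt_pos i).le (hG i)
  -- The gradients are bounded by the dissipation part of Gronwall's estimate, after division by
  -- `a₀/24`.
  have hsumG : ∑ i, S.dt i * G i ≤ X / (a₀ / 24) * Q := by
    rw [div_mul_eq_mul_div, le_div_iff₀ (by positivity)]
    have := norm0Sq_nonneg Ω (z (Fin.last S.N) (S.right (Fin.last S.N)))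
    linarith
  have hsumL : ∑ i, S.dt i * norm0Sq Ω (z i (S.left i)) ≤ T * X * Q := by
    calc _ ≤ ∑ i, S.dt i * (X * Q) := Finset.sum_le_sum fun i _ =>
          mul_le_mul_of_nonneg_left (hL i) (S.dt_pos i).le
      _ = _ := by rw [← Finset.sum_mul, sum_dt]; ring
  have hq0 : 0 ≤ 7 / 2 * (A / a₀) := by positivity
  -- Apart from the first, each starting gradient is bounded across the interface by `G` of the
  -- preceding step, and the grading of the time steps replaces its weight by twice the preceding
  -- step length, so the sum is one over the dissipation again.
  have hsums : ∑ i, S.dt i * semi1Sq Ω (z i (S.left i))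
      ≤ (16 * C_H ^ 2 + 2 * (7 / 2 * (A / a₀)) * (X / (a₀ / 24))) * Q := by
    rw [Fin.sum_univ_succ]
    have h1 : ∑ i : Fin S.N, S.dt i.succ * semi1Sq Ω (z i.succ (S.left i.succ))
        ≤ ∑ i : Fin S.N, 2 * (7 / 2 * (A / a₀)) * (S.dt i.castSucc * G i.castSucc) := by
      refine Finset.sum_le_sum fun i _ => ?_
      have h2 := (semi1Sq_left_succ_le hΩ hzfe i (hΛ i.castSucc) hK hst).trans
        (mul_le_mul_of_nonneg_left (hsG i.castSucc) hq0)
      calc _ ≤ 2 * S.dt i.castSucc * (7 / 2 * (A / a₀) * G i.castSucc) :=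
            mul_le_mul (hgr i) h2 (semi1Sq_nonneg _ _)
              (mul_nonneg (by norm_num) (S.dt_pos _).le)
        _ = _ := by ring
    rw [← Finset.mul_sum] at h1
    have h2 : ∑ i : Fin S.N, S.dt i.castSucc * G i.castSucc ≤ ∑ i, S.dt i * G i := by
      rw [Fin.sum_univ_castSucc (f := fun i => S.dt i * G i)]
      linarith [hkG0 (Fin.last S.N)]
    have h3 := mul_le_mul_of_nonneg_left (h2.trans hsumG)
      (show 0 ≤ 2 * (7 / 2 * (A / a₀)) by positivity)
    linarith
  have hsumz : ∑ i, S.dt i * S.slabTerm i (z i) ≤ C₁ * (T * X + X / (a₀ / 24) + C₃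
      + (16 * C_H ^ 2 + 2 * (7 / 2 * (A / a₀)) * (X / (a₀ / 24)))) * Q := by
    calc _ ≤ ∑ i, C₁ * (S.dt i * norm0Sq Ω (z i (S.left i)) + S.dt i * G i + S.dt i * D i
          + S.dt i * semi1Sq Ω (z i (S.left i))) := Finset.sum_le_sum fun i _ => by
          have := mul_le_mul_of_nonneg_left (hslab i) (S.dt_pos i).le
          linarith
      _ = C₁ * (∑ i, S.dt i * norm0Sq Ω (z i (S.left i)) + ∑ i, S.dt i * G i
          + ∑ i, S.dt i * D i + ∑ i, S.dt i * semi1Sq Ω (z i (S.left i))) := by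
          rw [← Finset.mul_sum, Finset.sum_add_distrib, Finset.sum_add_distrib,
            Finset.sum_add_distrib]
      _ ≤ C₁ * (T * X * Q + X / (a₀ / 24) * Q + C₃ * Q
          + (16 * C_H ^ 2 + 2 * (7 / 2 * (A / a₀)) * (X / (a₀ / 24))) * Q) := by gcongr
      _ = _ := by ring
  have hXX : X * Q ≤ (X + C₁ * (X + C₃)) * Q := by
    gcongr
    have : 0 ≤ C₁ * (X + C₃) := by positivity
    linarith
  have hfinal := energySq_sub_le hΩ hreg hregz (X := (X + C₁ * (X + C₃)) * Q)
    (by rw [← S.left_zero]; exact (hL 0).trans hXX)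
    (fun i => by
      refine (hmid i).trans ?_
      have h1 := mul_le_mul_of_nonneg_left (add_le_add (hL i) (hkD i)) hC₁0
      have h2 : 0 ≤ X * Q := by positivity
      linarith)
    (fun i => (hR' i).trans hXX) hsumz
  rw [hsplit]
  refine hfinal.trans ?_
  have he₀Q : e₀ ≤ Q := by linarith
  rw [errorConst]
  linarith

end SpaceTimeMesh

end MovingFE

end

/-! ### The theorem: choice of constants and passage to the infimum. -/

theorem theorem3p1 (d : ℕ) (hd : 1 ≤ d ∧ d ≤ 3)
    (Ω : Set (MovingFE.Sp d)) (hΩo : IsOpen Ω) (hΩb : Bornology.IsBounded Ω)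
    (T : ℝ) (hT : 0 < T)
    -- the coefficients of the differential equation
    (a : MovingFE.Sp d → ℝ → ℝ) (b : MovingFE.Sp d → ℝ → MovingFE.Sp d)
    (c : MovingFE.Sp d → ℝ → ℝ)
    (ha : ContDiffOn ℝ ∞ (Function.uncurry a) (closure Ω ×ˢ Set.Icc 0 T))
    (hb : ContDiffOn ℝ ∞ (Function.uncurry b) (closure Ω ×ˢ Set.Icc 0 T))
    (hc : ContDiffOn ℝ ∞ (Function.uncurry c) (closure Ω ×ˢ Set.Icc 0 T))
    (amin : ℝ) (hamin : 0 < amin) (ha_ge : ∀ x ∈ closure Ω, ∀ t ∈ Set.Icc 0 T, amin ≤ a x t)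
    (cmin : ℝ) (hcmin : 0 ≤ cmin) (hc_ge : ∀ x ∈ closure Ω, ∀ t ∈ Set.Icc 0 T, cmin ≤ c x t)
    -- the constants of the assumptions on the mesh
    (μ κ C_H : ℝ) (hμ : 0 < μ) (hκ : 0 < κ) (hC_H : 0 < C_H) :
    ∃ C : ℝ, 0 < C ∧ ∀ α : ℝ, 0 < α → ∃ δ : ℝ, 0 < δ ∧
      ∀ S : MovingFE.SpaceTimeMesh d Ω T,
        (∀ i, S.dt i ≤ δ) →
        -- bounds at the collocation nodes
        (∀ i, ∀ t ∈ ({S.tmid (2 / 3) i, S.right i} : Set ℝ), ∀ x ∈ Ω,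
          |S.charDeriv i (fun s y => a y s) t x| ≤ α ∧ ‖b x t - (S.mesh i).vel t x‖ ≤ κ) →
        -- space-time shape regularity
        (∀ i, ∀ t ∈ S.slab i, (S.mesh i).ShapeRegularAt (S.left i) (S.dt i) μ t) →
        -- controlled mesh discontinuities, initial projection and graded time steps
        (∃ C_AH : ℝ, C_AH ≤ 7 / 2 ∧ S.IsStabilityConstant a C_AH) →
        S.InitialProjectionStable C_H →
        (∀ i : Fin S.N, S.dt i.succ ≤ 2 * S.dt i.castSucc) →
        ∀ (f g : MovingFE.Sp d → ℝ → ℝ) (u₀ : MovingFE.Sp d → ℝ) (u : ℝ → MovingFE.Sp d → ℝ)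
          (uh : S.SlabFun),
          ContDiffOn ℝ ∞ (Function.uncurry f) (closure Ω ×ˢ Set.Icc 0 T) →
          (∀ t ∈ Set.Ioc 0 T, IntegrableOn (fun x => g x t) (frontier Ω)
            (Measure.euclideanHausdorffMeasure (d - 1))) →
          MemLp u₀ 2 (volume.restrict Ω) →
          S.IsWeakSolution a b c f g u₀ u →
          S.HasSecondCharDeriv u →
          S.IsDiscreteSolution (2 / 3) a b c f g u₀ uh →
          S.energySq (2 / 3) (fun i t x => u t x - uh i t x) ≤
            C * ((⨅ χ : S.feSpace, S.energySq (2 / 3) (fun i t x => u t x - χ.1 i t x))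
              + ∑ i, ∫ t in (S.left i)..(S.right i),
                  MovingFE.norm1Sq Ω
                    (fun x => S.dt i ^ 2 * S.charDeriv i (S.charDeriv i u) t x)) := by
  have hfin : IsFiniteMeasure (volume.restrict Ω) :=
    ⟨by rw [Measure.restrict_apply_univ]; exact hΩb.measure_lt_top⟩
  obtain ⟨A, B, c₀, δ, hA, hB, hc₀, hδ, -, hstep⟩ := MovingFE.SpaceTimeMesh.exists_stepBounds
    hΩo hΩb ha.continuousOn hb.continuousOn hc.continuousOn hamin ha_ge hμ hκ
  have hC := MovingFE.SpaceTimeMesh.errorConst_pos (A := A) (κ := κ) (B := B) (c₀ := c₀)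
    hamin hA.le hT.le C_H
  refine ⟨MovingFE.SpaceTimeMesh.errorConst A κ B amin c₀ T C_H, hC, fun α _ => ⟨δ, hδ, ?_⟩⟩
  rintro S hdt hnodes hreg ⟨K, hK, hst⟩ hproj hgr f g u₀ u uh - - - hu hu2 huh
  have hsb := hstep S hdt (fun i t ht x hx => (hnodes i t ht x hx).2) hreg
  -- An infimum over an empty family would be `0` by default; `u_h` itself shows that the family is
  -- nonempty.
  have hne : Nonempty S.feSpace := ⟨⟨uh, huh.1⟩⟩
  -- Isolating the infimum turns the claim into a lower bound for every member of the family, which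
  -- is the estimate for a single comparison function.
  rw [← div_le_iff₀' hC, ← sub_le_iff_le_add]
  refine le_ciInf fun χ => ?_
  rw [sub_le_iff_le_add, div_le_iff₀' hC]
  exact MovingFE.SpaceTimeMesh.energySq_error_le hΩo hT hamin hA.le hB hc₀ hsb hK hst
    hproj hgr hu hu2 huh χ.2
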